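/- Let $\mathbf{Cat}$ be the 2-category of small categories, with its canonical model structure (weak equivalences: the equivalences of categories; fibrations: the isofibrations). Let $\mathrm{End}_f(\mathbf{Cat})$ be the 2-category of finitary (i.e. filtered-colimit preserving) endo-2-functors of $\mathbf{Cat}$, 2-natural transformations and modifications, with its canonical model structure: the weak equivalences are the equivalences of this 2-category, and the fibrations are its isofibrations, i.e. the $p\colon S\to T$ such that for all $X$, $\alpha\colon X\to S$ and $\beta\colon X\to T$, every invertible 2-cell $p\alpha\cong\beta$ is of the form $p\theta$ for an invertible 2-cell $\theta\colon\alpha\cong\alpha'$ with $p\alpha'=\beta$. Let $\mathrm{Mnd}_f(\mathbf{Cat})$ be the category of finitary 2-monads on $\mathbf{Cat}$ and their (strict) morphisms, with the Lack model structure, whose weak equivalences and fibrations are created by the forgetful functor $\mathrm{Mnd}_f(\mathbf{Cat})\to\mathrm{End}_f(\mathbf{Cat})$; a finitary 2-monad is called flexible if it is cofibrant in this model structure, i.e. if the morphism from the initial (identity) 2-monad to it has the left lifting property with respect to all morphisms that are both fibrations and weak equivalences. For a finitary 2-monad $T$ let $T\text{-}\mathrm{Alg}$ be the category of strict $T$-algebras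 and strict morphisms. Let $f\colon T\to T'$ be a weak equivalence in $\mathrm{Mnd}_f(\mathbf{Cat})$ between flexible finitary 2-monads. Then $T\text{-}\mathrm{Alg}$ and $T'\text{-}\mathrm{Alg}$ carry the Lack model structures, i.e. the model structures whose weak equivalences and fibrations are created by the forgetful functors to $\mathbf{Cat}$; the restriction functor $f^*\colon T'\text{-}\mathrm{Alg}\to T\text{-}\mathrm{Alg}$ has a left adjoint $f_!$; and $f_!\dashv f^*$ is a Quillen equivalence, that is, $f_!$ preserves cofibrations and trivial cofibrations and, for every cofibrant $T$-algebra $A$ and every fibrant $T'$-algebra $B$, a morphism $f_!A\to B$ is a weak equivalence if and only if its adjunct $A\to f^*B$ is. -/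

import Mathlib

open CategoryTheory CategoryTheory.Limits HomotopicalAlgebra

universe u

namespace CatTwoMonad

open scoped Bicategory

/-! ## The canonical model structure on `Cat` -/

/-- The weak equivalences of the canonical model structure on the category of small categories:
the equivalences of categories. -/
def catWeakEquivalences : MorphismProperty Cat.{u, u} :=
  fun _ _ F => F.toFunctor.IsEquivalence

/-- The fibrations of the canonical model structure on the category of small categories:
the isofibrations, i.e. the functors along which isomorphisms `F x ≅ y` lift to
isomorphisms with source `x`. -/
def catFibrations : MorphismProperty Cat.{u, u} :=
  fun A B F => ∀ (x : A) (y : B) (e : F.toFunctor.obj x ≅ y),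
    ∃ (x' : A) (e' : x ≅ x') (h : F.toFunctor.obj x' = y),
      F.toFunctor.mapIso e' ≪≫ eqToIso h = e

/-! ## The 2-category of finitary endo-2-functors of `Cat` -/

/-- A (strict) endo-2-functor of the 2-category `Cat` of small categories. -/
structure TwoEndofunctor extends Cat.{u, u} ⥤ Cat.{u, u} where
  /-- The action on 2-cells. -/
  map₂ {A B : Cat.{u, u}} {F G : A ⟶ B} (θ : F ⟶ G) : map F ⟶ map G
  map₂_id {A B : Cat.{u, u}} (F : A ⟶ B) : map₂ (𝟙 F) = 𝟙 (map F)
  map₂_comp {A B : Cat.{u, u}} {F G H : A ⟶ B} (θ : F ⟶ G) (κ : G ⟶ H) :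
    map₂ (θ ≫ κ) = map₂ θ ≫ map₂ κ
  map₂_whiskerLeft {A B C : Cat.{u, u}} (F : A ⟶ B) {G H : B ⟶ C} (θ : G ⟶ H) :
    map₂ (F ◁ θ) = eqToHom (map_comp F G) ≫ map F ◁ map₂ θ ≫ eqToHom (map_comp F H).symm
  map₂_whiskerRight {A B C : Cat.{u, u}} {F G : A ⟶ B} (θ : F ⟶ G) (H : B ⟶ C) :
    map₂ (θ ▷ H) = eqToHom (map_comp F H) ≫ map₂ θ ▷ map H ≫ eqToHom (map_comp G H).symm

/-- An endo-2-functor of `Cat`, as a strict pseudofunctor in the sense of Mathlib. -/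
def TwoEndofunctor.toStrictPseudofunctor (T : TwoEndofunctor.{u}) :
    StrictPseudofunctor Cat.{u, u} Cat.{u, u} :=
  StrictPseudofunctor.mk''
    { obj := T.obj
      map := T.map
      map₂ := T.map₂
      map₂_id := T.map₂_id
      map₂_comp := T.map₂_comp
      map_id := T.map_id
      map_comp := T.map_comp
      map₂_whisker_left := T.map₂_whiskerLeft
      map₂_whisker_right := T.map₂_whiskerRight }

/-- A finitary endo-2-functor of `Cat`: one that preserves filtered colimits. -/
structure FinitaryEndo extends TwoEndofunctor.{u} where
  finitary : PreservesFilteredColimits toFunctor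

/-- A 2-natural transformation between endo-2-functors of `Cat`. -/
@[ext]
structure TwoNatTrans (S T : TwoEndofunctor.{u}) extends NatTrans S.toFunctor T.toFunctor where
  naturality₂ {A B : Cat.{u, u}} {F G : A ⟶ B} (θ : F ⟶ G) :
    S.map₂ θ ▷ app B =
      eqToHom (naturality F) ≫ app A ◁ T.map₂ θ ≫ eqToHom (naturality G).symm

lemma whiskerRight_comp_cat {A B C D : Cat.{u, u}} {F G : A ⟶ B} (θ : F ⟶ G) (H : B ⟶ C)
    (K : C ⟶ D) : θ ▷ (H ≫ K) = (θ ▷ H) ▷ K := rfl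

lemma whiskerLeft_comp_cat {A B C D : Cat.{u, u}} (F : A ⟶ B) (G : B ⟶ C) {H K : C ⟶ D}
    (θ : H ⟶ K) : (F ≫ G) ◁ θ = F ◁ G ◁ θ := rfl

lemma whisker_assoc_cat {A B C D : Cat.{u, u}} (F : A ⟶ B) {G H : B ⟶ C} (θ : G ⟶ H)
    (K : C ⟶ D) : (F ◁ θ) ▷ K = F ◁ (θ ▷ K) := rfl

/-- The identity 2-natural transformation. -/
def TwoNatTrans.id (T : TwoEndofunctor.{u}) : TwoNatTrans T T where
  toNatTrans := 𝟙 T.toFunctor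
  naturality₂ θ := by
    ext x
    simp

/-- The vertical composite of 2-natural transformations. -/
def TwoNatTrans.comp {R S T : TwoEndofunctor.{u}} (α : TwoNatTrans R S) (β : TwoNatTrans S T) :
    TwoNatTrans R T where
  toNatTrans := NatTrans.vcomp α.toNatTrans β.toNatTrans
  naturality₂ {A B F G} θ := by
    have h1 := α.naturality₂ θ
    have h2 := β.naturality₂ θ
    simp only [NatTrans.vcomp_app]
    rw [whiskerRight_comp_cat, h1, whiskerLeft_comp_cat]
    simp only [Bicategory.comp_whiskerRight, whisker_assoc_cat, h2, Bicategory.whiskerLeft_comp,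
      Bicategory.eqToHom_whiskerRight, Bicategory.whiskerLeft_eqToHom, Category.assoc,
      eqToHom_trans, eqToHom_trans_assoc]

/-- The category `End_f(Cat)` of finitary endo-2-functors of `Cat` and 2-natural
transformations. -/
instance : Category FinitaryEndo.{u} where
  Hom S T := TwoNatTrans S.toTwoEndofunctor T.toTwoEndofunctor
  id T := TwoNatTrans.id T.toTwoEndofunctor
  comp α β := TwoNatTrans.comp α β
  id_comp _ := TwoNatTrans.ext (funext fun _ => Category.id_comp _)
  comp_id _ := TwoNatTrans.ext (funext fun _ => Category.comp_id _)
  assoc _ _ _ := TwoNatTrans.ext (funext fun _ => Category.assoc _ _ _)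

/-- An invertible modification between 2-natural transformations, i.e. an invertible 2-cell
of the 2-category `End_f(Cat)`. -/
structure ModificationIso {S T : FinitaryEndo.{u}} (α β : S ⟶ T) where
  /-- The components of the modification. -/
  app (A : Cat.{u, u}) : α.app A ≅ β.app A
  naturality {A B : Cat.{u, u}} (F : A ⟶ B) :
    S.map F ◁ (app B).hom =
      eqToHom (α.naturality F) ≫ (app A).hom ▷ T.map F ≫ eqToHom (β.naturality F).symm

/-- The weak equivalences of the canonical model structure on the 2-category `End_f(Cat)`:
the equivalences of this 2-category. -/
def endoWeakEquivalences : MorphismProperty FinitaryEndo.{u} :=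
  fun S T α => ∃ β : T ⟶ S,
    Nonempty (ModificationIso (α ≫ β) (𝟙 S)) ∧ Nonempty (ModificationIso (β ≫ α) (𝟙 T))

/-- The fibrations of the canonical model structure on the 2-category `End_f(Cat)`:
the isofibrations of this 2-category, i.e. the 2-natural transformations `p : S ⟶ T` such that,
for every `X`, each invertible 2-cell `α ≫ p ≅ β` with `α : X ⟶ S` lifts to an invertible
2-cell `α ≅ α'` with `α' ≫ p = β`. -/
def endoFibrations : MorphismProperty FinitaryEndo.{u} :=
  fun S T p => ∀ (X : FinitaryEndo.{u}) (α : X ⟶ S) (β : X ⟶ T) (m : ModificationIso (α ≫ p) β),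
    ∃ (α' : X ⟶ S) (n : ModificationIso α α') (h : α' ≫ p = β),
      ∀ A : Cat.{u, u},
        (n.app A).hom ▷ p.app A ≫ eqToHom (congrArg (fun γ : X ⟶ T => γ.app A) h) = (m.app A).hom

/-! ## The category of finitary 2-monads on `Cat` and its Lack model structure -/

/-- A finitary 2-monad on `Cat`: a finitary endo-2-functor with a monad structure whose unit and
multiplication are 2-natural. -/
structure FinitaryMonad extends CategoryTheory.Monad Cat.{u, u}, FinitaryEndo.{u} where
  η_naturality₂ {A B : Cat.{u, u}} {F G : A ⟶ B} (θ : F ⟶ G) :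
    θ ▷ η.app B =
      eqToHom (η.naturality F) ≫ η.app A ◁ map₂ θ ≫ eqToHom (η.naturality G).symm
  μ_naturality₂ {A B : Cat.{u, u}} {F G : A ⟶ B} (θ : F ⟶ G) :
    map₂ (map₂ θ) ▷ μ.app B =
      eqToHom (μ.naturality F) ≫ μ.app A ◁ map₂ θ ≫ eqToHom (μ.naturality G).symm

/-- A morphism of finitary 2-monads: a 2-natural transformation which is compatible with the
units and the multiplications. -/
@[ext]
structure FinitaryMonad.Hom (S T : FinitaryMonad.{u}) where
  /-- The underlying morphism of monads. -/
  toMonadHom : S.toMonad ⟶ T.toMonad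
  naturality₂ {A B : Cat.{u, u}} {F G : A ⟶ B} (θ : F ⟶ G) :
    S.map₂ θ ▷ toMonadHom.app B =
      eqToHom (toMonadHom.naturality F) ≫ toMonadHom.app A ◁ T.map₂ θ ≫
        eqToHom (toMonadHom.naturality G).symm

/-- The 2-natural transformation underlying a morphism of finitary 2-monads. -/
def FinitaryMonad.Hom.toTwoNatTrans {S T : FinitaryMonad.{u}} (f : FinitaryMonad.Hom S T) :
    TwoNatTrans S.toTwoEndofunctor T.toTwoEndofunctor where
  toNatTrans := f.toMonadHom.toNatTrans
  naturality₂ := f.naturality₂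

/-- The category `Mnd_f(Cat)` of finitary 2-monads on `Cat`. -/
instance : Category FinitaryMonad.{u} where
  Hom S T := FinitaryMonad.Hom S T
  id T := ⟨𝟙 T.toMonad, (TwoNatTrans.id T.toTwoEndofunctor).naturality₂⟩
  comp f g := ⟨f.toMonadHom ≫ g.toMonadHom, (f.toTwoNatTrans.comp g.toTwoNatTrans).naturality₂⟩
  id_comp f := FinitaryMonad.Hom.ext (Category.id_comp f.toMonadHom)
  comp_id f := FinitaryMonad.Hom.ext (Category.comp_id f.toMonadHom)
  assoc f g h := FinitaryMonad.Hom.ext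
    (Category.assoc f.toMonadHom g.toMonadHom h.toMonadHom)

/-- The forgetful functor `Mnd_f(Cat) ⥤ End_f(Cat)`. -/
def forgetToEndo : FinitaryMonad.{u} ⥤ FinitaryEndo.{u} where
  obj T := T.toFinitaryEndo
  map f := f.toTwoNatTrans

/-- The weak equivalences of the Lack model structure on `Mnd_f(Cat)`. -/
instance : CategoryWithWeakEquivalences FinitaryMonad.{u} where
  weakEquivalences := endoWeakEquivalences.inverseImage forgetToEndo

/-- The fibrations of the Lack model structure on `Mnd_f(Cat)`. -/
instance : CategoryWithFibrations FinitaryMonad.{u} where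
  fibrations := endoFibrations.inverseImage forgetToEndo

/-- The cofibrations of the Lack model structure on `Mnd_f(Cat)`: the morphisms with the left
lifting property with respect to the trivial fibrations. -/
instance : CategoryWithCofibrations FinitaryMonad.{u} where
  cofibrations := (trivialFibrations FinitaryMonad.{u}).llp

/-- The identity 2-monad on `Cat`. -/
def idMonad : FinitaryMonad.{u} where
  toMonad := CategoryTheory.Monad.id Cat.{u, u}
  map₂ θ := θ
  map₂_id _ := rfl
  map₂_comp _ _ := rfl
  map₂_whiskerLeft _ _ _ _ := (Category.id_comp _).symm.trans
    (congrArg _ (Category.comp_id _).symm)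
  map₂_whiskerRight _ _ := (Category.id_comp _).symm.trans
    (congrArg _ (Category.comp_id _).symm)
  finitary := inferInstanceAs (PreservesFilteredColimits (𝟭 Cat.{u, u}))
  η_naturality₂ _ := (Category.id_comp _).symm.trans
    (congrArg _ (Category.comp_id _).symm)
  μ_naturality₂ _ := (Category.id_comp _).symm.trans
    (congrArg _ (Category.comp_id _).symm)

/-- The identity 2-monad is the initial finitary 2-monad. -/
def idMonadIsInitial : IsInitial idMonad.{u} :=
  IsInitial.ofUniqueHom
    (fun T => ⟨⟨T.η, fun X => Category.id_comp _, fun X => by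
      change 𝟙 X ≫ T.η.app X = (T.η.app X ≫ T.η.app (T.obj X)) ≫ T.μ.app X
      rw [Category.assoc, T.left_unit, Category.id_comp]
      exact (Category.comp_id _).symm⟩, T.η_naturality₂⟩)
    (fun T f => FinitaryMonad.Hom.ext (MonadHom.ext (funext fun X =>
      (Category.id_comp _).symm.trans (f.toMonadHom.app_η X))))

instance : HasInitial FinitaryMonad.{u} := idMonadIsInitial.hasInitial

/-- Flexible finitary 2-monads: the cofibrant objects of the Lack model structure on
`Mnd_f(Cat)`. -/
def FinitaryMonad.IsFlexible (T : FinitaryMonad.{u}) : Prop :=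
  IsCofibrant T

/-! ## Algebras -/

/-- The category of (strict) algebras of a finitary 2-monad on `Cat` and (strict) morphisms. -/
abbrev FinitaryMonad.Alg (T : FinitaryMonad.{u}) : Type (u + 1) :=
  T.toMonad.Algebra

/-- The restriction functor `T'-Alg ⥤ T-Alg` induced by a morphism `f : T ⟶ T'` of finitary
2-monads. -/
abbrev restrict {T T' : FinitaryMonad.{u}} (f : T ⟶ T') : T'.Alg ⥤ T.Alg :=
  CategoryTheory.Monad.algebraFunctorOfMonadHom f.toMonadHom

/-- A model structure on `T`-algebras is the Lack model structure if its weak equivalences and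
its fibrations are created by the forgetful functor to `Cat`, endowed with the canonical model
structure. (Its cofibrations are then determined by the lifting property.) -/
structure IsLackModelStructure (T : FinitaryMonad.{u}) (M : ModelCategory T.Alg) : Prop where
  weakEquivalences_eq :
    weakEquivalences T.Alg = catWeakEquivalences.inverseImage T.toMonad.forget
  fibrations_eq : fibrations T.Alg = catFibrations.inverseImage T.toMonad.forget

/-! ## Quillen equivalences -/

/-- An adjunction between model categories is a Quillen equivalence if the left adjoint preserves
cofibrations and trivial cofibrations and, for `X` cofibrant and `Y` fibrant, a morphism
`F X ⟶ Y` is a weak equivalence if and only if its adjunct `X ⟶ G Y` is. -/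
structure IsQuillenEquivalence {C D : Type*} [Category* C] [Category* D] [ModelCategory C]
    [ModelCategory D] {F : C ⥤ D} {G : D ⥤ C} (adj : F ⊣ G) : Prop where
  map_cofibration {X Y : C} (i : X ⟶ Y) : Cofibration i → Cofibration (F.map i)
  map_trivialCofibration {X Y : C} (i : X ⟶ Y) :
    Cofibration i → WeakEquivalence i → WeakEquivalence (F.map i)
  weakEquivalence_iff {X : C} {Y : D} (φ : F.obj X ⟶ Y) :
    IsCofibrant X → IsFibrant Y →
      (WeakEquivalence φ ↔ WeakEquivalence (adj.homEquiv X Y φ))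

end CatTwoMonad

/-! Restriction along `f` does not change underlying functors. In `Cat`, the adjunct of `φ : F A ⟶
B` is therefore the unit `η : A ⟶ F A` followed by `φ`, and by two-out-of-three the theorem reduces
to `isEquivalence_unit`: the unit is an equivalence of categories at every cofibrant algebra. That
`F` preserves cofibrations and trivial cofibrations is formal, since restriction preserves trivial
fibrations and fibrations.

The unit is handled by inverting `f` up to homotopy through strict morphisms of monads. Let `pow X`
be the category of isomorphisms in `X`. The comparison `lam : T (pow X) ⟶ pow (T X)` is a
distributive law, so `pow ∘ T` is a monad `T.powMonad`, and the isomorphisms in a `T`-algebra form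
an algebra over it. A monad morphism into `T.powMonad` is a homotopy between its two composites with
`evHom`. The pairs consisting of `t` in `T X` and an isomorphism `f t ≅ t'` in `T' X` form a
finitary 2-monad, `cylFinitaryMonad f` (a mapping path object), whose projection to `t'` is a
trivial fibration onto `T'`. As `T'` is flexible, this projection has a section, which amounts to `g
: T' ⟶ T` with a homotopy `h` from `g ≫ f` to the identity (`exists_homotopySection`). As the
components of `f` are fully faithful, `h` lifts to a homotopy `k` from `f ≫ g` to the identity
(`exists_homotopyLift`).

Let `A` be cofibrant. Restricted along `k`, the isomorphisms in `A` form a `T`-algebra whose target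
projection is a trivial fibration onto `A`, hence has a section. The source of this section is a
morphism from `A` to the restriction of `A` along `f ≫ g`; its transpose `v` goes from `F A` to the
restriction of `A` along `g`. The section is an isomorphism from `η ≫ v` to the identity.
Transposing its image under `pow η` gives an isomorphism from `v ≫ η` to the identity, because
morphisms out of `F A` are determined by their composite with `η`.

The model structures are transferred from `Cat` along the free-forgetful adjunction. Colimits of
algebras come from a sequential construction and the adjoint functor theorem, smallness from the
description of filtered colimits of categories on arrows, and the acyclicity condition from a path
object argument in which every algebra is fibrant (`weakEquivalences_of_llp_fibrations`). -/

namespace CatTwoMonad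

open scoped Bicategory

/-! ## Functors and their action on arrows -/

section Arrows

variable {C D E : Type u} [Category.{u} C] [Category.{u} D] [Category.{u} E]

/-- The action of a functor on arrows. -/
def mapA (F : C ⥤ D) (a : Arrow C) : Arrow D := Arrow.mk (F.map a.hom)

@[simp] lemma mapA_mk (F : C ⥤ D) {x y : C} (f : x ⟶ y) :
    mapA F (Arrow.mk f) = Arrow.mk (F.map f) := rfl

@[simp] lemma mapA_left (F : C ⥤ D) (a : Arrow C) : (mapA F a).left = F.obj a.left := rfl

@[simp] lemma mapA_right (F : C ⥤ D) (a : Arrow C) : (mapA F a).right = F.obj a.right := rfl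

/-- Arrows live in a single type, so equality of functors can be tested on them without transport
along equalities of objects. -/
lemma functor_ext_mapA {F G : C ⥤ D} (h : ∀ a, mapA F a = mapA G a) : F = G :=
  Arrow.functor_ext fun _ _ f => h (Arrow.mk f)

/-- The identity arrow of an object. -/
abbrev idA (x : C) : Arrow C := Arrow.mk (𝟙 x)

lemma mapA_idA (F : C ⥤ D) (x : C) : mapA F (idA x) = idA (F.obj x) := by
  simp [idA]

lemma idA_injective {x y : C} (h : idA x = idA y) : x = y :=
  congrArg (fun c : Arrow C => c.left) h

lemma arrow_mk_comp_congr {x y z x' y' z' : C} {f : x ⟶ y} {g : y ⟶ z} {f' : x' ⟶ y'}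
    {g' : y' ⟶ z'} (hf : Arrow.mk f = Arrow.mk f') (hg : Arrow.mk g = Arrow.mk g') :
    Arrow.mk (f ≫ g) = Arrow.mk (f' ≫ g') := by
  obtain rfl : x = x' := congrArg (fun c : Arrow C => c.left) hf
  obtain rfl : y = y' := congrArg (fun c : Arrow C => c.right) hf
  obtain rfl : z = z' := congrArg (fun c : Arrow C => c.right) hg
  rw [Arrow.mk_injective _ _ hf, Arrow.mk_injective _ _ hg]

lemma exists_comp_of_mapA_eq (F : C ⥤ D) {a b : Arrow C} (e : a.right = b.left) {x y z : D}
    {f : x ⟶ y} {g : y ⟶ z} (ha : mapA F a = Arrow.mk f) (hb : mapA F b = Arrow.mk g) :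
    ∃ (x' y' z' : C) (f' : x' ⟶ y') (g' : y' ⟶ z'), a = Arrow.mk f' ∧ b = Arrow.mk g' ∧
      Arrow.mk (F.map (f' ≫ g')) = Arrow.mk (f ≫ g) := by
  refine ⟨a.left, b.left, b.right, a.hom ≫ eqToHom e, b.hom,
    Arrow.ext rfl e (by simp), rfl, ?_⟩
  rw [Functor.map_comp]
  refine arrow_mk_comp_congr (Eq.trans ?_ ha) hb
  rw [Functor.map_comp, eqToHom_map]
  exact Arrow.arrow_mk_comp_eqToHom _ _

/-- A map on arrows that is compatible with identities and composition. -/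
structure IsFunctorialOnArrows {C : Type*} [Category* C] {D : Type*} [Category* D]
    (φ : Arrow C → Arrow D) : Prop where
  id (x : C) : ∃ y : D, φ (Arrow.mk (𝟙 x)) = Arrow.mk (𝟙 y)
  -- The composable pair is existentially quantified because the end points of the images of two
  -- composable arrows agree only propositionally.
  comp {x y z : C} (f : x ⟶ y) (g : y ⟶ z) : ∃ (x' y' z' : D) (f' : x' ⟶ y') (g' : y' ⟶ z'),
    φ (Arrow.mk f) = Arrow.mk f' ∧ φ (Arrow.mk g) = Arrow.mk g' ∧
      φ (Arrow.mk (f ≫ g)) = Arrow.mk (f' ≫ g')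

end Arrows

namespace IsFunctorialOnArrows

variable {C D : Type*} [Category* C] [Category* D] {φ : Arrow C → Arrow D}
  (h : IsFunctorialOnArrows φ)

include h

/-- Apply `comp` to `𝟙 x` and `f`: the source of `φ f` is the target of `φ (𝟙 x)`, which is an
identity. -/
lemma left_eq {x y : C} (f : x ⟶ y) :
    (φ (Arrow.mk f)).left = (φ (Arrow.mk (𝟙 x))).left := by
  obtain ⟨x', y', z', f', g', h₁, h₂, -⟩ := h.comp (𝟙 x) f
  obtain ⟨w, hw⟩ := h.id x
  have e₁ : x' = w := congrArg (fun c : Arrow D => c.left) (h₁.symm.trans hw)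
  have e₂ : y' = w := congrArg (fun c : Arrow D => c.right) (h₁.symm.trans hw)
  rw [h₁, h₂]
  exact e₂.trans e₁.symm

lemma right_eq {x y : C} (f : x ⟶ y) :
    (φ (Arrow.mk f)).right = (φ (Arrow.mk (𝟙 y))).left := by
  obtain ⟨x', y', z', f', g', h₁, h₂, -⟩ := h.comp f (𝟙 y)
  rw [h₁, h₂]
  rfl

/-- The functor with a given action on arrows. -/
def functor : C ⥤ D where
  obj x := (φ (Arrow.mk (𝟙 x))).left
  map {x y} f := eqToHom (h.left_eq f).symm ≫ (φ (Arrow.mk f)).hom ≫ eqToHom (h.right_eq f)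
  map_id x := by
    obtain ⟨w, hw⟩ := h.id x
    rw [arrow_hom_eq' hw]
    simp
  map_comp {x y z} f g := by
    obtain ⟨x', y', z', f', g', h₁, h₂, h₃⟩ := h.comp f g
    rw [arrow_hom_eq' h₁, arrow_hom_eq' h₂, arrow_hom_eq' h₃]
    simp
where
  arrow_hom_eq' {a b : Arrow D} (h : a = b) :
    a.hom = eqToHom (congrArg (fun c : Arrow D => c.left) h) ≫ b.hom ≫
      eqToHom (congrArg (fun c : Arrow D => c.right) h).symm := by
    subst h
    simp

lemma mk_functor_map {x y : C} (f : x ⟶ y) : Arrow.mk (h.functor.map f) = φ (Arrow.mk f) := by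
  refine Arrow.ext (h.left_eq f).symm (h.right_eq f).symm ?_
  simp [functor]

end IsFunctorialOnArrows

/-! ## Filtered colimits of categories -/

section FilteredColimits

variable {J : Type u} [SmallCategory J]

/-- A cocone of categories such that every arrow of its point comes from the diagram, and such that
arrows of the diagram that are identified in the point are identified in the diagram. -/
structure IsArrowColimit {D : J ⥤ Cat.{u, u}} (c : Cocone D) : Prop where
  surj (a : Arrow c.pt) : ∃ (j : J) (b : Arrow (D.obj j)), mapA (c.ι.app j).toFunctor b = a
  inj {j : J} (b b' : Arrow (D.obj j)) :
    mapA (c.ι.app j).toFunctor b = mapA (c.ι.app j).toFunctor b' →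
      ∃ (k : J) (f : j ⟶ k), mapA (D.map f).toFunctor b = mapA (D.map f).toFunctor b'

lemma mapA_cocone {D : J ⥤ Cat.{u, u}} (c : Cocone D) {j k : J} (f : j ⟶ k)
    (b : Arrow (D.obj j)) :
    mapA (c.ι.app k).toFunctor (mapA (D.map f).toFunctor b) = mapA (c.ι.app j).toFunctor b := by
  rw [← c.w f]
  rfl

lemma mapA_diagram_comp (D : J ⥤ Cat.{u, u}) {i j k : J} (f : i ⟶ j) (g : j ⟶ k)
    (b : Arrow (D.obj i)) :
    mapA (D.map (f ≫ g)).toFunctor b = mapA (D.map g).toFunctor (mapA (D.map f).toFunctor b) := by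
  rw [D.map_comp]
  rfl

namespace IsArrowColimit

variable {D : J ⥤ Cat.{u, u}} {c : Cocone D} (hc : IsArrowColimit c)

include hc

lemma surj_obj (x : c.pt) : ∃ (j : J) (y : D.obj j), (c.ι.app j).toFunctor.obj y = x := by
  obtain ⟨j, b, hb⟩ := hc.surj (idA x)
  exact ⟨j, b.left, congrArg (fun c : Arrow _ => c.left) hb⟩

lemma inj_obj {j : J} {y y' : D.obj j}
    (h : (c.ι.app j).toFunctor.obj y = (c.ι.app j).toFunctor.obj y') :
    ∃ (k : J) (f : j ⟶ k), (D.map f).toFunctor.obj y = (D.map f).toFunctor.obj y' := by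
  obtain ⟨k, f, hf⟩ := hc.inj (idA y) (idA y') (by rw [mapA_idA, mapA_idA, h])
  exact ⟨k, f, congrArg (fun c : Arrow _ => c.left) hf⟩

variable [IsFiltered J]

lemma inj₂ {j j' : J} (b : Arrow (D.obj j)) (b' : Arrow (D.obj j'))
    (h : mapA (c.ι.app j).toFunctor b = mapA (c.ι.app j').toFunctor b') :
    ∃ (k : J) (f : j ⟶ k) (g : j' ⟶ k),
      mapA (D.map f).toFunctor b = mapA (D.map g).toFunctor b' := by
  obtain ⟨k, f, hf⟩ := hc.inj
    (mapA (D.map (IsFiltered.leftToMax j j')).toFunctor b)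
    (mapA (D.map (IsFiltered.rightToMax j j')).toFunctor b')
    (by rw [mapA_cocone, mapA_cocone, h])
  exact ⟨k, IsFiltered.leftToMax j j' ≫ f, IsFiltered.rightToMax j j' ≫ f, by
    rw [mapA_diagram_comp, mapA_diagram_comp, hf]⟩

lemma surj₂ (a a' : Arrow c.pt) : ∃ (j : J) (b b' : Arrow (D.obj j)),
    mapA (c.ι.app j).toFunctor b = a ∧ mapA (c.ι.app j).toFunctor b' = a' := by
  obtain ⟨j, b, hb⟩ := hc.surj a
  obtain ⟨j', b', hb'⟩ := hc.surj a'
  exact ⟨IsFiltered.max j j', mapA (D.map (IsFiltered.leftToMax j j')).toFunctor b,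
    mapA (D.map (IsFiltered.rightToMax j j')).toFunctor b', by rw [mapA_cocone, hb],
    by rw [mapA_cocone, hb']⟩

/-- Composable arrows of the colimit come from composable arrows of the diagram. -/
lemma surj_comp {x y z : c.pt} (f : x ⟶ y) (g : y ⟶ z) :
    ∃ (j : J) (x' y' z' : D.obj j) (f' : x' ⟶ y') (g' : y' ⟶ z'),
      Arrow.mk ((c.ι.app j).toFunctor.map f') = Arrow.mk f ∧
      Arrow.mk ((c.ι.app j).toFunctor.map g') = Arrow.mk g ∧
      Arrow.mk ((c.ι.app j).toFunctor.map (f' ≫ g')) = Arrow.mk (f ≫ g) := by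
  obtain ⟨j, b, b', hb, hb'⟩ := hc.surj₂ (Arrow.mk f) (Arrow.mk g)
  obtain ⟨k, t, ht⟩ := hc.inj_obj (y := b.right) (y' := b'.left)
    ((congrArg (fun c : Arrow _ => c.right) hb).trans
      (congrArg (fun c : Arrow _ => c.left) hb').symm)
  rw [← mapA_cocone c t] at hb hb'
  obtain ⟨x', y', z', f', g', h₁, h₂, h₃⟩ := exists_comp_of_mapA_eq _ ht hb hb'
  rw [h₁] at hb
  rw [h₂] at hb'
  exact ⟨k, x', y', z', f', g', hb, hb', h₃⟩

/-- The action on arrows of the functor induced by a cocone. -/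
noncomputable def descA (s : Cocone D) (a : Arrow c.pt) : Arrow s.pt :=
  mapA (s.ι.app (hc.surj a).choose).toFunctor (hc.surj a).choose_spec.choose

/-- The chosen representative does not matter: two representatives of one arrow become equal at a
later stage. -/
lemma descA_mapA (s : Cocone D) {j : J} (b : Arrow (D.obj j)) :
    hc.descA s (mapA (c.ι.app j).toFunctor b) = mapA (s.ι.app j).toFunctor b := by
  have h := (hc.surj (mapA (c.ι.app j).toFunctor b)).choose_spec.choose_spec
  obtain ⟨k, f, g, hfg⟩ := hc.inj₂ _ _ h
  rw [descA, ← mapA_cocone s f, hfg, mapA_cocone]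

lemma isFunctorialOnArrows_descA (s : Cocone D) : IsFunctorialOnArrows (hc.descA s) where
  id x := by
    obtain ⟨j, y, rfl⟩ := hc.surj_obj x
    exact ⟨(s.ι.app j).toFunctor.obj y, by
      rw [← idA, ← mapA_idA, descA_mapA, mapA_idA]⟩
  comp f g := by
    obtain ⟨j, x', y', z', f', g', h₁, h₂, h₃⟩ := hc.surj_comp f g
    refine ⟨_, _, _, (s.ι.app j).toFunctor.map f', (s.ι.app j).toFunctor.map g', ?_, ?_, ?_⟩
    · rw [← h₁, ← mapA_mk, descA_mapA, mapA_mk]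
    · rw [← h₂, ← mapA_mk, descA_mapA, mapA_mk]
    · rw [← h₃, ← mapA_mk, descA_mapA, mapA_mk, Functor.map_comp]

/-- A cocone that satisfies the concrete conditions is a colimit cocone. -/
noncomputable def isColimit : IsColimit c where
  desc s := ⟨(hc.isFunctorialOnArrows_descA s).functor⟩
  fac s j := Cat.ext (functor_ext_mapA fun a =>
    ((hc.isFunctorialOnArrows_descA s).mk_functor_map _).trans (hc.descA_mapA s a))
  uniq s m hm := Cat.ext (functor_ext_mapA fun a => by
    obtain ⟨j, b, rfl⟩ := hc.surj a
    refine Eq.trans ?_ (((hc.isFunctorialOnArrows_descA s).mk_functor_map _).trans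
      (hc.descA_mapA s b)).symm
    rw [← hm j]
    rfl)

end IsArrowColimit

lemma IsArrowColimit.of_iso {D : J ⥤ Cat.{u, u}} {c c' : Cocone D} (hc : IsArrowColimit c)
    (e : c ≅ c') : IsArrowColimit c' := by
  have h₁ (j : J) (b : Arrow (D.obj j)) : mapA (c'.ι.app j).toFunctor b =
      mapA e.hom.hom.toFunctor (mapA (c.ι.app j).toFunctor b) := by
    rw [← e.hom.w j]
    rfl
  have h₂ (a : Arrow c'.pt) : mapA e.hom.hom.toFunctor (mapA e.inv.hom.toFunctor a) = a := by
    have := congrArg CoconeMorphism.hom e.inv_hom_id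
    exact congrArg (fun F : c'.pt ⟶ c'.pt => mapA F.toFunctor a) this
  have h₃ (a : Arrow c.pt) : mapA e.inv.hom.toFunctor (mapA e.hom.hom.toFunctor a) = a := by
    have := congrArg CoconeMorphism.hom e.hom_inv_id
    exact congrArg (fun F : c.pt ⟶ c.pt => mapA F.toFunctor a) this
  constructor
  · intro a
    obtain ⟨j, b, hb⟩ := hc.surj (mapA e.inv.hom.toFunctor a)
    exact ⟨j, b, by rw [h₁, hb, h₂]⟩
  · intro j b b' h
    rw [h₁, h₁] at h
    exact hc.inj b b' (by rw [← h₃ (mapA _ b), h, h₃])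

/-! ### The construction of filtered colimits of categories -/

namespace FilteredColimit

variable (D : J ⥤ Cat.{u, u})

/-- Two objects of a diagram of categories are related if they become equal at a later stage. -/
def RelO (p q : Σ j, D.obj j) : Prop :=
  ∃ (k : J) (f : p.1 ⟶ k) (g : q.1 ⟶ k),
    (D.map f).toFunctor.obj p.2 = (D.map g).toFunctor.obj q.2

/-- Two arrows of a diagram of categories are related if they become equal at a later stage. -/
def RelA (p q : Σ j, Arrow (D.obj j)) : Prop :=
  ∃ (k : J) (f : p.1 ⟶ k) (g : q.1 ⟶ k),
    mapA (D.map f).toFunctor p.2 = mapA (D.map g).toFunctor q.2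

/-- Reduces statements on objects, such as transitivity of `RelO`, to statements on arrows. -/
lemma relA_idA_iff (j j' : J) (x : D.obj j) (x' : D.obj j') :
    RelA D ⟨j, idA x⟩ ⟨j', idA x'⟩ ↔ RelO D ⟨j, x⟩ ⟨j', x'⟩ := by
  refine exists_congr fun k => exists_congr fun f => exists_congr fun g => ?_
  dsimp only
  rw [mapA_idA, mapA_idA]
  exact ⟨idA_injective, fun h => congrArg _ h⟩

variable [IsFiltered J]

lemma relA_equivalence : Equivalence (RelA D) where
  refl p := ⟨p.1, 𝟙 _, 𝟙 _, rfl⟩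
  symm := fun ⟨k, f, g, h⟩ => ⟨k, g, f, h.symm⟩
  trans := by
    rintro p q r ⟨k, f, g, h⟩ ⟨k', f', g', h'⟩
    obtain ⟨l, a, b, hab⟩ := IsFiltered.span g f'
    refine ⟨l, f ≫ a, g' ≫ b, ?_⟩
    rw [mapA_diagram_comp, h, ← mapA_diagram_comp, hab, mapA_diagram_comp, h', mapA_diagram_comp]

lemma relO_equivalence : Equivalence (RelO D) where
  refl p := ⟨p.1, 𝟙 _, 𝟙 _, rfl⟩
  symm := fun ⟨k, f, g, h⟩ => ⟨k, g, f, h.symm⟩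
  trans {p q r} h h' := by
    rw [← relA_idA_iff] at h h' ⊢
    exact (relA_equivalence D).trans h h'

/-- The objects of the filtered colimit of a diagram of categories. -/
def Obj : Type u := Quotient ⟨RelO D, relO_equivalence D⟩

/-- The arrows of the filtered colimit of a diagram of categories. -/
def Arr : Type u := Quotient ⟨RelA D, relA_equivalence D⟩

variable {D}

/-- The class of an object. -/
def Obj.mk {j : J} (x : D.obj j) : Obj D := Quotient.mk _ ⟨j, x⟩

/-- The class of an arrow. -/
def Arr.mk {j : J} (a : Arrow (D.obj j)) : Arr D := Quotient.mk _ ⟨j, a⟩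

lemma Obj.mk_eq_iff {j j' : J} {x : D.obj j} {x' : D.obj j'} :
    Obj.mk x = Obj.mk x' ↔ RelO D ⟨j, x⟩ ⟨j', x'⟩ :=
  Quotient.eq (r := ⟨RelO D, relO_equivalence D⟩)

lemma Arr.mk_eq_iff {j j' : J} {a : Arrow (D.obj j)} {a' : Arrow (D.obj j')} :
    Arr.mk a = Arr.mk a' ↔ RelA D ⟨j, a⟩ ⟨j', a'⟩ :=
  Quotient.eq (r := ⟨RelA D, relA_equivalence D⟩)

lemma Obj.exists_rep (x : Obj D) : ∃ (j : J) (y : D.obj j), Obj.mk y = x :=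
  Quotient.inductionOn x fun ⟨j, y⟩ => ⟨j, y, rfl⟩

lemma Arr.exists_rep (x : Arr D) : ∃ (j : J) (y : Arrow (D.obj j)), Arr.mk y = x :=
  Quotient.inductionOn x fun ⟨j, y⟩ => ⟨j, y, rfl⟩

lemma Arr.mk_map {j k : J} (f : j ⟶ k) (a : Arrow (D.obj j)) :
    Arr.mk (mapA (D.map f).toFunctor a) = Arr.mk a :=
  Arr.mk_eq_iff.2 ⟨k, 𝟙 _, f, by rw [D.map_id]; rfl⟩

/-- The source of an arrow of the colimit. -/
def src : Arr D → Obj D :=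
  Quotient.lift (fun p => Obj.mk p.2.left) (by
    rintro ⟨j, a⟩ ⟨j', a'⟩ ⟨k, f, g, h⟩
    exact Obj.mk_eq_iff.2 ⟨k, f, g, congrArg (fun c : Arrow _ => c.left) h⟩)

/-- The target of an arrow of the colimit. -/
def tgt : Arr D → Obj D :=
  Quotient.lift (fun p => Obj.mk p.2.right) (by
    rintro ⟨j, a⟩ ⟨j', a'⟩ ⟨k, f, g, h⟩
    exact Obj.mk_eq_iff.2 ⟨k, f, g, congrArg (fun c : Arrow _ => c.right) h⟩)

/-- The identity arrow of an object of the colimit. -/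
def idArr : Obj D → Arr D :=
  Quotient.lift (fun p => Arr.mk (idA p.2)) (by
    rintro ⟨j, a⟩ ⟨j', a'⟩ h
    exact Arr.mk_eq_iff.2 ((relA_idA_iff D _ _ _ _).2 h))

@[simp] lemma src_mk {j : J} (a : Arrow (D.obj j)) : src (Arr.mk a) = Obj.mk a.left := rfl

@[simp] lemma tgt_mk {j : J} (a : Arrow (D.obj j)) : tgt (Arr.mk a) = Obj.mk a.right := rfl

@[simp] lemma idArr_mk {j : J} (x : D.obj j) : idArr (Obj.mk x) = Arr.mk (idA x) := rfl

/-- Two arrows of the colimit compose to a third one. -/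
def IsComp (a b c : Arr D) : Prop :=
  ∃ (j : J) (x y z : D.obj j) (f : x ⟶ y) (g : y ⟶ z),
    Arr.mk (Arrow.mk f) = a ∧ Arr.mk (Arrow.mk g) = b ∧ Arr.mk (Arrow.mk (f ≫ g)) = c

lemma IsComp.mk {j : J} {x y z : D.obj j} (f : x ⟶ y) (g : y ⟶ z) :
    IsComp (Arr.mk (Arrow.mk f)) (Arr.mk (Arrow.mk g)) (Arr.mk (Arrow.mk (f ≫ g))) :=
  ⟨j, x, y, z, f, g, rfl, rfl, rfl⟩

lemma exists_common_stage (a b : Arr D) :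
    ∃ (j : J) (f g : Arrow (D.obj j)), Arr.mk f = a ∧ Arr.mk g = b := by
  obtain ⟨j, f, rfl⟩ := a.exists_rep
  obtain ⟨j', g, rfl⟩ := b.exists_rep
  exact ⟨IsFiltered.max j j', mapA (D.map (IsFiltered.leftToMax j j')).toFunctor f,
    mapA (D.map (IsFiltered.rightToMax j j')).toFunctor g, Arr.mk_map _ _, Arr.mk_map _ _⟩

/-- Equality of classes provides two possibly different maps to a common stage; coequalizing them
leaves a single transition map. -/
lemma Obj.exists_map_eq {j : J} {x y : D.obj j} (h : Obj.mk x = Obj.mk y) :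
    ∃ (k : J) (t : j ⟶ k), (D.map t).toFunctor.obj x = (D.map t).toFunctor.obj y := by
  obtain ⟨k, f, g, h⟩ := Obj.mk_eq_iff.1 h
  refine ⟨_, f ≫ IsFiltered.coeqHom f g, ?_⟩
  have h₁ := congrArg (D.map (IsFiltered.coeqHom f g)).toFunctor.obj h
  conv_rhs => rw [IsFiltered.coeq_condition]
  simp only [D.map_comp]
  exact h₁

lemma Arr.exists_map_eq {j : J} {x y : Arrow (D.obj j)} (h : Arr.mk x = Arr.mk y) :
    ∃ (k : J) (t : j ⟶ k), mapA (D.map t).toFunctor x = mapA (D.map t).toFunctor y := by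
  obtain ⟨k, f, g, h⟩ := Arr.mk_eq_iff.1 h
  refine ⟨_, f ≫ IsFiltered.coeqHom f g, ?_⟩
  conv_rhs => rw [IsFiltered.coeq_condition]
  rw [mapA_diagram_comp, h, mapA_diagram_comp]

lemma exists_isComp {a b : Arr D} (h : tgt a = src b) : ∃ c, IsComp a b c := by
  obtain ⟨j, f, g, rfl, rfl⟩ := exists_common_stage a b
  obtain ⟨k, t, ht⟩ := Obj.exists_map_eq h
  rw [← Arr.mk_map t f, ← Arr.mk_map t g]
  have h₁ := IsComp.mk ((mapA (D.map t).toFunctor f).hom ≫ eqToHom ht)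
    (mapA (D.map t).toFunctor g).hom
  have h₂ : Arrow.mk ((mapA (D.map t).toFunctor f).hom ≫ eqToHom ht) =
      mapA (D.map t).toFunctor f := Arrow.arrow_mk_comp_eqToHom _ _
  rw [h₂] at h₁
  exact ⟨_, h₁⟩

/-- Two composable representatives of the same pair become equal at a common later stage, and so do
their composites. Together with `exists_isComp`, this makes the relation a composition law. -/
lemma IsComp.unique {a b c c' : Arr D} (h : IsComp a b c) (h' : IsComp a b c') : c = c' := by
  obtain ⟨j, x, y, z, f, g, rfl, rfl, rfl⟩ := h
  obtain ⟨j', x', y', z', f', g', h₁, h₂, rfl⟩ := h'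
  obtain ⟨k, s, t, h₁⟩ := Arr.mk_eq_iff.1 h₁
  rw [← Arr.mk_map s, ← Arr.mk_map t (Arrow.mk g)] at h₂
  obtain ⟨l, r, h₂⟩ := Arr.exists_map_eq h₂
  rw [← Arr.mk_map (t ≫ r), ← Arr.mk_map (s ≫ r) (Arrow.mk (f' ≫ g'))]
  refine congrArg Arr.mk ?_
  have h₁' := congrArg (mapA (D.map r).toFunctor) h₁
  rw [← mapA_diagram_comp, ← mapA_diagram_comp] at h₁' h₂
  simp only [mapA_mk] at h₁' h₂
  rw [mapA_mk, mapA_mk, (D.map (t ≫ r)).toFunctor.map_comp, (D.map (s ≫ r)).toFunctor.map_comp]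
  exact arrow_mk_comp_congr h₁'.symm h₂.symm

lemma IsComp.src_eq {a b c : Arr D} (h : IsComp a b c) : src c = src a := by
  obtain ⟨j, x, y, z, f, g, rfl, rfl, rfl⟩ := h
  rfl

lemma IsComp.tgt_eq {a b c : Arr D} (h : IsComp a b c) : tgt c = tgt b := by
  obtain ⟨j, x, y, z, f, g, rfl, rfl, rfl⟩ := h
  rfl

lemma isComp_idArr_left (a : Arr D) : IsComp (idArr (src a)) a a := by
  obtain ⟨j, f, rfl⟩ := a.exists_rep
  simpa using IsComp.mk (𝟙 f.left) f.hom

lemma isComp_idArr_right (a : Arr D) : IsComp a (idArr (tgt a)) a := by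
  obtain ⟨j, f, rfl⟩ := a.exists_rep
  simpa using IsComp.mk f.hom (𝟙 f.right)

lemma exists_triple {a b c : Arr D} (h : tgt a = src b) (h' : tgt b = src c) :
    ∃ (j : J) (x y z w : D.obj j) (f : x ⟶ y) (g : y ⟶ z) (i : z ⟶ w),
      Arr.mk (Arrow.mk f) = a ∧ Arr.mk (Arrow.mk g) = b ∧ Arr.mk (Arrow.mk i) = c := by
  obtain ⟨d, j, x, y, z, f, g, rfl, rfl, rfl⟩ := exists_isComp h
  obtain ⟨j', i, rfl⟩ := c.exists_rep
  obtain ⟨k, s, t, hst⟩ := Obj.mk_eq_iff.1 h'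
  refine ⟨k, _, _, _, _, (D.map s).toFunctor.map f, (D.map s).toFunctor.map g,
    eqToHom hst ≫ (D.map t).toFunctor.map i.hom, Arr.mk_map s (Arrow.mk f),
    Arr.mk_map s (Arrow.mk g), ?_⟩
  rw [Arrow.arrow_mk_eqToHom_comp]
  exact Arr.mk_map t i

/-- A composable triple is represented at one stage, where associativity holds in a category of the
diagram. -/
lemma IsComp.assoc {a b c ab bc abc : Arr D} (h : tgt a = src b) (h' : tgt b = src c)
    (h₁ : IsComp a b ab) (h₂ : IsComp b c bc) (h₃ : IsComp ab c abc) : IsComp a bc abc := by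
  obtain ⟨j, x, y, z, w, f, g, i, rfl, rfl, rfl⟩ := exists_triple h h'
  obtain rfl := h₁.unique (IsComp.mk f g)
  obtain rfl := h₂.unique (IsComp.mk g i)
  obtain rfl := h₃.unique (IsComp.mk (f ≫ g) i)
  simpa using IsComp.mk f (g ≫ i)

/-- The morphisms of the filtered colimit. -/
def Hom (x y : Obj D) : Type u := { a : Arr D // src a = x ∧ tgt a = y }

/-- The composition of the filtered colimit. -/
noncomputable def Hom.comp {x y z : Obj D} (f : Hom x y) (g : Hom y z) : Hom x z :=
  have h := exists_isComp (f.2.2.trans g.2.1.symm)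
  ⟨h.choose, h.choose_spec.src_eq.trans f.2.1, h.choose_spec.tgt_eq.trans g.2.2⟩

lemma Hom.isComp_comp {x y z : Obj D} (f : Hom x y) (g : Hom y z) :
    IsComp f.1 g.1 (f.comp g).1 :=
  (exists_isComp (f.2.2.trans g.2.1.symm)).choose_spec

/-- The identities of the filtered colimit. -/
def Hom.id (x : Obj D) : Hom x x :=
  ⟨idArr x, by obtain ⟨j, y, rfl⟩ := x.exists_rep; simp,
    by obtain ⟨j, y, rfl⟩ := x.exists_rep; simp⟩

noncomputable instance : Category.{u} (Obj D) where
  Hom x y := Hom x y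
  id x := Hom.id x
  comp f g := Hom.comp f g
  id_comp {x y} f := by
    refine Subtype.ext (IsComp.unique (Hom.isComp_comp _ _) ?_)
    convert isComp_idArr_left f.1
    exact congrArg idArr f.2.1.symm
  comp_id {x y} f := by
    refine Subtype.ext (IsComp.unique (Hom.isComp_comp _ _) ?_)
    convert isComp_idArr_right f.1
    exact congrArg idArr f.2.2.symm
  assoc f g i := Subtype.ext (IsComp.unique
    (IsComp.assoc (f.2.2.trans g.2.1.symm) (g.2.2.trans i.2.1.symm) (Hom.isComp_comp f g)
      (Hom.isComp_comp g i) (Hom.isComp_comp (f.comp g) i)) (Hom.isComp_comp f (g.comp i)))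

/-- The functors from the diagram to the filtered colimit. -/
noncomputable def ι (j : J) : D.obj j ⥤ Obj D where
  obj x := Obj.mk x
  map f := ⟨Arr.mk (Arrow.mk f), rfl, rfl⟩
  map_id _ := rfl
  map_comp f g := Subtype.ext ((IsComp.mk f g).unique (Hom.isComp_comp (D := D)
    ⟨Arr.mk (Arrow.mk f), rfl, rfl⟩ ⟨Arr.mk (Arrow.mk g), rfl, rfl⟩))

lemma obj_arrow_ext {a b : Arrow (Obj D)} (h : a.hom.1 = b.hom.1) : a = b := by
  obtain ⟨x, y, f, hf, hf'⟩ := a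
  obtain ⟨x', y', g, hg, hg'⟩ := b
  obtain rfl : f = g := h
  obtain rfl : x = x' := hf.symm.trans hg
  obtain rfl : y = y' := hf'.symm.trans hg'
  rfl

variable (D) in
/-- The explicit cocone of a filtered diagram of categories. -/
noncomputable def cocone : Cocone D where
  pt := Cat.of (Obj D)
  ι :=
    { app j := (ι j).toCatHom
      naturality j k f := by
        refine Cat.ext (functor_ext_mapA fun a => obj_arrow_ext ?_)
        exact Arr.mk_map f a }

lemma isArrowColimit_cocone : IsArrowColimit (cocone D) where
  surj a := by
    obtain ⟨j, b, hb⟩ := Arr.exists_rep a.hom.1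
    exact ⟨j, b, obj_arrow_ext hb⟩
  inj {j} b b' h := by
    have h₁ : Arr.mk b = Arr.mk b' := by
      obtain ⟨x, y, f⟩ := b
      obtain ⟨x', y', f'⟩ := b'
      exact congrArg (fun a : Arrow (Obj D) => a.hom.1) h
    exact Arr.exists_map_eq h₁

end FilteredColimit

variable [IsFiltered J] {D : J ⥤ Cat.{u, u}}

/-- Filtered colimits of categories are computed on arrows. -/
lemma isArrowColimit_of_isColimit {c : Cocone D} (hc : IsColimit c) : IsArrowColimit c :=
  FilteredColimit.isArrowColimit_cocone.of_iso
    (FilteredColimit.isArrowColimit_cocone.isColimit.uniqueUpToIso hc)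

end FilteredColimits

/-! ### Finite categories are finitely presentable -/

namespace IsArrowColimit

variable {J : Type u} [SmallCategory J] {D : J ⥤ Cat.{u, u}} {c : Cocone D}
  (hc : IsArrowColimit c)

include hc

lemma exists_map_eq_of_finite {ι : Type*} [Finite ι] {j : J} (b b' : ι → Arrow (D.obj j))
    (h : ∀ i, mapA (c.ι.app j).toFunctor (b i) = mapA (c.ι.app j).toFunctor (b' i)) :
    ∃ (k : J) (f : j ⟶ k), ∀ i, mapA (D.map f).toFunctor (b i) =
      mapA (D.map f).toFunctor (b' i) := by
  classical
  have : Fintype ι := Fintype.ofFinite ι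
  suffices H : ∀ s : Finset ι, ∃ (k : J) (f : j ⟶ k), ∀ i ∈ s,
      mapA (D.map f).toFunctor (b i) = mapA (D.map f).toFunctor (b' i) by
    obtain ⟨k, f, hf⟩ := H Finset.univ
    exact ⟨k, f, fun i => hf i (Finset.mem_univ i)⟩
  intro s
  induction s using Finset.induction_on with
  | empty => exact ⟨j, 𝟙 j, by simp⟩
  | insert i s _ ih =>
    obtain ⟨k, f, hf⟩ := ih
    obtain ⟨l, g, hg⟩ := hc.inj (mapA (D.map f).toFunctor (b i)) (mapA (D.map f).toFunctor (b' i))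
      (by rw [mapA_cocone, mapA_cocone, h])
    refine ⟨l, f ≫ g, fun i' hi' => ?_⟩
    rw [mapA_diagram_comp, mapA_diagram_comp]
    rcases Finset.mem_insert.1 hi' with rfl | hi'
    · exact hg
    · rw [hf i' hi']

lemma exists_comp_eq_of_finite {K : Type*} [Category* K] [Finite (Arrow K)] {j : J}
    (G G' : K ⥤ D.obj j) (h : G ⋙ (c.ι.app j).toFunctor = G' ⋙ (c.ι.app j).toFunctor) :
    ∃ (k : J) (f : j ⟶ k), G ⋙ (D.map f).toFunctor = G' ⋙ (D.map f).toFunctor := by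
  obtain ⟨k, f, hf⟩ := hc.exists_map_eq_of_finite (fun m : Arrow K => Arrow.mk (G.map m.hom))
    (fun m => Arrow.mk (G'.map m.hom))
    (fun m => congrArg (fun F : K ⥤ c.pt => Arrow.mk (F.map m.hom)) h)
  exact ⟨k, f, Arrow.functor_ext fun x y m => hf (Arrow.mk m)⟩

variable [IsFiltered J]

lemma exists_lift_of_finite {ι : Type*} [Finite ι] (a : ι → Arrow c.pt) :
    ∃ (j : J) (b : ι → Arrow (D.obj j)), ∀ i, mapA (c.ι.app j).toFunctor (b i) = a i := by
  classical
  have : Fintype ι := Fintype.ofFinite ι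
  choose j b hb using fun i => hc.surj (a i)
  obtain ⟨k, hk⟩ := IsFiltered.sup_objs_exists (Finset.univ.image j)
  have f (i : ι) : j i ⟶ k := (hk (Finset.mem_image_of_mem _ (Finset.mem_univ i))).some
  exact ⟨k, fun i => mapA (D.map (f i)).toFunctor (b i), fun i => by rw [mapA_cocone, hb]⟩

/-- A functor on `K` consists of finitely many arrows subject to finitely many equations. The arrows
lift to some stage, and each equation holds from some later stage on. -/
lemma exists_lift_functor_of_finite {K : Type*} [Category* K] [Finite (Arrow K)] (F : K ⥤ c.pt) :
    ∃ (j : J) (G : K ⥤ D.obj j), G ⋙ (c.ι.app j).toFunctor = F := by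
  obtain ⟨j, b, hb⟩ := hc.exists_lift_of_finite (fun m : Arrow K => Arrow.mk (F.map m.hom))
  have hl (m : Arrow K) : (c.ι.app j).toFunctor.obj (b m).left = F.obj m.left :=
    congrArg (fun c : Arrow _ => c.left) (hb m)
  have hr (m : Arrow K) : (c.ι.app j).toFunctor.obj (b m).right = F.obj m.right :=
    congrArg (fun c : Arrow _ => c.right) (hb m)
  -- At stage `k` the lifts of composable arrows become composable; composites can be formed only
  -- from then on.
  obtain ⟨k, f, hf⟩ := hc.exists_map_eq_of_finite
    (ι := { p : Arrow K × Arrow K // p.1.right = p.2.left })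
    (fun p => idA (b p.1.1).right) (fun p => idA (b p.1.2).left)
    (fun p => by rw [mapA_idA, mapA_idA, hr, hl, p.2])
  let b₁ (m : Arrow K) := mapA (D.map f).toFunctor (b m)
  have hb₁ (m : Arrow K) : mapA (c.ι.app k).toFunctor (b₁ m) = Arrow.mk (F.map m.hom) := by
    rw [mapA_cocone, hb]
  have e (p : { p : Arrow K × Arrow K // p.1.right = p.2.left }) :
      (b₁ p.1.1).right = (b₁ p.1.2).left :=
    congrArg (fun c : Arrow _ => c.left) (hf p)
  -- The left summand records the equations for composites, the right summand those for identities.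
  obtain ⟨l, g, hg⟩ := hc.exists_map_eq_of_finite
    (ι := { p : Arrow K × Arrow K // p.1.right = p.2.left } ⊕ Arrow K)
    (Sum.elim (fun p => Arrow.mk (((b₁ p.1.1).hom ≫ eqToHom (e p)) ≫ (b₁ p.1.2).hom))
      (fun m => b₁ (Arrow.mk (𝟙 m.left))))
    (Sum.elim (fun p => b₁ (Arrow.mk ((p.1.1.hom ≫ eqToHom p.2) ≫ p.1.2.hom)))
      (fun m => Arrow.mk (𝟙 (b₁ m).left))) (by
    rintro (p | m)
    · dsimp only [Sum.elim_inl]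
      rw [hb₁, mapA_mk, Functor.map_comp]
      change _ = Arrow.mk (F.map ((p.1.1.hom ≫ eqToHom p.2) ≫ p.1.2.hom))
      rw [F.map_comp]
      refine arrow_mk_comp_congr ?_ (hb₁ _)
      rw [← mapA_mk, Arrow.arrow_mk_comp_eqToHom]
      refine (hb₁ _).trans ?_
      rw [F.map_comp, eqToHom_map]
      exact (Arrow.arrow_mk_comp_eqToHom _ _).symm
    · dsimp only [Sum.elim_inr]
      have h₁ : (c.ι.app k).toFunctor.obj (b₁ m).left = F.obj m.left :=
        congrArg (fun c : Arrow _ => c.left) (hb₁ m)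
      rw [hb₁, mapA_idA, h₁]
      simp)
  have hφ : IsFunctorialOnArrows fun m : Arrow K => mapA (D.map g).toFunctor (b₁ m) := by
    constructor
    · intro x
      have := hg (Sum.inr (Arrow.mk (𝟙 x)))
      dsimp only [Sum.elim_inr] at this
      exact ⟨_, this.trans (mapA_idA _ _)⟩
    · intro x y z m n
      have := hg (Sum.inl ⟨(Arrow.mk m, Arrow.mk n), rfl⟩)
      dsimp only [Sum.elim_inl] at this
      refine ⟨_, _, _, (D.map g).toFunctor.map ((b₁ (Arrow.mk m)).hom ≫ eqToHom
          (e ⟨(Arrow.mk m, Arrow.mk n), rfl⟩)),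
        (D.map g).toFunctor.map (b₁ (Arrow.mk n)).hom, ?_, rfl, ?_⟩
      · rw [← mapA_mk, Arrow.arrow_mk_comp_eqToHom]
        rfl
      · rw [← Functor.map_comp, ← mapA_mk, this]
        simp
  refine ⟨l, hφ.functor, Arrow.functor_ext fun x y m => ?_⟩
  have h₁ := congrArg (mapA (c.ι.app l).toFunctor) (hφ.mk_functor_map m)
  rw [mapA_cocone, hb₁] at h₁
  exact h₁

end IsArrowColimit

/-- This makes the domains of the generating cofibrations small, hence also the free algebras on
them. -/
instance preservesFilteredColimits_coyoneda (K : Cat.{u, u}) [Finite (Arrow K)] :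
    PreservesFilteredColimits (coyoneda.obj (Opposite.op K)) where
  preserves_filtered_colimits J _ _ := ⟨fun {D} => ⟨fun {c} hc => by
    have hc := isArrowColimit_of_isColimit hc
    refine ⟨Types.FilteredColimit.isColimitOf' _ _ ?_ ?_⟩
    · intro F
      obtain ⟨j, G, hG⟩ := hc.exists_lift_functor_of_finite (Cat.Hom.toFunctor (F : K ⟶ c.pt))
      exact ⟨j, G.toCatHom, Cat.ext hG.symm⟩
    · intro j G G' h
      obtain ⟨k, f, hf⟩ := hc.exists_comp_eq_of_finite (Cat.Hom.toFunctor (G : K ⟶ D.obj j))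
        (Cat.Hom.toFunctor (G' : K ⟶ D.obj j))
        (congrArg (fun F : K ⟶ c.pt => F.toFunctor) h)
      exact ⟨k, f, Cat.ext hf⟩⟩⟩

/-! ## Categories of isomorphisms -/

/-- The category of isomorphisms of a category, as a functor. -/
def pow : Cat.{u, u} ⥤ Cat.{u, u} where
  obj X := Cat.of (WalkingIso.{0} ⥤ X)
  map F := ((Functor.whiskeringRight WalkingIso.{0} _ _).obj F.toFunctor).toCatHom

/-- The source and the target of an isomorphism. -/
def ev (X : Cat.{u, u}) (i : WalkingIso.{0}) : pow.obj X ⟶ X :=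
  ((evaluation WalkingIso.{0} X).obj i).toCatHom

/-- The universal isomorphism. -/
def evm (X : Cat.{u, u}) {i j : WalkingIso.{0}} (m : i ⟶ j) : ev X i ⟶ ev X j :=
  ((evaluation WalkingIso.{0} X).map m).toCatHom₂

/-- The inclusion of the identities into the category of isomorphisms. -/
def cst (X : Cat.{u, u}) : X ⟶ pow.obj X := (Functor.const WalkingIso.{0}).toCatHom

/-- The diagonal composite of a square of isomorphisms. -/
def diag (X : Cat.{u, u}) : pow.obj (pow.obj X) ⟶ pow.obj X where
  toFunctor :=
    { obj F :=
        { obj i := (F.obj i).obj i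
          map {i j} m := (F.map m).app i ≫ (F.obj j).map m
          map_id i := by
            rw [F.map_id, (F.obj i).map_id, Category.comp_id]
            rfl
          map_comp {i j k} m n := by
            rw [F.map_comp, (F.obj k).map_comp]
            change ((F.map m).app i ≫ (F.map n).app i) ≫ _ = _
            have := (F.map n).naturality m
            simp only [Category.assoc]
            rw [reassoc_of% this] }
      map {F G} τ :=
        { app i := (τ.app i).app i
          naturality i j m := by
            have h₁ := congrArg (fun t => NatTrans.app t i) (τ.naturality m)
            have h₂ := (τ.app j).naturality m
            change ((F.map m).app i ≫ (F.obj j).map m) ≫ (τ.app j).app j =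
              (τ.app i).app i ≫ (G.map m).app i ≫ (G.obj j).map m
            change (F.map m).app i ≫ (τ.app j).app i = (τ.app i).app i ≫ (G.map m).app i at h₁
            rw [Category.assoc, h₂, reassoc_of% h₁] } }

lemma catApp_congr {X Y : Cat.{u, u}} {F G : X ⟶ Y} (α : F ⟶ G) {x y : X} (h : x = y) :
    α.toNatTrans.app x = eqToHom (congrArg F.toFunctor.obj h) ≫ α.toNatTrans.app y ≫
      eqToHom (congrArg G.toFunctor.obj h).symm := by
  subst h
  simp

lemma pow_hom_ext {Z : Cat.{u, u}} {F G : pow.obj Z} {α β : F ⟶ G}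
    (h : ∀ i, (ev Z i).toFunctor.map α = (ev Z i).toFunctor.map β) : α = β :=
  NatTrans.ext (funext h)

lemma ev_map_eqToHom {Z : Cat.{u, u}} {F G : pow.obj Z} (h : F = G) (i : WalkingIso.{0}) :
    (ev Z i).toFunctor.map (eqToHom h) = eqToHom (congrArg (ev Z i).toFunctor.obj h) :=
  eqToHom_map _ _

/-- Functors to the category of isomorphisms are determined by the corresponding natural
isomorphisms. -/
lemma pow_ext {Y Z : Cat.{u, u}} {F G : Y ⟶ pow.obj Z} (h : ∀ i, F ≫ ev Z i = G ≫ ev Z i)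
    (h' : ∀ ⦃i j : WalkingIso.{0}⦄ (m : i ⟶ j) (y : Y),
      (evm Z m).toNatTrans.app (F.toFunctor.obj y) =
        eqToHom (congrArg (fun H : Y ⟶ Z => H.toFunctor.obj y) (h i)) ≫
          (evm Z m).toNatTrans.app (G.toFunctor.obj y) ≫
            eqToHom (congrArg (fun H : Y ⟶ Z => H.toFunctor.obj y) (h j)).symm) : F = G := by
  have h₀ (y : Y) : F.toFunctor.obj y = G.toFunctor.obj y :=
    CategoryTheory.Functor.ext (fun i => congrArg (fun H : Y ⟶ Z => H.toFunctor.obj y) (h i))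
      (fun i j m => h' m y)
  refine Cat.ext (CategoryTheory.Functor.ext h₀ ?_)
  intro y y' f
  refine pow_hom_ext fun i => ?_
  have := CategoryTheory.Functor.congr_hom (congrArg Cat.Hom.toFunctor (h i)) f
  rw [Functor.map_comp, Functor.map_comp, ev_map_eqToHom, ev_map_eqToHom]
  exact this

lemma pow_map_ev {X Y : Cat.{u, u}} (F : X ⟶ Y) (i : WalkingIso.{0}) :
    pow.map F ≫ ev Y i = ev X i ≫ F := rfl

lemma pow_map_ev_assoc {X Y : Cat.{u, u}} (F : X ⟶ Y) (i : WalkingIso.{0}) {W : Cat.{u, u}} (h : Y ⟶ W) :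
    pow.map F ≫ ev Y i ≫ h = ev X i ≫ F ≫ h := by
  rw [← Category.assoc, pow_map_ev F i, Category.assoc]

/-- Both `eqToHom` are identities; they are written out so that the equation can be used for
rewriting between objects that simplification does not identify syntactically. The same holds for
the similar equations for `cst`, `diag` and `lam`. -/
lemma pow_map_evm {X Y : Cat.{u, u}} (F : X ⟶ Y) {i j : WalkingIso.{0}} (m : i ⟶ j) :
    pow.map F ◁ evm Y m = eqToHom (pow_map_ev F i) ≫ evm X m ▷ F ≫
      eqToHom (pow_map_ev F j).symm := by
  exact (Category.id_comp _).symm.trans (congrArg _ (Category.comp_id _).symm)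

lemma evm_pow_map {X Y : Cat.{u, u}} (F : X ⟶ Y) {i j : WalkingIso.{0}} (m : i ⟶ j)
    (p : pow.obj X) : (evm Y m).toNatTrans.app ((pow.map F).toFunctor.obj p) =
      eqToHom (congrArg (fun H : pow.obj X ⟶ Y => H.toFunctor.obj p) (pow_map_ev F i)) ≫
        F.toFunctor.map ((evm X m).toNatTrans.app p) ≫
      eqToHom (congrArg (fun H : pow.obj X ⟶ Y => H.toFunctor.obj p) (pow_map_ev F j)).symm := by
  exact (Category.id_comp _).symm.trans (congrArg _ (Category.comp_id _).symm)

@[simp]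
lemma cst_ev (X : Cat.{u, u}) (i : WalkingIso.{0}) : cst X ≫ ev X i = 𝟙 X := rfl

lemma cst_evm (X : Cat.{u, u}) {i j : WalkingIso.{0}} (m : i ⟶ j) :
    cst X ◁ evm X m = eqToHom ((cst_ev X i).trans (cst_ev X j).symm) := rfl

lemma evm_cst {X : Cat.{u, u}} {i j : WalkingIso.{0}} (m : i ⟶ j) (x : X) :
    (evm X m).toNatTrans.app ((cst X).toFunctor.obj x) =
      eqToHom (congrArg (fun H : X ⟶ X => H.toFunctor.obj x)
        ((cst_ev X i).trans (cst_ev X j).symm)) := rfl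

@[simp]
lemma diag_ev (X : Cat.{u, u}) (i : WalkingIso.{0}) :
    diag X ≫ ev X i = ev (pow.obj X) i ≫ ev X i := rfl

@[simp]
lemma diag_ev_assoc (X : Cat.{u, u}) (i : WalkingIso.{0}) {W : Cat.{u, u}} (h : X ⟶ W) :
    diag X ≫ ev X i ≫ h = ev (pow.obj X) i ≫ ev X i ≫ h := by
  rw [← Category.assoc, diag_ev X i, Category.assoc]

lemma evm_diag {X : Cat.{u, u}} {i j : WalkingIso.{0}} (m : i ⟶ j) (p : pow.obj (pow.obj X)) :
    (evm X m).toNatTrans.app ((diag X).toFunctor.obj p) =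
      eqToHom (congrArg (fun H : pow.obj (pow.obj X) ⟶ X => H.toFunctor.obj p) (diag_ev X i)) ≫
        (ev X i).toFunctor.map ((evm (pow.obj X) m).toNatTrans.app p) ≫
          (evm X m).toNatTrans.app ((ev (pow.obj X) j).toFunctor.obj p) ≫
      eqToHom (congrArg (fun H : pow.obj (pow.obj X) ⟶ X => H.toFunctor.obj p)
        (diag_ev X j)).symm := by
  refine (Category.id_comp _).symm.trans ?_
  exact congrArg (_ ≫ ·) (congrArg (_ ≫ ·) (Category.comp_id _).symm)

lemma diag_evm (X : Cat.{u, u}) {i j : WalkingIso.{0}} (m : i ⟶ j) :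
    diag X ◁ evm X m = eqToHom (diag_ev X i) ≫ evm (pow.obj X) m ▷ ev X i ≫
      ev (pow.obj X) j ◁ evm X m ≫ eqToHom (diag_ev X j).symm := by
  refine Cat.Hom₂.ext (NatTrans.ext (funext fun p => (evm_diag m p).trans ?_))
  simp only [Cat.Hom₂.comp_app, Cat.eqToHom_app, Cat.whiskerLeft_app, Cat.whiskerRight_app]

lemma ev_map_pow_map {X Y : Cat.{u, u}} (F : X ⟶ Y) (i : WalkingIso.{0}) {p q : pow.obj X}
    (α : p ⟶ q) : (ev Y i).toFunctor.map ((pow.map F).toFunctor.map α) =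
      eqToHom (congrArg (fun H : pow.obj X ⟶ Y => H.toFunctor.obj p) (pow_map_ev F i)) ≫
        F.toFunctor.map ((ev X i).toFunctor.map α) ≫
      eqToHom (congrArg (fun H : pow.obj X ⟶ Y => H.toFunctor.obj q) (pow_map_ev F i)).symm :=
  CategoryTheory.Functor.congr_hom (congrArg Cat.Hom.toFunctor (pow_map_ev F i)) α

lemma cst_nat {X Y : Cat.{u, u}} (F : X ⟶ Y) : F ≫ cst Y = cst X ≫ pow.map F := by
  refine pow_ext (fun i => rfl) (fun i j m y => ?_)
  simp only [evm_cst, evm_pow_map, Cat.Hom.comp_toFunctor, Functor.comp_obj, eqToHom_map,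
    eqToHom_trans]

lemma cst_nat_assoc {X Y : Cat.{u, u}} (F : X ⟶ Y) {W : Cat.{u, u}} (h : pow.obj Y ⟶ W) :
    F ≫ cst Y ≫ h = cst X ≫ pow.map F ≫ h := by
  rw [← Category.assoc, cst_nat F, Category.assoc]

lemma diag_nat {X Y : Cat.{u, u}} (F : X ⟶ Y) :
    pow.map (pow.map F) ≫ diag Y = diag X ≫ pow.map F := by
  refine pow_ext (fun i => rfl) (fun i j m y => ?_)
  have h : (ev _ j).toFunctor.obj ((pow.map (pow.map F)).toFunctor.obj y) =
      (pow.map F).toFunctor.obj ((ev _ j).toFunctor.obj y) :=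
    congrArg (fun H : pow.obj (pow.obj X) ⟶ pow.obj Y => H.toFunctor.obj y)
      (pow_map_ev (pow.map F) j)
  simp only [Cat.Hom.comp_toFunctor, Functor.comp_obj, evm_diag, evm_pow_map, ev_map_pow_map,
    catApp_congr (evm Y m) h, eqToHom_map, eqToHom_trans, Functor.map_comp, Category.assoc,
    eqToHom_trans_assoc, eqToHom_refl, Category.id_comp]

lemma diag_nat_assoc {X Y : Cat.{u, u}} (F : X ⟶ Y) {W : Cat.{u, u}} (h : pow.obj Y ⟶ W) :
    pow.map (pow.map F) ≫ diag Y ≫ h = diag X ≫ pow.map F ≫ h := by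
  rw [← Category.assoc, diag_nat F, Category.assoc]

/-! ### The distributive law of a 2-functor over the formation of isomorphisms. -/

section Lam

variable (T : TwoEndofunctor.{u})

lemma map₂_eqToHom {A B : Cat.{u, u}} {F G : A ⟶ B} (h : F = G) :
    T.map₂ (eqToHom h) = eqToHom (congrArg T.map h) := by
  subst h
  simp [T.map₂_id]

lemma map₂_app_map {A B C : Cat.{u, u}} (F : A ⟶ B) {G H : B ⟶ C} (θ : G ⟶ H) (t : T.obj A) :
    (T.map₂ θ).toNatTrans.app ((T.map F).toFunctor.obj t) =
      eqToHom (congrArg (fun K : T.obj A ⟶ T.obj C => K.toFunctor.obj t) (T.map_comp F G).symm) ≫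
        (T.map₂ (F ◁ θ)).toNatTrans.app t ≫
      eqToHom (congrArg (fun K : T.obj A ⟶ T.obj C => K.toFunctor.obj t) (T.map_comp F H)) := by
  simp [T.map₂_whiskerLeft]

lemma map₂_whiskerRight_app {A B C : Cat.{u, u}} {F G : A ⟶ B} (θ : F ⟶ G) (H : B ⟶ C)
    (t : T.obj A) : (T.map₂ (θ ▷ H)).toNatTrans.app t =
      eqToHom (congrArg (fun K : T.obj A ⟶ T.obj C => K.toFunctor.obj t) (T.map_comp F H)) ≫
        (T.map H).toFunctor.map ((T.map₂ θ).toNatTrans.app t) ≫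
      eqToHom (congrArg (fun K : T.obj A ⟶ T.obj C => K.toFunctor.obj t)
        (T.map_comp G H).symm) := by
  simp [T.map₂_whiskerRight]

/-- The canonical comparison between the value of a 2-functor at a category of isomorphisms and
the isomorphisms of its value. -/
def lam (X : Cat.{u, u}) : T.obj (pow.obj X) ⟶ pow.obj (T.obj X) where
  toFunctor :=
    { obj t :=
        { obj i := (T.map (ev X i)).toFunctor.obj t
          map m := (T.map₂ (evm X m)).toNatTrans.app t
          map_id i := by
            have : evm X (𝟙 i) = 𝟙 (ev X i) := by
              ext F
              exact F.map_id i
            rw [this, T.map₂_id]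
            rfl
          map_comp {i j k} m n := by
            have : evm X (m ≫ n) = evm X m ≫ evm X n := by
              ext F
              exact F.map_comp m n
            rw [this, T.map₂_comp]
            rfl }
      map τ :=
        { app i := (T.map (ev X i)).toFunctor.map τ
          naturality i j m := ((T.map₂ (evm X m)).toNatTrans.naturality τ).symm }
      map_id t := by
        refine NatTrans.ext (funext fun i => ?_)
        exact (T.map (ev X i)).toFunctor.map_id t
      map_comp τ τ' := by
        refine NatTrans.ext (funext fun i => ?_)
        exact (T.map (ev X i)).toFunctor.map_comp τ τ' }

@[simp]
lemma lam_ev (X : Cat.{u, u}) (i : WalkingIso.{0}) :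
    lam T X ≫ ev (T.obj X) i = T.map (ev X i) := rfl

lemma evm_lam {X : Cat.{u, u}} {i j : WalkingIso.{0}} (m : i ⟶ j) (t : T.obj (pow.obj X)) :
    (evm (T.obj X) m).toNatTrans.app ((lam T X).toFunctor.obj t) =
      eqToHom (congrArg (fun H : T.obj (pow.obj X) ⟶ T.obj X => H.toFunctor.obj t)
        (lam_ev T X i)) ≫ (T.map₂ (evm X m)).toNatTrans.app t ≫
      eqToHom (congrArg (fun H : T.obj (pow.obj X) ⟶ T.obj X => H.toFunctor.obj t)
        (lam_ev T X j)).symm := by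
  exact (Category.id_comp _).symm.trans (congrArg _ (Category.comp_id _).symm)

lemma ev_map_lam (X : Cat.{u, u}) (i : WalkingIso.{0}) {t t' : T.obj (pow.obj X)} (α : t ⟶ t') :
    (ev (T.obj X) i).toFunctor.map ((lam T X).toFunctor.map α) =
      eqToHom (congrArg (fun H : T.obj (pow.obj X) ⟶ T.obj X => H.toFunctor.obj t)
        (lam_ev T X i)) ≫ (T.map (ev X i)).toFunctor.map α ≫
      eqToHom (congrArg (fun H : T.obj (pow.obj X) ⟶ T.obj X => H.toFunctor.obj t')
        (lam_ev T X i)).symm :=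
  CategoryTheory.Functor.congr_hom (congrArg Cat.Hom.toFunctor (lam_ev T X i)) α

lemma lam_nat {X Y : Cat.{u, u}} (F : X ⟶ Y) :
    T.map (pow.map F) ≫ lam T Y = lam T X ≫ pow.map (T.map F) := by
  refine pow_ext (fun i => ?_) (fun i j m t => ?_)
  · exact (T.map_comp (pow.map F) (ev Y i)).symm.trans (T.map_comp (ev X i) F)
  · simp only [evm_lam, map₂_app_map, pow_map_evm, T.map₂_comp, map₂_eqToHom,
      map₂_whiskerRight_app, evm_pow_map, Cat.Hom.comp_toFunctor, Functor.comp_obj, eqToHom_map,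
      eqToHom_trans, Functor.map_comp, Category.assoc, eqToHom_trans_assoc, Cat.Hom₂.comp_app,
      Cat.eqToHom_app]

lemma lam_cst (X : Cat.{u, u}) : T.map (cst X) ≫ lam T X = cst (T.obj X) := by
  refine pow_ext (fun i => ?_) (fun i j m t => ?_)
  · exact (T.map_comp (cst X) (ev X i)).symm.trans (T.map_id X)
  · simp only [evm_lam, map₂_app_map, cst_evm, map₂_eqToHom, evm_cst, Cat.Hom.comp_toFunctor,
      Functor.comp_obj, eqToHom_trans, Cat.eqToHom_app]

lemma lam_diag (X : Cat.{u, u}) :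
    T.map (diag X) ≫ lam T X = lam T (pow.obj X) ≫ pow.map (lam T X) ≫ diag (T.obj X) := by
  refine pow_ext (fun i => ?_) (fun i j m t => ?_)
  · exact (T.map_comp (diag X) (ev X i)).symm.trans (T.map_comp (ev (pow.obj X) i) (ev X i))
  · have h : (ev _ j).toFunctor.obj ((pow.map (lam T X)).toFunctor.obj
        ((lam T (pow.obj X)).toFunctor.obj t)) =
        (lam T X).toFunctor.obj ((T.map (ev (pow.obj X) j)).toFunctor.obj t) := rfl
    simp only [Cat.Hom.comp_toFunctor, Functor.comp_obj, evm_lam, map₂_app_map, diag_evm,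
      map₂_eqToHom, evm_diag, evm_pow_map, ev_map_lam, catApp_congr (evm _ m) h, T.map₂_comp,
      Cat.Hom₂.comp_app, map₂_whiskerRight_app, eqToHom_map,
      eqToHom_trans, Functor.map_comp, Category.assoc, eqToHom_trans_assoc, Cat.eqToHom_app]

/-- The source and target components use naturality of `α`; the component at an isomorphism is
exactly 2-naturality at `evm X m`. -/
lemma lam_app {S T : TwoEndofunctor.{u}} (α : TwoNatTrans S T) (X : Cat.{u, u}) :
    α.app (pow.obj X) ≫ lam T X = lam S X ≫ pow.map (α.app X) := by
  refine pow_ext (fun i => ?_) (fun i j m t => ?_)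
  · exact (α.naturality (ev X i)).symm
  · have := congrArg (fun β => β.toNatTrans.app t) (α.naturality₂ (evm X m))
    simp only [Cat.Hom₂.comp_app, Cat.eqToHom_app, Cat.whiskerLeft_app,
      Cat.whiskerRight_app] at this
    simp only [Cat.Hom.comp_toFunctor, Functor.comp_obj, evm_lam, evm_pow_map, eqToHom_map, this,
      eqToHom_trans, Functor.map_comp, Category.assoc, eqToHom_trans_assoc]

end Lam

/-! ## The monad of isomorphisms in a 2-monad -/

lemma evm_id {X : Cat.{u, u}} (i : WalkingIso.{0}) : evm X (𝟙 i) = 𝟙 (ev X i) := by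
  ext F
  exact F.map_id i

lemma ev_map_cst {X : Cat.{u, u}} (i : WalkingIso.{0}) {x y : X} (α : x ⟶ y) :
    (ev X i).toFunctor.map ((cst X).toFunctor.map α) =
      eqToHom (congrArg (fun H : X ⟶ X => H.toFunctor.obj x) (cst_ev X i)) ≫ α ≫
      eqToHom (congrArg (fun H : X ⟶ X => H.toFunctor.obj y) (cst_ev X i)).symm :=
  CategoryTheory.Functor.congr_hom (congrArg Cat.Hom.toFunctor (cst_ev X i)) α

lemma ev_map_diag {X : Cat.{u, u}} (i : WalkingIso.{0}) {p q : pow.obj (pow.obj X)} (α : p ⟶ q) :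
    (ev X i).toFunctor.map ((diag X).toFunctor.map α) =
      eqToHom (congrArg (fun H : pow.obj (pow.obj X) ⟶ X => H.toFunctor.obj p) (diag_ev X i)) ≫
        (ev X i).toFunctor.map ((ev (pow.obj X) i).toFunctor.map α) ≫
      eqToHom (congrArg (fun H : pow.obj (pow.obj X) ⟶ X => H.toFunctor.obj q)
        (diag_ev X i)).symm :=
  CategoryTheory.Functor.congr_hom (congrArg Cat.Hom.toFunctor (diag_ev X i)) α

-- With unit `cst` and multiplication `diag`, `pow` is a monad: its structure comes from the
-- diagonal of `WalkingIso` and its map to the point. This is one of the unit laws.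
@[simp]
lemma cst_diag (X : Cat.{u, u}) : cst (pow.obj X) ≫ diag X = 𝟙 _ := by
  refine pow_ext (fun i => rfl) (fun i j m y => ?_)
  have h : (ev _ j).toFunctor.obj ((cst _).toFunctor.obj y) = y := rfl
  simp only [evm_diag, evm_cst, Cat.Hom.comp_toFunctor, Functor.comp_obj, eqToHom_map,
    eqToHom_trans_assoc, catApp_congr (evm X m) h, Category.assoc, eqToHom_trans]
  rfl

@[simp]
lemma cst_diag_assoc (X : Cat.{u, u}) {W : Cat.{u, u}} (h : pow.obj X ⟶ W) :
    cst (pow.obj X) ≫ diag X ≫ h = h := by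
  rw [← Category.assoc, cst_diag X, Category.id_comp]

@[simp]
lemma pow_map_cst_diag (X : Cat.{u, u}) : pow.map (cst X) ≫ diag X = 𝟙 _ := by
  refine pow_ext (fun i => rfl) (fun i j m y => ?_)
  have h : (ev _ j).toFunctor.obj ((pow.map (cst X)).toFunctor.obj y) =
    (cst X).toFunctor.obj ((ev X j).toFunctor.obj y) := rfl
  simp only [evm_diag, evm_cst, Cat.Hom.comp_toFunctor, Functor.comp_obj, eqToHom_map,
    eqToHom_trans_assoc, catApp_congr (evm X m) h, Category.assoc, eqToHom_trans, evm_pow_map,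
    Functor.map_comp, ev_map_cst]
  rfl

@[simp]
lemma pow_map_cst_diag_assoc (X : Cat.{u, u}) {W : Cat.{u, u}} (h : pow.obj X ⟶ W) :
    pow.map (cst X) ≫ diag X ≫ h = h := by
  rw [← Category.assoc, pow_map_cst_diag X, Category.id_comp]

lemma diag_assoc (X : Cat.{u, u}) :
    diag (pow.obj X) ≫ diag X = pow.map (diag X) ≫ diag X := by
  refine pow_ext (fun i => rfl) (fun i j m y => ?_)
  have h₁ : (ev _ j).toFunctor.obj ((diag (pow.obj X)).toFunctor.obj y) =
    (ev _ j).toFunctor.obj ((ev _ j).toFunctor.obj y) := rfl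
  have h₂ : (ev _ j).toFunctor.obj ((pow.map (diag X)).toFunctor.obj y) =
    (diag X).toFunctor.obj ((ev _ j).toFunctor.obj y) := rfl
  simp only [evm_diag, Cat.Hom.comp_toFunctor, Functor.comp_obj, eqToHom_map,
    eqToHom_trans_assoc, catApp_congr (evm X m) h₁, catApp_congr (evm X m) h₂, Category.assoc,
    eqToHom_trans, evm_pow_map, Functor.map_comp, ev_map_diag, eqToHom_refl, Category.id_comp]

lemma diag_assoc_assoc (X : Cat.{u, u}) {W : Cat.{u, u}} (h : pow.obj X ⟶ W) :
    diag (pow.obj X) ≫ diag X ≫ h = pow.map (diag X) ≫ diag X ≫ h := by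
  rw [← Category.assoc, diag_assoc X, Category.assoc]

lemma lam_evm (T : TwoEndofunctor.{u}) (X : Cat.{u, u}) {i j : WalkingIso.{0}} (m : i ⟶ j) :
    lam T X ◁ evm (T.obj X) m = eqToHom (lam_ev T X i) ≫ T.map₂ (evm X m) ≫
      eqToHom (lam_ev T X j).symm := by
  refine Cat.Hom₂.ext (NatTrans.ext (funext fun p => (evm_lam T m p).trans ?_))
  simp only [Cat.Hom₂.comp_app, Cat.eqToHom_app]

/-- The composite of two endo-2-functors. -/
@[simps! toFunctor map₂]
def TwoEndofunctor.comp (S T : TwoEndofunctor.{u}) : TwoEndofunctor.{u} where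
  toFunctor := S.toFunctor ⋙ T.toFunctor
  map₂ θ := T.map₂ (S.map₂ θ)
  map₂_id F := by rw [S.map₂_id, T.map₂_id]; rfl
  map₂_comp θ κ := by rw [S.map₂_comp, T.map₂_comp]
  map₂_whiskerLeft F G H θ := by
    simp only [S.map₂_whiskerLeft, T.map₂_comp, map₂_eqToHom, T.map₂_whiskerLeft, Category.assoc,
      eqToHom_trans, eqToHom_trans_assoc, Functor.comp_map]
  map₂_whiskerRight θ H := by
    simp only [S.map₂_whiskerRight, T.map₂_comp, map₂_eqToHom, T.map₂_whiskerRight, Category.assoc,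
      eqToHom_trans, eqToHom_trans_assoc, Functor.comp_map]

/-- Applied to `S = T`, this turns `lam_app` for the multiplication into the compatibility `lam_μ`
of the distributive law with `μ`. -/
lemma lam_comp (S T : TwoEndofunctor.{u}) (X : Cat.{u, u}) :
    T.map (lam S X) ≫ lam T (S.obj X) = lam (S.comp T) X := by
  refine pow_ext (fun i => ?_) (fun i j m t => ?_)
  · exact (T.map_comp (lam S X) (ev (S.obj X) i)).symm
  · change _ = eqToHom _ ≫ (T.map₂ (S.map₂ (evm X m))).toNatTrans.app t ≫ eqToHom _
    simp only [evm_lam, map₂_app_map, lam_evm, T.map₂_comp, map₂_eqToHom, Cat.Hom.comp_toFunctor,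
      Functor.comp_obj, Cat.Hom₂.comp_app, Cat.eqToHom_app, Category.assoc, eqToHom_trans,
      eqToHom_trans_assoc]

namespace FinitaryMonad

variable (T : FinitaryMonad.{u})

/-- The unit, as a 2-natural transformation. -/
def ηTwo : TwoNatTrans idMonad.toTwoEndofunctor T.toTwoEndofunctor where
  toNatTrans := T.η
  naturality₂ := T.η_naturality₂

/-- The multiplication, as a 2-natural transformation. -/
def μTwo : TwoNatTrans (T.toTwoEndofunctor.comp T.toTwoEndofunctor) T.toTwoEndofunctor where
  toNatTrans := T.μ
  naturality₂ := T.μ_naturality₂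

/-- The canonical comparison for a 2-monad. -/
def lam (X : Cat.{u, u}) : T.obj (pow.obj X) ⟶ pow.obj (T.obj X) :=
  CatTwoMonad.lam T.toTwoEndofunctor X

lemma lam_η (X : Cat.{u, u}) : T.η.app (pow.obj X) ≫ T.lam X = pow.map (T.η.app X) :=
  lam_app T.ηTwo X

lemma lam_η_assoc (X : Cat.{u, u}) {W : Cat.{u, u}} (h : pow.obj (T.obj X) ⟶ W) :
    T.η.app (pow.obj X) ≫ T.lam X ≫ h = pow.map (T.η.app X) ≫ h := by
  rw [← Category.assoc, T.lam_η X]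

lemma lam_μ (X : Cat.{u, u}) :
    T.μ.app (pow.obj X) ≫ T.lam X = T.map (T.lam X) ≫ T.lam (T.obj X) ≫ pow.map (T.μ.app X) :=
  (lam_app T.μTwo X).trans (by
    rw [← lam_comp]
    exact Category.assoc _ _ _)

lemma lam_nat {X Y : Cat.{u, u}} (F : X ⟶ Y) :
    T.map (pow.map F) ≫ T.lam Y = T.lam X ≫ pow.map (T.map F) :=
  CatTwoMonad.lam_nat T.toTwoEndofunctor F

lemma lam_cst (X : Cat.{u, u}) : T.map (cst X) ≫ T.lam X = cst (T.obj X) :=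
  CatTwoMonad.lam_cst T.toTwoEndofunctor X

lemma lam_cst_assoc (X : Cat.{u, u}) {W : Cat.{u, u}} (h : pow.obj (T.obj X) ⟶ W) :
    T.map (cst X) ≫ T.lam X ≫ h = cst (T.obj X) ≫ h := by
  rw [← Category.assoc, T.lam_cst X]

lemma lam_diag (X : Cat.{u, u}) :
    T.map (diag X) ≫ T.lam X = T.lam (pow.obj X) ≫ pow.map (T.lam X) ≫ diag (T.obj X) :=
  CatTwoMonad.lam_diag T.toTwoEndofunctor X

lemma lam_ev (X : Cat.{u, u}) (i : WalkingIso.{0}) :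
    T.lam X ≫ ev (T.obj X) i = T.map (ev X i) := rfl

lemma lam_ev_assoc (X : Cat.{u, u}) (i : WalkingIso.{0}) {W : Cat.{u, u}} (h : T.obj X ⟶ W) :
    T.lam X ≫ ev (T.obj X) i ≫ h = T.map (ev X i) ≫ h := by
  rw [← Category.assoc, T.lam_ev X i]

lemma lam_hom {T T' : FinitaryMonad.{u}} (f : T ⟶ T') (X : Cat.{u, u}) :
    f.toMonadHom.app (pow.obj X) ≫ T'.lam X = T.lam X ≫ pow.map (f.toMonadHom.app X) :=
  lam_app f.toTwoNatTrans X

/-- The action of a 2-monad on the isomorphisms of an algebra. -/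
def powStr {Y : Cat.{u, u}} (h : T.obj Y ⟶ Y) : pow.obj (T.obj (pow.obj Y)) ⟶ pow.obj Y :=
  pow.map (T.lam Y) ≫ diag (T.obj Y) ≫ pow.map h

/-- Stated for any `h` satisfying the unit law, so as to serve both the free case `h = μ` of
`powMonad` and the case of an algebra in `powAlg`. The same applies to `powStr_assoc`. -/
lemma powStr_unit {Y : Cat.{u, u}} (h : T.obj Y ⟶ Y) (hh : T.η.app Y ≫ h = 𝟙 Y) :
    (T.η.app (pow.obj Y) ≫ cst _) ≫ T.powStr h = 𝟙 (pow.obj Y) := by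
  rw [powStr, Category.assoc, ← cst_nat_assoc, cst_diag_assoc, lam_η_assoc, ← pow.map_comp, hh]
  exact pow.map_id Y

lemma powStr_assoc {Y : Cat.{u, u}} (h : T.obj Y ⟶ Y) (hh : T.μ.app Y ≫ h = T.map h ≫ h) :
    T.powStr (T.μ.app (pow.obj Y)) ≫ T.powStr h = pow.map (T.map (T.powStr h)) ≫ T.powStr h := by
  simp only [powStr, T.map_comp, pow.map_comp, Category.assoc]
  have h₁ : pow.map (T.map (pow.map (T.lam Y))) ≫ pow.map (T.lam _) =
      pow.map (T.lam _) ≫ pow.map (pow.map (T.map (T.lam Y))) := by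
    rw [← pow.map_comp, lam_nat, pow.map_comp]
  have h₂ : pow.map (T.map (diag (T.obj Y))) ≫ pow.map (T.lam _) =
      pow.map (T.lam _) ≫ pow.map (pow.map (T.lam _)) ≫ pow.map (diag _) := by
    rw [← pow.map_comp, lam_diag, pow.map_comp, pow.map_comp]
  have h₃ : pow.map (T.map (pow.map h)) ≫ pow.map (T.lam _) =
      pow.map (T.lam _) ≫ pow.map (pow.map (T.map h)) := by
    rw [← pow.map_comp, lam_nat, pow.map_comp]
  have h₄ : pow.map (T.μ.app (pow.obj Y)) ≫ pow.map (T.lam Y) =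
      pow.map (T.map (T.lam Y)) ≫ pow.map (T.lam _) ≫ pow.map (pow.map (T.μ.app Y)) := by
    rw [← pow.map_comp, lam_μ, pow.map_comp, pow.map_comp]
  have h₅ : pow.map (T.map h) ≫ pow.map h = pow.map (T.μ.app Y) ≫ pow.map h := by
    rw [← pow.map_comp, ← hh, pow.map_comp]
  -- All maps in the image of `T` are moved past `lam`. The two sides then have the same factors up
  -- to associativity of `diag` and of `h`.
  rw [reassoc_of% h₃, diag_nat_assoc, reassoc_of% h₂, reassoc_of% h₁, h₅, reassoc_of% h₄,
    diag_nat_assoc, ← diag_nat_assoc, ← diag_nat_assoc (T.lam _), diag_assoc_assoc]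

/-- The monad of isomorphisms in a 2-monad. -/
def powMonad : CategoryTheory.Monad Cat.{u, u} where
  toFunctor := T.toFunctor ⋙ pow
  η :=
    { app X := T.η.app X ≫ cst (T.obj X)
      naturality X Y F := by
        have := T.η.naturality F
        dsimp at this ⊢
        rw [reassoc_of% this, Category.assoc, cst_nat] }
  μ :=
    { app X := T.powStr (T.μ.app X)
      naturality X Y F := by
        have := T.μ.naturality F
        dsimp [powStr] at this ⊢
        rw [← pow.map_comp_assoc, lam_nat, pow.map_comp_assoc, diag_nat_assoc, ← pow.map_comp,
          this]
        simp only [pow.map_comp, Category.assoc] }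
  left_unit X := T.powStr_unit (T.μ.app X) (T.left_unit X)
  right_unit X := by
    have := T.right_unit X
    dsimp [powStr]
    rw [← pow.map_comp_assoc, T.map_comp, Category.assoc, lam_cst, pow.map_comp_assoc,
      pow_map_cst_diag_assoc, ← pow.map_comp]
    erw [this]
    exact pow.map_id _
  assoc X := (T.powStr_assoc (T.μ.app X) (T.assoc X).symm).symm

/-- The isomorphisms in an algebra form an algebra for the monad of isomorphisms. -/
def powAlg (A : T.Alg) : T.powMonad.Algebra where
  A := pow.obj A.A
  a := T.powStr A.a
  unit := T.powStr_unit A.a A.unit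
  assoc := T.powStr_assoc A.a A.assoc

/-- The source and the target, as morphisms of monads. -/
def evHom (i : WalkingIso.{0}) : T.powMonad ⟶ T.toMonad where
  app X := ev (T.obj X) i
  naturality X Y F := pow_map_ev _ i
  app_η X := by
    change (T.η.app X ≫ cst (T.obj X)) ≫ ev (T.obj X) i = _
    rw [Category.assoc, cst_ev, Category.comp_id]
  app_μ X := by
    change T.powStr (T.μ.app X) ≫ ev (T.obj X) i =
      (pow.map (T.map (ev (T.obj X) i)) ≫ ev _ i) ≫ T.μ.app X
    simp only [powStr, Category.assoc, pow_map_ev, diag_ev_assoc, pow_map_ev_assoc, lam_ev_assoc]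

/-- The identities, as a morphism of monads. -/
def cstHom : T.toMonad ⟶ T.powMonad where
  app X := cst (T.obj X)
  naturality X Y F := cst_nat _
  app_μ X := by
    change T.μ.app X ≫ cst (T.obj X) = (T.map (cst (T.obj X)) ≫ cst _) ≫ T.powStr (T.μ.app X)
    rw [powStr, Category.assoc, ← cst_nat_assoc, cst_diag_assoc, lam_cst_assoc, ← cst_nat]

/-- The functoriality of the monad of isomorphisms. -/
def powHom {T T' : FinitaryMonad.{u}} (f : T ⟶ T') : T.powMonad ⟶ T'.powMonad where
  app X := pow.map (f.toMonadHom.app X)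
  naturality X Y F := by
    have := f.toMonadHom.naturality F
    change pow.map (T.map F) ≫ pow.map (f.toMonadHom.app Y) =
      pow.map (f.toMonadHom.app X) ≫ pow.map (T'.map F)
    change T.map F ≫ f.toMonadHom.app Y = f.toMonadHom.app X ≫ T'.map F at this
    rw [← pow.map_comp, this, pow.map_comp]
  app_η X := by
    change (T.η.app X ≫ cst (T.obj X)) ≫ _ = T'.η.app X ≫ cst (T'.obj X)
    rw [Category.assoc, ← cst_nat, ← Category.assoc]
    exact congrArg (· ≫ _) (f.toMonadHom.app_η X)
  app_μ X := by
    have h₁ : pow.map (T.map (pow.map (f.toMonadHom.app X))) ≫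
        pow.map (f.toMonadHom.app (pow.obj (T'.obj X))) ≫ pow.map (T'.lam (T'.obj X)) =
        pow.map (T.lam _) ≫ pow.map (pow.map (T.map (f.toMonadHom.app X))) ≫
          pow.map (pow.map (f.toMonadHom.app _)) := by
      rw [← pow.map_comp, lam_hom, pow.map_comp, ← pow.map_comp_assoc, lam_nat,
        pow.map_comp_assoc]
    have h₂ : pow.map (T.μ.app X) ≫ pow.map (f.toMonadHom.app X) =
        pow.map (T.map (f.toMonadHom.app X)) ≫ pow.map (f.toMonadHom.app _) ≫
          pow.map (T'.μ.app X) := by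
      rw [← pow.map_comp, ← pow.map_comp, f.toMonadHom.app_μ, Category.assoc, pow.map_comp]
    change T.powStr (T.μ.app X) ≫ _ = (pow.map (T.map (pow.map (f.toMonadHom.app X))) ≫
      pow.map (f.toMonadHom.app (pow.obj (T'.obj X)))) ≫ T'.powStr (T'.μ.app X)
    simp only [powStr, Category.assoc]
    rw [reassoc_of% h₁, h₂, diag_nat_assoc, diag_nat_assoc]

end FinitaryMonad

/-! ## Monads embedded in products of monads -/

section JointlyMono

variable {C : Type*} [Category* C] {ι : Type*} (M : ι → CategoryTheory.Monad C)

/-- A functor which embeds in a product of monads is a monad as soon as it is closed under the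
units and the multiplications. -/
def monadOfJointlyMono (P : C ⥤ C) (a : ∀ i, P ⟶ (M i).toFunctor)
    (ext : ∀ {Z X : C} (v w : Z ⟶ P.obj X), (∀ i, v ≫ (a i).app X = w ≫ (a i).app X) → v = w)
    (η : ∀ X, X ⟶ P.obj X) (hη : ∀ X i, η X ≫ (a i).app X = (M i).η.app X)
    (μ : ∀ X, P.obj (P.obj X) ⟶ P.obj X)
    (hμ : ∀ X i, μ X ≫ (a i).app X =
      (P.map ((a i).app X) ≫ (a i).app ((M i).obj X)) ≫ (M i).μ.app X) :
    CategoryTheory.Monad C where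
  toFunctor := P
  η :=
    { app := η
      naturality X Y f := by
        refine ext _ _ fun i => ?_
        have := (M i).η.naturality f
        dsimp at this ⊢
        rw [Category.assoc, hη, this, Category.assoc, (a i).naturality, reassoc_of% hη] }
  μ :=
    { app := μ
      naturality X Y f := by
        refine ext _ _ fun i => ?_
        have h₁ := (M i).μ.naturality f
        have h₂ := (a i).naturality f
        dsimp at h₁ ⊢
        simp only [Category.assoc, hμ, h₂, ← P.map_comp_assoc]
        rw [reassoc_of% hμ, ← h₁, P.map_comp_assoc, (a i).naturality_assoc] }
  left_unit X := by
    refine ext _ _ fun i => ?_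
    dsimp
    have := (M i).left_unit X
    dsimp at this
    -- This instance of naturality of the unit is itself tested after every `a j`; it replaces the
    -- left unit law of `P` by that of `M i`.
    have hnat : η (P.obj X) ≫ P.map ((a i).app X) = (a i).app X ≫ η ((M i).obj X) := by
      refine ext _ _ fun j => ?_
      have := (M j).η.naturality ((a i).app X)
      dsimp at this
      rw [Category.assoc, (a j).naturality, reassoc_of% hη, Category.assoc, hη, this]
    rw [Category.assoc, hμ, Category.assoc, reassoc_of% hnat, reassoc_of% hη, this]
    simp
  right_unit X := by
    refine ext _ _ fun i => ?_
    dsimp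
    have := (M i).right_unit X
    dsimp at this
    rw [Category.assoc, hμ, Category.assoc, ← P.map_comp_assoc, hη, (a i).naturality_assoc, this]
    simp
  assoc X := by
    refine ext _ _ fun i => ?_
    have h₁ := (M i).assoc X
    -- Naturality of the multiplication along `a i`, by which associativity reduces to that of `M
    -- i`.
    have hnat : μ (P.obj X) ≫ P.map ((a i).app X) =
        P.map (P.map ((a i).app X)) ≫ μ ((M i).obj X) := by
      refine ext _ _ fun j => ?_
      have h₁ := (M j).μ.naturality ((a i).app X)
      have h₂ := (a j).naturality ((a i).app X)
      dsimp at h₁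
      simp only [Category.assoc, hμ, h₂, ← P.map_comp_assoc]
      rw [reassoc_of% hμ, ← h₁, P.map_comp_assoc]
      simp only [NatTrans.naturality_assoc]
    have h₂ : (M i).map ((a i).app (P.obj X)) ≫ (M i).map ((M i).map ((a i).app X)) =
        (M i).map (P.map ((a i).app X)) ≫ (M i).map ((a i).app ((M i).obj X)) := by
      rw [← (M i).map_comp, ← (a i).naturality, (M i).map_comp]
    dsimp at h₁ ⊢
    simp only [Category.assoc, hμ]
    rw [← P.map_comp_assoc, hμ, reassoc_of% hnat, reassoc_of% hμ, ← h₁]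
    simp only [P.map_comp, Category.assoc, (a i).naturality_assoc, reassoc_of% h₂]

variable {M}

/-- The components of a morphism of monads may be tested after a jointly monic family of
morphisms of monads. -/
def monadHomOfJointlyMono {S P : CategoryTheory.Monad C} (a : ∀ i, P ⟶ M i)
    (ext : ∀ {Z X : C} (v w : Z ⟶ P.obj X), (∀ i, v ≫ (a i).app X = w ≫ (a i).app X) → v = w)
    (h : ∀ i, S ⟶ M i) (k : ∀ X, S.obj X ⟶ P.obj X) (hk : ∀ X i, k X ≫ (a i).app X = (h i).app X) :
    S ⟶ P where
  app := k
  naturality X Y f := by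
    refine ext _ _ fun i => ?_
    rw [Category.assoc, Category.assoc, hk, (h i).naturality, (a i).naturality, reassoc_of% hk]
  app_η X := by
    refine ext _ _ fun i => ?_
    rw [Category.assoc, hk, (h i).app_η, (a i).app_η]
  app_μ X := by
    refine ext _ _ fun i => ?_
    have h₁ : k (P.obj X) ≫ P.map ((a i).app X) = S.map ((a i).app X) ≫ k ((M i).obj X) := by
      refine ext _ _ fun j => ?_
      rw [Category.assoc, (a j).naturality, reassoc_of% hk, Category.assoc, hk, (h j).naturality]
    simp only [Category.assoc, hk, (a i).app_μ, (h i).app_μ]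
    rw [reassoc_of% h₁, reassoc_of% hk, ← S.map_comp_assoc, hk]

end JointlyMono

/-! ## Mapping cylinders of fully faithful functors -/

lemma walkingIso_map_comp {C : Type*} [Category* C] (r : WalkingIso.{0} ⥤ C)
    {j k l : WalkingIso.{0}} (m : j ⟶ k) (n : k ⟶ l) (m' : j ⟶ l) :
    r.map m ≫ r.map n = r.map m' := (CategoryTheory.Functor.map_comp r m n).symm

/-- `WalkingIso` has exactly one morphism between any two objects, all invertible: one component of
a transformation determines the others by conjugation. -/
lemma walkingIso_app_bijective {C : Type*} [Category* C] (p q : WalkingIso.{0} ⥤ C)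
    (i : WalkingIso.{0}) : Function.Bijective (fun α : p ⟶ q => α.app i) := by
  let c (j k : WalkingIso.{0}) : j ⟶ k := ⟨⟩
  refine ⟨fun α β h => ?_, fun m => ⟨⟨fun j => p.map (c j i) ≫ m ≫ q.map (c i j),
    fun j k n => ?_⟩, ?_⟩⟩
  · refine NatTrans.ext (funext fun j => ?_)
    have h₁ := α.naturality (c i j)
    have h₂ := β.naturality (c i j)
    dsimp at h
    rw [h, ← h₂] at h₁
    have : IsIso (p.map (c i j)) := ⟨p.map (c j i), (walkingIso_map_comp p _ _ (𝟙 i)).trans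
      (CategoryTheory.Functor.map_id p i), (walkingIso_map_comp p _ _ (𝟙 j)).trans
        (CategoryTheory.Functor.map_id p j)⟩
    exact (cancel_epi _).1 h₁
  · rw [Category.assoc, Category.assoc, walkingIso_map_comp q _ _ (c i k), ← Category.assoc,
      walkingIso_map_comp p _ _ (c j i)]
  · change p.map (𝟙 i) ≫ m ≫ q.map (𝟙 i) = m
    rw [CategoryTheory.Functor.map_id p i, CategoryTheory.Functor.map_id q i,
      Category.id_comp, Category.comp_id]

lemma ev_map_bijective (X : Cat.{u, u}) (i : WalkingIso.{0}) (p q : pow.obj X) :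
    Function.Bijective ((ev X i).toFunctor.map : (p ⟶ q) → _) :=
  walkingIso_app_bijective p q i

/-- Morphisms of isomorphisms are determined by their sources, or by their targets. -/
noncomputable def evFullyFaithful (X : Cat.{u, u}) (i : WalkingIso.{0}) : (ev X i).toFunctor.FullyFaithful where
  preimage {p q} := (Equiv.ofBijective _ (ev_map_bijective X i p q)).symm
  map_preimage m := (Equiv.ofBijective _ (ev_map_bijective X i _ _)).apply_symm_apply m
  preimage_map m := (Equiv.ofBijective _ (ev_map_bijective X i _ _)).symm_apply_apply m

variable {A B : Cat.{u, u}}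

/-- Objects of the mapping cylinder of a functor. -/
@[ext]
structure CylObj (φ : A ⟶ B) where
  /-- The source. -/
  left : A
  /-- The isomorphism. -/
  path : pow.obj B
  w : φ.toFunctor.obj left = (ev B .zero).toFunctor.obj path

/-- The mapping cylinder of a fully faithful functor: the category of isomorphisms whose source
is in the image of the functor. -/
def cyl (φ : A ⟶ B) : Cat.{u, u} :=
  -- Morphisms are taken between the targets only, so the projection to the target is fully faithful
  -- by construction. For fully faithful `φ`, the morphism of sources can be recovered from the
  -- morphism of targets.
  Cat.of (InducedCategory B fun o : CylObj φ => (ev B .one).toFunctor.obj o.path)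

/-- The projection of the mapping cylinder to the target. -/
def cylRight (φ : A ⟶ B) : cyl φ ⟶ B where
  toFunctor := inducedFunctor _

/-- The part of an object of the mapping cylinder in the source category. -/
def cylSource {φ : A ⟶ B} (o : cyl φ) : A := CylObj.left o

/-- The isomorphism of an object of the mapping cylinder. -/
def cylIso {φ : A ⟶ B} (o : cyl φ) : pow.obj B := CylObj.path o

/-- The morphism of targets given by a morphism of the mapping cylinder. -/
def cylHom {φ : A ⟶ B} {o o' : cyl φ} (m : o ⟶ o') :
    (ev B .one).toFunctor.obj (cylIso o) ⟶ (ev B .one).toFunctor.obj (cylIso o') :=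
  (cylRight φ).toFunctor.map m

lemma cylHom_id {φ : A ⟶ B} (o : cyl φ) : cylHom (𝟙 o) = 𝟙 _ :=
  (cylRight φ).toFunctor.map_id o

lemma cylHom_comp {φ : A ⟶ B} {o o' o'' : cyl φ} (m : o ⟶ o') (n : o' ⟶ o'') :
    cylHom (m ≫ n) = cylHom m ≫ cylHom n :=
  (cylRight φ).toFunctor.map_comp m n

/-- The isomorphism given by an object of the mapping cylinder. -/
noncomputable def cylPath (φ : A ⟶ B) : cyl φ ⟶ pow.obj B where
  toFunctor :=
    { obj o := cylIso o
      map m := (evFullyFaithful B .one).preimage (cylHom m)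
      map_id o := (evFullyFaithful B .one).map_injective (by
        rw [Functor.FullyFaithful.map_preimage, CategoryTheory.Functor.map_id, cylHom_id])
      map_comp m n := (evFullyFaithful B .one).map_injective (by
        simp only [Functor.map_comp, Functor.FullyFaithful.map_preimage, cylHom_comp]) }

lemma cyl_w {φ : A ⟶ B} (o : cyl φ) : φ.toFunctor.obj (cylSource o) =
    (ev B .zero).toFunctor.obj ((cylPath φ).toFunctor.obj o) :=
  CylObj.w o

/-- The projection of the mapping cylinder to the target is fully faithful. -/
def cylRightFullyFaithful (φ : A ⟶ B) : (cylRight φ).toFunctor.FullyFaithful :=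
  fullyFaithfulInducedFunctor _

lemma cylPath_ev_one (φ : A ⟶ B) : cylPath φ ≫ ev B .one = cylRight φ :=
  Cat.ext (CategoryTheory.Functor.ext (fun _ => rfl) fun o o' m => by
    refine ((evFullyFaithful B .one).map_preimage (cylHom m)).trans ?_
    exact ((Category.id_comp _).trans (Category.comp_id _)).symm)

lemma cylPath_ev_one_assoc (φ : A ⟶ B) {W : Cat.{u, u}} (h : B ⟶ W) :
    cylPath φ ≫ ev B .one ≫ h = cylRight φ ≫ h := by
  rw [← Category.assoc, cylPath_ev_one φ]

lemma fully_functor_hom_ext {X Y Z : Cat.{u, u}} {P : Y ⟶ Z} (hP : P.toFunctor.Faithful) {F G : X ⟶ Y}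
    (h₀ : ∀ x, F.toFunctor.obj x = G.toFunctor.obj x) (h : F ≫ P = G ≫ P) : F = G := by
  refine Cat.ext (CategoryTheory.Functor.ext h₀ fun x y f => P.toFunctor.map_injective ?_)
  have := CategoryTheory.Functor.congr_hom (congrArg Cat.Hom.toFunctor h) f
  simp only [Functor.map_comp, eqToHom_map]
  exact this

lemma cyl_hom_ext {φ : A ⟶ B} {Z : Cat.{u, u}} {F G : Z ⟶ cyl φ}
    (h₀ : ∀ z, cylSource (F.toFunctor.obj z) = cylSource (G.toFunctor.obj z))
    (h : F ≫ cylPath φ = G ≫ cylPath φ) : F = G := by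
  refine fully_functor_hom_ext (cylRightFullyFaithful φ).faithful
    (fun z => CylObj.ext (h₀ z) (congrArg (fun H : Z ⟶ _ => H.toFunctor.obj z) h)) ?_
  rw [← cylPath_ev_one, ← Category.assoc, h, Category.assoc]

/-- Functors to the mapping cylinder. -/
def cylLift {φ : A ⟶ B} {Z : Cat.{u, u}} (F : Z ⟶ A) (G : Z ⟶ pow.obj B)
    (h : F ≫ φ = G ≫ ev B .zero) : Z ⟶ cyl φ where
  toFunctor :=
    { obj z := ⟨F.toFunctor.obj z, G.toFunctor.obj z,
        congrArg (fun H : Z ⟶ B => H.toFunctor.obj z) h⟩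
      map f := ⟨(ev B .one).toFunctor.map (G.toFunctor.map f)⟩
      map_id z := InducedCategory.hom_ext (by
        rw [CategoryTheory.Functor.map_id, CategoryTheory.Functor.map_id]
        rfl)
      map_comp f g := InducedCategory.hom_ext (by
        simp only [Functor.map_comp]
        rfl) }

@[simp]
lemma cylLift_path {φ : A ⟶ B} {Z : Cat.{u, u}} (F : Z ⟶ A) (G : Z ⟶ pow.obj B)
    (h : F ≫ φ = G ≫ ev B .zero) : cylLift F G h ≫ cylPath φ = G := by
  refine fully_functor_hom_ext (evFullyFaithful B .one).faithful (fun _ => rfl) ?_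
  rw [Category.assoc, cylPath_ev_one]
  rfl

@[simp]
lemma cylLift_path_assoc {φ : A ⟶ B} {Z : Cat.{u, u}} (F : Z ⟶ A) (G : Z ⟶ pow.obj B)
    (h : F ≫ φ = G ≫ ev B .zero) {W : Cat.{u, u}} (k : pow.obj B ⟶ W) :
    cylLift F G h ≫ cylPath φ ≫ k = G ≫ k := by
  rw [← Category.assoc, cylLift_path F G h]

@[simp]
lemma cylLift_right {φ : A ⟶ B} {Z : Cat.{u, u}} (F : Z ⟶ A) (G : Z ⟶ pow.obj B)
    (h : F ≫ φ = G ≫ ev B .zero) : cylLift F G h ≫ cylRight φ = G ≫ ev B .one := rfl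

section

variable (φ : A ⟶ B) [φ.toFunctor.Full] [φ.toFunctor.Faithful]

/-- The projection of the mapping cylinder to the source. -/
noncomputable def cylLeft : cyl φ ⟶ A where
  toFunctor :=
    { obj o := cylSource o
      map {o o'} m := φ.toFunctor.preimage (eqToHom (cyl_w o) ≫
        (ev B .zero).toFunctor.map ((cylPath φ).toFunctor.map m) ≫ eqToHom (cyl_w o').symm)
      map_id o := φ.toFunctor.map_injective (by
        rw [Functor.map_preimage, CategoryTheory.Functor.map_id, CategoryTheory.Functor.map_id,
          CategoryTheory.Functor.map_id, Category.id_comp, eqToHom_trans, eqToHom_refl])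
      map_comp m n := φ.toFunctor.map_injective (by
        simp only [Functor.map_comp, Functor.map_preimage, Category.assoc, eqToHom_trans_assoc,
          eqToHom_refl, Category.id_comp]) }

lemma cylLeft_comp : cylLeft φ ≫ φ = cylPath φ ≫ ev B .zero :=
  Cat.ext (CategoryTheory.Functor.ext (fun o => cyl_w o) fun _ _ _ =>
    φ.toFunctor.map_preimage _)

lemma cylLeft_comp_assoc {W : Cat.{u, u}} (h : B ⟶ W) :
    cylLeft φ ≫ φ ≫ h = cylPath φ ≫ ev B .zero ≫ h := by
  rw [← Category.assoc, cylLeft_comp φ, Category.assoc]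

variable {φ}

@[simp]
lemma cylLift_left {Z : Cat.{u, u}} (F : Z ⟶ A) (G : Z ⟶ pow.obj B)
    (h : F ≫ φ = G ≫ ev B .zero) : cylLift F G h ≫ cylLeft φ = F := by
  refine fully_functor_hom_ext (P := φ) inferInstance (fun _ => rfl) ?_
  rw [Category.assoc, cylLeft_comp, cylLift_path_assoc, h]

@[simp]
lemma cylLift_left_assoc {Z : Cat.{u, u}} (F : Z ⟶ A) (G : Z ⟶ pow.obj B)
    (h : F ≫ φ = G ≫ ev B .zero) {W : Cat.{u, u}} (k : A ⟶ W) :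
    cylLift F G h ≫ cylLeft φ ≫ k = F ≫ k := by
  rw [← Category.assoc, cylLift_left F G h]

/-- Together with `cylLift`, this is the universal property of `cyl φ` as the strict pullback of `φ`
and `ev B .zero`. -/
lemma cyl_ext {Z : Cat.{u, u}} {F G : Z ⟶ cyl φ} (h₀ : F ≫ cylLeft φ = G ≫ cylLeft φ)
    (h : F ≫ cylPath φ = G ≫ cylPath φ) : F = G :=
  cyl_hom_ext (fun z => congrArg (fun H : Z ⟶ A => H.toFunctor.obj z) h₀) h

end

/-! ## Lifting 2-cells along fully faithful 2-natural transformations -/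

lemma whiskerLeft_congr {A B C : Cat.{u, u}} {F F' : A ⟶ B} (h : F = F') {G H : B ⟶ C}
    (θ : G ⟶ H) : F ◁ θ = eqToHom (congrArg (· ≫ G) h) ≫ F' ◁ θ ≫
      eqToHom (congrArg (· ≫ H) h).symm := by
  subst h
  simp

lemma whiskerRight_congr {A B C : Cat.{u, u}} {F G : A ⟶ B} (θ : F ⟶ G) {H H' : B ⟶ C}
    (h : H = H') : θ ▷ H = eqToHom (congrArg (F ≫ ·) h) ≫ θ ▷ H' ≫
      eqToHom (congrArg (G ≫ ·) h).symm := by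
  subst h
  simp

lemma whiskerRight_injective {X Y Z : Cat.{u, u}} {p : Y ⟶ Z} (hp : p.toFunctor.FullyFaithful)
    {F G : X ⟶ Y} {α β : F ⟶ G} (h : α ▷ p = β ▷ p) : α = β := by
  refine Cat.Hom₂.ext (NatTrans.ext (funext fun x => hp.map_injective ?_))
  exact congrArg (fun γ : F ≫ p ⟶ G ≫ p => γ.toNatTrans.app x) h

/-- Lifting 2-cells along a fully faithful functor. -/
def cellLift {X Y Z : Cat.{u, u}} {p : Y ⟶ Z} (hp : p.toFunctor.FullyFaithful) {F G : X ⟶ Y}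
    (θ : F ≫ p ⟶ G ≫ p) : F ⟶ G :=
  NatTrans.toCatHom₂
    { app x := hp.preimage (θ.toNatTrans.app x)
      naturality x y f := hp.map_injective (by
        rw [Functor.map_comp, Functor.map_comp, hp.map_preimage, hp.map_preimage]
        exact θ.toNatTrans.naturality f) }

@[simp]
lemma cellLift_whiskerRight {X Y Z : Cat.{u, u}} {p : Y ⟶ Z} (hp : p.toFunctor.FullyFaithful)
    {F G : X ⟶ Y} (θ : F ≫ p ⟶ G ≫ p) : cellLift hp θ ▷ p = θ :=
  Cat.Hom₂.ext (NatTrans.ext (funext fun _ => hp.map_preimage _))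

/-- Lifting invertible 2-cells along a fully faithful functor. -/
@[simps]
def cellIsoLift {X Y Z : Cat.{u, u}} {p : Y ⟶ Z} (hp : p.toFunctor.FullyFaithful) {F G : X ⟶ Y}
    (θ : F ≫ p ≅ G ≫ p) : F ≅ G where
  hom := cellLift hp θ.hom
  inv := cellLift hp θ.inv
  hom_inv_id := whiskerRight_injective hp (by simp)
  inv_hom_id := whiskerRight_injective hp (by simp)

section

variable {P : Cat.{u, u} ⥤ Cat.{u, u}} {T : TwoEndofunctor.{u}} (p : P ⟶ T.toFunctor)
  (hp : ∀ X, (p.app X).toFunctor.FullyFaithful)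

/-- The structure of a 2-functor induced by a fully faithful natural transformation. -/
def TwoEndofunctor.ofFullyFaithful : TwoEndofunctor.{u} where
  toFunctor := P
  -- 2-naturality of `p` prescribes the image of this 2-cell under `p`, and full faithfulness lifts
  -- it. All the axioms are tested after composition with `p`.
  map₂ {X Y F G} θ := cellLift (hp Y) (eqToHom (p.naturality F) ≫ p.app X ◁ T.map₂ θ ≫
    eqToHom (p.naturality G).symm)
  map₂_id F := whiskerRight_injective (hp _) (by
    rw [cellLift_whiskerRight, T.map₂_id]
    simp)
  map₂_comp θ κ := whiskerRight_injective (hp _) (by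
    simp only [cellLift_whiskerRight, T.map₂_comp, Bicategory.comp_whiskerRight,
      Bicategory.whiskerLeft_comp, Category.assoc, eqToHom_trans_assoc, eqToHom_refl,
      Category.id_comp])
  map₂_whiskerLeft F G H θ := whiskerRight_injective (hp _) (by
    simp only [cellLift_whiskerRight, T.map₂_whiskerLeft, Bicategory.comp_whiskerRight,
      Bicategory.whiskerLeft_comp, Category.assoc, eqToHom_trans_assoc,
      Bicategory.eqToHom_whiskerRight, Bicategory.whiskerLeft_eqToHom, whisker_assoc_cat,
      eqToHom_trans, ← whiskerLeft_comp_cat]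
    rw [whiskerLeft_congr (p.naturality F)]
    simp only [Category.assoc, eqToHom_trans_assoc, eqToHom_trans])
  map₂_whiskerRight {A B C F G} θ H := whiskerRight_injective (hp _) (by
    simp only [cellLift_whiskerRight, T.map₂_whiskerRight, Bicategory.comp_whiskerRight,
      Bicategory.whiskerLeft_comp, Category.assoc, eqToHom_trans_assoc,
      Bicategory.eqToHom_whiskerRight, Bicategory.whiskerLeft_eqToHom, ← whisker_assoc_cat,
      eqToHom_trans, ← whiskerRight_comp_cat]
    rw [whiskerRight_congr _ (p.naturality H)]
    simp only [whiskerRight_comp_cat, cellLift_whiskerRight, Bicategory.comp_whiskerRight,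
      Bicategory.eqToHom_whiskerRight, Category.assoc, eqToHom_trans_assoc, eqToHom_trans])

/-- A fully faithful natural transformation is 2-natural for the induced structure of a
2-functor. -/
def TwoNatTrans.ofFullyFaithful : TwoNatTrans (TwoEndofunctor.ofFullyFaithful p hp) T where
  toNatTrans := p
  naturality₂ _ := cellLift_whiskerRight _ _

end

/-- A natural transformation is 2-natural as soon as its composite with a fully faithful 2-natural
transformation is. -/
def TwoNatTrans.lift {R S T : TwoEndofunctor.{u}} (α : R.toFunctor ⟶ S.toFunctor)
    (p : TwoNatTrans S T) (hp : ∀ X, (p.app X).toFunctor.FullyFaithful) (β : TwoNatTrans R T)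
    (h : β.toNatTrans = α ≫ p.toNatTrans) : TwoNatTrans R S where
  toNatTrans := α
  naturality₂ {A B F G} θ := whiskerRight_injective (hp _) (by
    obtain ⟨β, h₁⟩ := β
    subst h
    have h₂ := p.naturality₂ θ
    refine (h₁ θ).trans ?_
    simp only [h₂, Bicategory.comp_whiskerRight, Bicategory.eqToHom_whiskerRight,
      Bicategory.whiskerLeft_comp, whisker_assoc_cat, Bicategory.whiskerLeft_eqToHom,
      whiskerLeft_comp_cat, Category.assoc, eqToHom_trans_assoc, eqToHom_trans, NatTrans.comp_app])

/-- Lifting invertible modifications along a fully faithful 2-natural transformation. -/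
def ModificationIso.lift {R S : FinitaryEndo.{u}} {T : TwoEndofunctor.{u}} {α β : R ⟶ S}
    (p : TwoNatTrans S.toTwoEndofunctor T) (hp : ∀ X, (p.app X).toFunctor.FullyFaithful)
    (m : ∀ X, α.app X ≫ p.app X ≅ β.app X ≫ p.app X)
    (h : ∀ {A B : Cat.{u, u}} (F : A ⟶ B), R.map F ◁ (m B).hom =
      eqToHom (by rw [α.naturality_assoc, p.naturality, Category.assoc]) ≫ (m A).hom ▷ T.map F ≫
        eqToHom (by rw [β.naturality_assoc, p.naturality, Category.assoc])) :
    ModificationIso α β where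
  app X := cellIsoLift (hp X) (m X)
  naturality {A B} F := whiskerRight_injective (hp _) (by
    have h₁ : (cellLift (hp A) (m A).hom ▷ S.map F) ▷ p.app B = _ :=
      whiskerRight_congr _ (p.naturality F)
    rw [whiskerRight_comp_cat, cellLift_whiskerRight] at h₁
    simp only [Bicategory.comp_whiskerRight, Bicategory.eqToHom_whiskerRight, whisker_assoc_cat,
      cellIsoLift_hom, cellLift_whiskerRight, h₁, Category.assoc, eqToHom_trans_assoc,
      eqToHom_trans]
    exact h F)

/-! ## The mapping cylinder of a fully faithful morphism of 2-monads -/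

/-- The multiplication of `M` pulled back to `P` along `a` and then sent to `N` depends only on the
composite `c` of `a` and `F`. Two factorizations of one `c` can thus be compared. -/
lemma map_comp_app_comp_μ {C : Type*} [Category* C] {P : C ⥤ C} {M N : CategoryTheory.Monad C}
    (a : P ⟶ M.toFunctor) (F : M ⟶ N) (c : P ⟶ N.toFunctor)
    (h : ∀ X, a.app X ≫ F.app X = c.app X) (X : C) :
    ((P.map (a.app X) ≫ a.app (M.obj X)) ≫ M.μ.app X) ≫ F.app X =
      (P.map (c.app X) ≫ c.app (N.obj X)) ≫ N.μ.app X := by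
  simp only [Category.assoc, F.app_μ, ← h, P.map_comp, a.naturality_assoc]

lemma finite_arrow (K : Type*) [Category* K] [Finite K] [∀ x y : K, Finite (x ⟶ y)] :
    Finite (Arrow K) :=
  Finite.of_surjective (fun p : Σ x y : K, x ⟶ y => Arrow.mk p.2.2)
    fun a => ⟨⟨a.left, a.right, a.hom⟩, rfl⟩

instance : Finite WalkingIso.{0} := Finite.of_equiv _ WalkingIso.equivBool.symm

instance (x y : WalkingIso.{0}) : Finite (x ⟶ y) := inferInstanceAs (Finite Unit)

instance : Finite (Arrow WalkingIso.{0}) := finite_arrow _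

lemma arrow_eq_of_faithful {C D : Type*} [Category* C] [Category* D] (F : C ⥤ D) [F.Faithful]
    {a b : Arrow C} (hl : a.left = b.left) (hr : a.right = b.right)
    (h : Arrow.mk (F.map a.hom) = Arrow.mk (F.map b.hom)) : a = b := by
  obtain ⟨x, y, f⟩ := a
  obtain ⟨x', y', g⟩ := b
  obtain rfl : x = x' := hl
  obtain rfl : y = y' := hr
  exact congrArg _ (F.map_injective (Arrow.mk_injective _ _ h))

lemma mapA_square {X Y Y' Z : Cat.{u, u}} {F : X ⟶ Y} {G : Y ⟶ Z} {F' : X ⟶ Y'} {G' : Y' ⟶ Z}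
    (h : F ≫ G = F' ≫ G') (a : Arrow X) :
    mapA G.toFunctor (mapA F.toFunctor a) = mapA G'.toFunctor (mapA F'.toFunctor a) :=
  congrArg (fun H : X ⟶ Z => mapA H.toFunctor a) h

lemma obj_square {X Y Y' Z : Cat.{u, u}} {F : X ⟶ Y} {G : Y ⟶ Z} {F' : X ⟶ Y'} {G' : Y' ⟶ Z}
    (h : F ≫ G = F' ≫ G') (x : X) :
    G.toFunctor.obj (F.toFunctor.obj x) = G'.toFunctor.obj (F'.toFunctor.obj x) :=
  congrArg (fun H : X ⟶ Z => H.toFunctor.obj x) h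

lemma obj_cocone {J : Type u} [SmallCategory J] {D : J ⥤ Cat.{u, u}} (c : Cocone D) {j k : J}
    (f : j ⟶ k) (x : D.obj j) :
    (c.ι.app k).toFunctor.obj ((D.map f).toFunctor.obj x) = (c.ι.app j).toFunctor.obj x :=
  congrArg (fun H : D.obj j ⟶ c.pt => H.toFunctor.obj x) (c.w f)

/-- Only objects need to be lifted and identified by hand. An arrow of `c.pt` has a representative
in `D'`; once the end points of the latter agree with the images of lifted objects, full
faithfulness brings it back to `D`. -/
lemma IsArrowColimit.of_fullyFaithful {J : Type u} [SmallCategory J] [IsFiltered J]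
    {D D' : J ⥤ Cat.{u, u}} (p : D ⟶ D') {c : Cocone D} {c' : Cocone D'} (q : c.pt ⟶ c'.pt)
    (hp : ∀ j, (p.app j).toFunctor.FullyFaithful) (hq : q.toFunctor.FullyFaithful)
    (hpq : ∀ j, c.ι.app j ≫ q = p.app j ≫ c'.ι.app j) (hc' : IsArrowColimit c')
    (surj : ∀ x : c.pt, ∃ (j : J) (y : D.obj j), (c.ι.app j).toFunctor.obj y = x)
    (inj : ∀ {j : J} (y y' : D.obj j), (c.ι.app j).toFunctor.obj y = (c.ι.app j).toFunctor.obj y' →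
      ∃ (k : J) (f : j ⟶ k), (D.map f).toFunctor.obj y = (D.map f).toFunctor.obj y') :
    IsArrowColimit c where
  surj a := by
    obtain ⟨i, x, hx⟩ := surj a.left
    obtain ⟨j, y, hy⟩ := surj a.right
    obtain ⟨l, b, hb⟩ := hc'.surj (mapA q.toFunctor a)
    obtain ⟨m, u, v, w, -⟩ : ∃ (m : J) (u : i ⟶ m) (v : j ⟶ m) (w : l ⟶ m), True :=
      ⟨_, IsFiltered.leftToMax i j ≫ IsFiltered.leftToMax _ l,
        IsFiltered.rightToMax i j ≫ IsFiltered.leftToMax _ l, IsFiltered.rightToMax _ l, trivial⟩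
    rw [← obj_cocone c u] at hx
    rw [← obj_cocone c v] at hy
    rw [← mapA_cocone c' w] at hb
    generalize (D.map u).toFunctor.obj x = x at hx
    generalize (D.map v).toFunctor.obj y = y at hy
    generalize mapA (D'.map w).toFunctor b = b at hb
    obtain ⟨n, s, hs⟩ := hc'.inj_obj (y := (p.app m).toFunctor.obj x) (y' := b.left) (by
      rw [← obj_square (hpq m), hx]
      exact (congrArg (fun d : Arrow _ => d.left) hb).symm)
    obtain ⟨n', t, ht⟩ := hc'.inj_obj (y := (D'.map s).toFunctor.obj ((p.app m).toFunctor.obj y))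
      (y' := (mapA (D'.map s).toFunctor b).right) (by
      rw [obj_cocone, ← obj_square (hpq m), hy]
      exact (congrArg (fun d : Arrow _ => d.right) ((mapA_cocone c' s b).trans hb)).symm)
    have e₁ := congrArg (D'.map t).toFunctor.obj hs
    rw [← obj_square (p.naturality s), ← obj_square (p.naturality t)] at e₁ ht
    generalize hd : mapA (D'.map t).toFunctor (mapA (D'.map s).toFunctor b) = d
    have hd' : mapA (c'.ι.app n').toFunctor d = mapA q.toFunctor a := by
      rw [← hd, mapA_cocone, mapA_cocone, hb]
    have e₁' : _ = d.left := e₁.trans (congrArg (fun d : Arrow _ => d.left) hd)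
    have e₂' : _ = d.right := ht.trans (congrArg (fun d : Arrow _ => d.right) hd)
    refine ⟨n', Arrow.mk ((hp n').preimage (eqToHom e₁' ≫ d.hom ≫ eqToHom e₂'.symm)), ?_⟩
    have := hq.faithful
    refine arrow_eq_of_faithful q.toFunctor ?_ ?_ ?_
    · exact (obj_cocone c t _).trans ((obj_cocone c s _).trans hx)
    · exact (obj_cocone c t _).trans ((obj_cocone c s _).trans hy)
    · refine (mapA_square (hpq n') _).trans ?_
      refine Eq.trans (congrArg _ ?_) hd'
      rw [mapA_mk, (hp n').map_preimage]
      exact Arrow.ext e₁' e₂' (by simp)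
  inj {j} b b' h := by
    obtain ⟨k, s, hs⟩ := hc'.inj (mapA (p.app j).toFunctor b) (mapA (p.app j).toFunctor b') (by
      rw [← mapA_square (hpq j), ← mapA_square (hpq j), h])
    rw [← mapA_square (p.naturality s), ← mapA_square (p.naturality s)] at hs
    rw [← mapA_cocone c s, ← mapA_cocone c s] at h
    obtain ⟨l, t, ht⟩ := inj _ _ (congrArg (fun d : Arrow _ => d.left) h)
    rw [← mapA_cocone c t, ← mapA_cocone c t] at h
    obtain ⟨m, v, hv⟩ := inj _ _ (congrArg (fun d : Arrow _ => d.right) h)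
    refine ⟨m, s ≫ t ≫ v, ?_⟩
    rw [mapA_diagram_comp, mapA_diagram_comp, mapA_diagram_comp, mapA_diagram_comp]
    have := (hp m).faithful
    refine arrow_eq_of_faithful (p.app m).toFunctor (congrArg (D.map v).toFunctor.obj ht) hv ?_
    refine (mapA_square (p.naturality v) _).trans (Eq.trans ?_ (mapA_square (p.naturality v) _).symm)
    refine congrArg _ ?_
    rw [mapA_square (p.naturality t), mapA_square (p.naturality t), hs]

section

variable {T T' : FinitaryMonad.{u}} (f : T ⟶ T')
  [∀ X, (f.toMonadHom.app X).toFunctor.Full] [∀ X, (f.toMonadHom.app X).toFunctor.Faithful]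

lemma cylFunctor_map_w {X Y : Cat.{u, u}} (F : X ⟶ Y) :
    (cylLeft (f.toMonadHom.app X) ≫ T.map F) ≫ f.toMonadHom.app Y =
      (cylPath (f.toMonadHom.app X) ≫ pow.map (T'.map F)) ≫ ev (T'.obj Y) .zero := by
  have : T.map F ≫ f.toMonadHom.app Y = f.toMonadHom.app X ≫ T'.map F :=
    f.toMonadHom.naturality F
  rw [Category.assoc, this, cylLeft_comp_assoc, Category.assoc, pow_map_ev]

/-- The endofunctor underlying the mapping cylinder. -/
noncomputable def cylFunctor : Cat.{u, u} ⥤ Cat.{u, u} where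
  obj X := cyl (f.toMonadHom.app X)
  map F := cylLift (cylLeft _ ≫ T.map F) (cylPath _ ≫ pow.map (T'.map F)) (cylFunctor_map_w f F)
  map_id X := cyl_ext (by simp) (by simp)
  map_comp F G := cyl_ext (by simp) (by simp)

/-- The projection to the source, as a natural transformation. -/
noncomputable def cylFunctorLeft : cylFunctor f ⟶ T.toFunctor where
  app X := cylLeft (f.toMonadHom.app X)
  naturality _ _ F := cylLift_left _ _ (cylFunctor_map_w f F)

/-- The isomorphism parametrized by the mapping cylinder, as a natural transformation. -/
noncomputable def cylFunctorPath : cylFunctor f ⟶ T'.powMonad.toFunctor where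
  app X := cylPath (f.toMonadHom.app X)
  naturality _ _ F := cylLift_path _ _ (cylFunctor_map_w f F)

/-- The projection to the target, as a natural transformation. -/
noncomputable def cylFunctorRight : cylFunctor f ⟶ T'.toFunctor where
  app X := cylRight (f.toMonadHom.app X)
  naturality X Y F := by
    refine Eq.trans (cylLift_right _ _ (cylFunctor_map_w f F)) ?_
    exact (Category.assoc _ _ _).trans (cylPath_ev_one_assoc (f.toMonadHom.app X) (T'.map F))

lemma cylFunctorLeft_comp (X : Cat.{u, u}) :
    (cylFunctorLeft f).app X ≫ f.toMonadHom.app X =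
      (cylFunctorPath f).app X ≫ (T'.evHom .zero).app X := by
  exact cylLeft_comp _

lemma cylFunctorPath_comp (X : Cat.{u, u}) :
    (cylFunctorPath f).app X ≫ (T'.evHom .one).app X = (cylFunctorRight f).app X := by
  exact cylPath_ev_one _

/-- The 2-monads in which the mapping cylinder embeds. -/
def cylFamily (T T' : FinitaryMonad.{u}) : Bool → CategoryTheory.Monad Cat.{u, u} :=
  Bool.rec T.toMonad T'.powMonad

/-- The projections of the mapping cylinder. -/
noncomputable def cylProj : ∀ b, cylFunctor f ⟶ (cylFamily T T' b).toFunctor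
  | false => cylFunctorLeft f
  | true => cylFunctorPath f

lemma cylProj_ext {Z X : Cat.{u, u}} (v w : Z ⟶ (cylFunctor f).obj X)
    (h : ∀ b, v ≫ (cylProj f b).app X = w ≫ (cylProj f b).app X) : v = w := by
  have h₁ : v ≫ cylLeft (f.toMonadHom.app X) = w ≫ cylLeft (f.toMonadHom.app X) := h false
  have h₂ : v ≫ cylPath (f.toMonadHom.app X) = w ≫ cylPath (f.toMonadHom.app X) := h true
  exact cyl_ext h₁ h₂

lemma cylUnit_w (X : Cat.{u, u}) : T.η.app X ≫ f.toMonadHom.app X =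
    T'.powMonad.η.app X ≫ ev (T'.obj X) .zero :=
  (f.toMonadHom.app_η X).trans ((T'.evHom .zero).app_η X).symm

/-- The unit of the mapping cylinder. -/
noncomputable def cylUnit (X : Cat.{u, u}) : X ⟶ (cylFunctor f).obj X :=
  cylLift (T.η.app X) (T'.powMonad.η.app X) (cylUnit_w f X)

/-- Both sides are the multiplication of `T'` pulled back along the source transformation
`cylFunctorLeft f ≫ f.toMonadHom.toNatTrans` from the cylinder to `T'`. -/
lemma cylMult_w (X : Cat.{u, u}) :
    (((cylFunctor f).map ((cylFunctorLeft f).app X) ≫ (cylFunctorLeft f).app (T.obj X)) ≫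
      T.μ.app X) ≫ f.toMonadHom.app X =
    (((cylFunctor f).map ((cylFunctorPath f).app X) ≫
      (cylFunctorPath f).app (T'.powMonad.obj X)) ≫ T'.powMonad.μ.app X) ≫
        ev (T'.obj X) .zero :=
  (map_comp_app_comp_μ (cylFunctorLeft f) f.toMonadHom
    (cylFunctorLeft f ≫ f.toMonadHom.toNatTrans) (fun _ => rfl) X).trans
      (map_comp_app_comp_μ (cylFunctorPath f) (T'.evHom .zero)
        (cylFunctorLeft f ≫ f.toMonadHom.toNatTrans)
          (fun X => (cylFunctorLeft_comp f X).symm) X).symm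

/-- The multiplication of the mapping cylinder. -/
noncomputable def cylMult (X : Cat.{u, u}) :
    (cylFunctor f).obj ((cylFunctor f).obj X) ⟶ (cylFunctor f).obj X :=
  cylLift _ _ (cylMult_w f X)

/-- The monad underlying the mapping cylinder. -/
noncomputable def cylMonad : CategoryTheory.Monad Cat.{u, u} :=
  monadOfJointlyMono (cylFamily T T') (cylFunctor f) (cylProj f) (cylProj_ext f) (cylUnit f)
    (fun X b => match b with
      | false => cylLift_left _ _ (cylUnit_w f X)
      | true => cylLift_path _ _ (cylUnit_w f X)) (cylMult f)
    (fun X b => match b with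
      | false => cylLift_left _ _ (cylMult_w f X)
      | true => cylLift_path _ _ (cylMult_w f X))

/-- The projection to the source, as a morphism of monads. -/
noncomputable def cylMonadLeft : cylMonad f ⟶ T.toMonad where
  toNatTrans := cylFunctorLeft f
  app_η X := cylLift_left _ _ (cylUnit_w f X)
  app_μ X := cylLift_left _ _ (cylMult_w f X)

/-- The isomorphism parametrized by the mapping cylinder, as a morphism of monads. -/
noncomputable def cylMonadPath : cylMonad f ⟶ T'.powMonad where
  toNatTrans := cylFunctorPath f
  app_η X := cylLift_path _ _ (cylUnit_w f X)
  app_μ X := cylLift_path _ _ (cylMult_w f X)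

lemma cylMonadLeft_comp :
    cylMonadLeft f ≫ f.toMonadHom = cylMonadPath f ≫ T'.evHom .zero :=
  MonadHom.ext (funext fun X => cylFunctorLeft_comp f X)

/-- The projection to the target is fully faithful. -/
def cylFunctorRightFullyFaithful (X : Cat.{u, u}) :
    ((cylFunctorRight f).app X).toFunctor.FullyFaithful :=
  cylRightFullyFaithful _

/-- The 2-functor underlying the mapping cylinder. -/
noncomputable def cylTwoEndofunctor : TwoEndofunctor.{u} :=
  TwoEndofunctor.ofFullyFaithful (T := T'.toTwoEndofunctor) (cylFunctorRight f)
    (cylFunctorRightFullyFaithful f)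

/-- The projection to the target, as a 2-natural transformation. -/
noncomputable def cylTwoRight : TwoNatTrans (cylTwoEndofunctor f) T'.toTwoEndofunctor :=
  TwoNatTrans.ofFullyFaithful (T := T'.toTwoEndofunctor) (cylFunctorRight f)
    (cylFunctorRightFullyFaithful f)

lemma cylFunctor_obj_ext {X : Cat.{u, u}} {o o' : (cylFunctor f).obj X}
    (h : ((cylFunctorLeft f).app X).toFunctor.obj o = ((cylFunctorLeft f).app X).toFunctor.obj o')
    (h' : ((cylFunctorPath f).app X).toFunctor.obj o =
      ((cylFunctorPath f).app X).toFunctor.obj o') : o = o' :=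
  CylObj.ext h h'

lemma exists_cylFunctor_obj {X : Cat.{u, u}} (x : T.obj X) (γ : pow.obj (T'.obj X))
    (h : (f.toMonadHom.app X).toFunctor.obj x = (ev (T'.obj X) .zero).toFunctor.obj γ) :
    ∃ o : (cylFunctor f).obj X, ((cylFunctorLeft f).app X).toFunctor.obj o = x ∧
      ((cylFunctorPath f).app X).toFunctor.obj o = γ :=
  ⟨CylObj.mk (φ := f.toMonadHom.app X) x γ h, rfl, rfl⟩

/-- On objects the cylinder is a finite limit of `T`, `T'` and isomorphisms in `T'`, and filtered
colimits commute with it because `WalkingIso` is finite. Arrows are controlled by the fully faithful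
projection to `T'`. -/
lemma isArrowColimit_cylFunctor {J : Type u} [SmallCategory J] [IsFiltered J]
    {D : J ⥤ Cat.{u, u}} {c : Cocone D} (hc : IsColimit c) :
    IsArrowColimit ((cylFunctor f).mapCocone c) := by
  have := T.finitary
  have := T'.finitary
  have h : IsArrowColimit (T.toFunctor.mapCocone c) :=
    isArrowColimit_of_isColimit (isColimitOfPreserves _ hc)
  have h' : IsArrowColimit (T'.toFunctor.mapCocone c) :=
    isArrowColimit_of_isColimit (isColimitOfPreserves _ hc)
  have natL {X Y : Cat.{u, u}} (F : X ⟶ Y) (o : (cylFunctor f).obj X) :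
      ((cylFunctorLeft f).app Y).toFunctor.obj (((cylFunctor f).map F).toFunctor.obj o) =
        (T.map F).toFunctor.obj (((cylFunctorLeft f).app X).toFunctor.obj o) :=
    congrArg (fun H : (cylFunctor f).obj X ⟶ T.obj Y => H.toFunctor.obj o)
      ((cylFunctorLeft f).naturality F)
  have natP {X Y : Cat.{u, u}} (F : X ⟶ Y) (o : (cylFunctor f).obj X) :
      ((cylFunctorPath f).app Y).toFunctor.obj (((cylFunctor f).map F).toFunctor.obj o) =
        (pow.map (T'.map F)).toFunctor.obj (((cylFunctorPath f).app X).toFunctor.obj o) :=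
    congrArg (fun H : (cylFunctor f).obj X ⟶ pow.obj (T'.obj Y) => H.toFunctor.obj o)
      ((cylFunctorPath f).naturality F)
  refine IsArrowColimit.of_fullyFaithful (Functor.whiskerLeft D (cylFunctorRight f)) 
    (c' := T'.toFunctor.mapCocone c) ((cylFunctorRight f).app c.pt)
    (fun j => cylFunctorRightFullyFaithful f _) (cylFunctorRightFullyFaithful f _)
    (fun j => (cylFunctorRight f).naturality _) h' ?_ ?_
  · intro o
    obtain ⟨i, x, hx⟩ := h.surj_obj (((cylFunctorLeft f).app c.pt).toFunctor.obj o)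
    obtain ⟨j, γ, hγ⟩ := h'.exists_lift_functor_of_finite (K := WalkingIso.{0})
      (((cylFunctorPath f).app c.pt).toFunctor.obj o)
    obtain ⟨m, u, v, -⟩ : ∃ (m : J) (u : i ⟶ m) (v : j ⟶ m), True :=
      ⟨_, IsFiltered.leftToMax i j, IsFiltered.rightToMax i j, trivial⟩
    rw [← obj_cocone _ u] at hx
    have hγ' : (pow.map (T'.map (c.ι.app m))).toFunctor.obj
        ((pow.map (T'.map (D.map v))).toFunctor.obj γ) =
          ((cylFunctorPath f).app c.pt).toFunctor.obj o := by
      refine (congrArg (fun H : T'.obj (D.obj j) ⟶ T'.obj c.pt => (pow.map H).toFunctor.obj γ)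
        ((T'.toFunctor.mapCocone c).w v)).trans hγ
    generalize (pow.map (T'.map (D.map v))).toFunctor.obj γ = γ at hγ'
    generalize ((D ⋙ T.toFunctor).map u).toFunctor.obj x = x at hx
    have w : (f.toMonadHom.app c.pt).toFunctor.obj (((cylFunctorLeft f).app c.pt).toFunctor.obj o) =
        (ev (T'.obj c.pt) .zero).toFunctor.obj
          (((cylFunctorPath f).app c.pt).toFunctor.obj o) :=
      obj_square (cylFunctorLeft_comp f c.pt) o
    rw [← hx, ← hγ'] at w
    -- The image of `x` and the source of `γ` agree in the colimit, hence at some stage `n`; only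
    -- there do they form an object of the cylinder.
    obtain ⟨n, s, hs⟩ := h'.inj_obj (y := (f.toMonadHom.app (D.obj m)).toFunctor.obj x)
      (y' := (ev (T'.obj (D.obj m)) .zero).toFunctor.obj γ)
      ((obj_square (f.toMonadHom.naturality (c.ι.app m)) x).symm.trans w)
    obtain ⟨o', ho₁, ho₂⟩ := exists_cylFunctor_obj f ((T.map (D.map s)).toFunctor.obj x)
      ((pow.map (T'.map (D.map s))).toFunctor.obj γ)
      ((obj_square (f.toMonadHom.naturality (D.map s)) x).trans hs)
    refine ⟨n, o', cylFunctor_obj_ext f ?_ ?_⟩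
    · refine (natL _ _).trans ((congrArg _ ho₁).trans (Eq.trans ?_ hx))
      exact obj_cocone (T.toFunctor.mapCocone c) s x
    · refine (natP _ _).trans ((congrArg _ ho₂).trans (Eq.trans ?_ hγ'))
      exact congrArg (fun H : T'.obj (D.obj m) ⟶ T'.obj c.pt => (pow.map H).toFunctor.obj γ)
        ((T'.toFunctor.mapCocone c).w s)
  · intro j o o' ho
    obtain ⟨k, s, hs⟩ := h.inj_obj (y := ((cylFunctorLeft f).app _).toFunctor.obj o)
      (y' := ((cylFunctorLeft f).app _).toFunctor.obj o')
      ((natL _ _).symm.trans ((congrArg _ ho).trans (natL _ _)))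
    have ho' : ((cylFunctor f).map (c.ι.app k)).toFunctor.obj
          (((cylFunctor f).map (D.map s)).toFunctor.obj o) =
        ((cylFunctor f).map (c.ι.app k)).toFunctor.obj
          (((cylFunctor f).map (D.map s)).toFunctor.obj o') :=
      (obj_cocone ((cylFunctor f).mapCocone c) s o).trans
        (ho.trans (obj_cocone ((cylFunctor f).mapCocone c) s o').symm)
    obtain ⟨l, t, ht⟩ := h'.exists_comp_eq_of_finite (K := WalkingIso.{0})
      (((cylFunctorPath f).app _).toFunctor.obj (((cylFunctor f).map (D.map s)).toFunctor.obj o))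
      (((cylFunctorPath f).app _).toFunctor.obj (((cylFunctor f).map (D.map s)).toFunctor.obj o'))
      ((natP _ _).symm.trans ((congrArg _ ho').trans (natP _ _)))
    refine ⟨l, s ≫ t, ?_⟩
    rw [Functor.map_comp]
    refine cylFunctor_obj_ext f (X := D.obj l) ?_ ?_
    · refine (natL (D.map t) _).trans (Eq.trans ?_ (natL (D.map t) _).symm)
      refine congrArg (T.map (D.map t)).toFunctor.obj ?_
      exact (natL _ _).trans (hs.trans (natL _ _).symm)
    · exact (natP (D.map t) _).trans (ht.trans (natP (D.map t) _).symm)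

instance : PreservesFilteredColimits (cylFunctor f) where
  preserves_filtered_colimits _ _ _ := ⟨⟨fun hc =>
    ⟨(isArrowColimit_cylFunctor f hc).isColimit⟩⟩⟩

end

/-- Whiskering a 2-natural transformation on the right. -/
def TwoNatTrans.whiskerRight {S T : TwoEndofunctor.{u}} (α : TwoNatTrans S T)
    (R : TwoEndofunctor.{u}) : TwoNatTrans (S.comp R) (T.comp R) where
  toNatTrans := Functor.whiskerRight α.toNatTrans R.toFunctor
  naturality₂ {A B F G} θ := by
    have h := congrArg R.map₂ (α.naturality₂ θ)
    rw [R.map₂_whiskerRight, R.map₂_comp, R.map₂_comp, R.map₂_whiskerLeft, map₂_eqToHom,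
      map₂_eqToHom] at h
    have h' := congrArg (fun x => eqToHom (R.map_comp _ _).symm ≫ x ≫ eqToHom (R.map_comp _ _)) h
    simp only [Category.assoc, eqToHom_trans_assoc, eqToHom_trans, eqToHom_refl,
      Category.id_comp, Category.comp_id] at h'
    exact h'

/-- Whiskering a 2-natural transformation on the left. -/
def TwoNatTrans.whiskerLeft (R : TwoEndofunctor.{u}) {S T : TwoEndofunctor.{u}}
    (α : TwoNatTrans S T) : TwoNatTrans (R.comp S) (R.comp T) where
  toNatTrans := Functor.whiskerLeft R.toFunctor α.toNatTrans
  naturality₂ θ := α.naturality₂ (R.map₂ θ)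

/-! ### The cylinder as a finitary 2-monad over the target. -/

section

variable {T T' : FinitaryMonad.{u}} (f : T ⟶ T')
  [∀ X, (f.toMonadHom.app X).toFunctor.Full] [∀ X, (f.toMonadHom.app X).toFunctor.Faithful]

lemma cylMonad_η_right (X : Cat.{u, u}) :
    (cylMonad f).η.app X ≫ (cylFunctorRight f).app X = T'.η.app X :=
  (cylLift_right _ _ (cylUnit_w f X)).trans ((T'.evHom .one).app_η X)

lemma cylMonad_μ_right (X : Cat.{u, u}) :
    (cylMonad f).μ.app X ≫ (cylFunctorRight f).app X =
      ((cylFunctor f).map ((cylFunctorRight f).app X) ≫ (cylFunctorRight f).app (T'.obj X)) ≫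
        T'.μ.app X :=
  (cylLift_right _ _ (cylMult_w f X)).trans (map_comp_app_comp_μ (cylFunctorPath f)
    (T'.evHom .one) (cylFunctorRight f) (cylFunctorPath_comp f) X)

/-- The unit of the mapping cylinder, as a 2-natural transformation. -/
noncomputable def cylTwoUnit : TwoNatTrans idMonad.toTwoEndofunctor (cylTwoEndofunctor f) :=
  TwoNatTrans.lift (R := idMonad.toTwoEndofunctor) (S := cylTwoEndofunctor f) (cylMonad f).η
    (cylTwoRight f) (cylFunctorRightFullyFaithful f) T'.ηTwo
    (NatTrans.ext (funext fun X => (cylMonad_η_right f X).symm))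

/-- The multiplication of the mapping cylinder, as a 2-natural transformation. -/
noncomputable def cylTwoMult :
    TwoNatTrans ((cylTwoEndofunctor f).comp (cylTwoEndofunctor f)) (cylTwoEndofunctor f) :=
  TwoNatTrans.lift (R := (cylTwoEndofunctor f).comp (cylTwoEndofunctor f))
    (S := cylTwoEndofunctor f) (cylMonad f).μ
    (cylTwoRight f) (cylFunctorRightFullyFaithful f)
    ((((cylTwoRight f).whiskerRight _).comp ((cylTwoRight f).whiskerLeft _)).comp T'.μTwo)
    (NatTrans.ext (funext fun X => (cylMonad_μ_right f X).symm))

/-- The mapping cylinder of a fully faithful morphism of 2-monads. -/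
noncomputable def cylFinitaryMonad : FinitaryMonad.{u} where
  toMonad := cylMonad f
  map₂ := (cylTwoEndofunctor f).map₂
  map₂_id := (cylTwoEndofunctor f).map₂_id
  map₂_comp := (cylTwoEndofunctor f).map₂_comp
  map₂_whiskerLeft := (cylTwoEndofunctor f).map₂_whiskerLeft
  map₂_whiskerRight := (cylTwoEndofunctor f).map₂_whiskerRight
  finitary := inferInstanceAs (PreservesFilteredColimits (cylFunctor f))
  η_naturality₂ := (cylTwoUnit f).naturality₂
  μ_naturality₂ := (cylTwoMult f).naturality₂

/-- The projection of the mapping cylinder to the target. -/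
noncomputable def cylProjection : cylFinitaryMonad f ⟶ T' where
  toMonadHom :=
    { toNatTrans := cylFunctorRight f
      app_η := cylMonad_η_right f
      app_μ := cylMonad_μ_right f }
  naturality₂ := (cylTwoRight f).naturality₂

lemma cylMonadPath_comp :
    cylMonadPath f ≫ T'.evHom .one = (cylProjection f).toMonadHom :=
  MonadHom.ext (funext fun X => cylFunctorPath_comp f X)

/-! ### The projection is a trivial fibration -/

/-- A morphism to the mapping cylinder lifting a 2-natural transformation to the target. -/
noncomputable def cylEndoLift {X : FinitaryEndo.{u}} (α : X.toFunctor ⟶ cylFunctor f)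
    (β : X ⟶ T'.toFinitaryEndo) (h : β.toNatTrans = α ≫ cylFunctorRight f) :
    X ⟶ (cylFinitaryMonad f).toFinitaryEndo :=
  TwoNatTrans.lift (R := X.toTwoEndofunctor) (S := cylTwoEndofunctor f) α (cylTwoRight f)
    (cylFunctorRightFullyFaithful f) β h

end

/-! ### Invertible 2-cells as functors to categories of isomorphisms. -/

/-- The universal isomorphism, as an invertible 2-cell. -/
def evIso (Z : Cat.{u, u}) (i j : WalkingIso.{0}) : ev Z i ≅ ev Z j where
  hom := evm Z (⟨⟩ : i ⟶ j)
  inv := evm Z (⟨⟩ : j ⟶ i)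
  hom_inv_id := Cat.Hom₂.ext (NatTrans.ext (funext fun p =>
    (walkingIso_map_comp p _ _ (𝟙 i)).trans (CategoryTheory.Functor.map_id p i)))
  inv_hom_id := Cat.Hom₂.ext (NatTrans.ext (funext fun p =>
    (walkingIso_map_comp p _ _ (𝟙 j)).trans (CategoryTheory.Functor.map_id p j)))

/-- Functors to the category of isomorphisms are determined by the corresponding invertible
2-cells. -/
lemma pow_ext_iso {Y Z : Cat.{u, u}} {F G : Y ⟶ pow.obj Z} (h₀ : F ≫ ev Z .zero = G ≫ ev Z .zero)
    (h₁ : F ≫ ev Z .one = G ≫ ev Z .one)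
    (h : F ◁ (evIso Z .zero .one).hom = eqToHom h₀ ≫ G ◁ (evIso Z .zero .one).hom ≫
      eqToHom h₁.symm) : F = G := by
  have hi : ∀ i, F ≫ ev Z i = G ≫ ev Z i := fun i =>
    WalkingIso.rec (motive := fun i => F ≫ ev Z i = G ≫ ev Z i) h₀ h₁ i
  have hm : ∀ (i j : WalkingIso.{0}) (m : i ⟶ j), F ◁ evm Z m =
      eqToHom (hi i) ≫ G ◁ evm Z m ≫ eqToHom (hi j).symm := by
    have hid (i : WalkingIso.{0}) (m : i ⟶ i) : F ◁ evm Z m =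
      eqToHom (hi i) ≫ G ◁ evm Z m ≫ eqToHom (hi i).symm := by
      obtain rfl : m = 𝟙 i := rfl
      simp only [evm_id, Bicategory.whiskerLeft_id, Category.id_comp, eqToHom_trans, eqToHom_refl]
    intro i j m
    induction i <;> induction j
    · exact hid _ m
    · exact h
    · have h' : (Bicategory.whiskerLeftIso F (evIso Z .zero .one)) =
          eqToIso h₀ ≪≫ Bicategory.whiskerLeftIso G (evIso Z .zero .one) ≪≫ eqToIso h₁.symm :=
        Iso.ext (by simpa using h)
      have h'' := congrArg Iso.inv h'
      simp only [Iso.trans_inv, eqToIso.inv, Category.assoc] at h''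
      exact h''
    · exact hid _ m
  refine pow_ext hi fun i j m y => ?_
  have := congrArg (fun β : F ≫ ev Z i ⟶ F ≫ ev Z j => β.toNatTrans.app y) (hm i j m)
  simp only [Cat.Hom₂.comp_app, Cat.eqToHom_app, Cat.whiskerLeft_app] at this
  exact this

/-- The functor to the category of isomorphisms given by an invertible 2-cell. -/
def powLift {Y Z : Cat.{u, u}} {F G : Y ⟶ Z} (e : F ≅ G) : Y ⟶ pow.obj Z where
  toFunctor :=
    { obj y := WalkingIso.fromIso ((Cat.Hom.toNatIso e).app y)
      map {y y'} m :=
        { app i := WalkingIso.rec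
            (motive := fun i => (WalkingIso.fromIso.{0} ((Cat.Hom.toNatIso e).app y)).obj i ⟶
              (WalkingIso.fromIso.{0} ((Cat.Hom.toNatIso e).app y')).obj i)
            (F.toFunctor.map m) (G.toFunctor.map m) i
          naturality i j n := by
            induction i <;> induction j
            · exact (Category.id_comp _).trans (Category.comp_id _).symm
            · exact (e.hom.toNatTrans.naturality m).symm
            · exact (e.inv.toNatTrans.naturality m).symm
            · exact (Category.id_comp _).trans (Category.comp_id _).symm }
      map_id y := by
        refine NatTrans.ext (funext fun i => ?_)
        induction i
        · exact F.toFunctor.map_id y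
        · exact G.toFunctor.map_id y
      map_comp m m' := by
        refine NatTrans.ext (funext fun i => ?_)
        induction i
        · exact F.toFunctor.map_comp m m'
        · exact G.toFunctor.map_comp m m' }

@[simp]
lemma powLift_zero {Y Z : Cat.{u, u}} {F G : Y ⟶ Z} (e : F ≅ G) :
    powLift e ≫ ev Z .zero = F := rfl

@[simp]
lemma powLift_one {Y Z : Cat.{u, u}} {F G : Y ⟶ Z} (e : F ≅ G) :
    powLift e ≫ ev Z .one = G := rfl

lemma powLift_evIso {Y Z : Cat.{u, u}} {F G : Y ⟶ Z} (e : F ≅ G) :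
    powLift e ◁ (evIso Z .zero .one).hom =
      eqToHom (powLift_zero e) ≫ e.hom ≫ eqToHom (powLift_one e).symm := by
  exact (Category.id_comp _).symm.trans (congrArg _ (Category.comp_id _).symm)

lemma pow_map_evIso {X Y : Cat.{u, u}} (F : X ⟶ Y) :
    pow.map F ◁ (evIso Y .zero .one).hom = eqToHom (pow_map_ev F .zero) ≫
      (evIso X .zero .one).hom ▷ F ≫ eqToHom (pow_map_ev F .one).symm :=
  pow_map_evm F _

lemma powLift_nat {Y Y' Z Z' : Cat.{u, u}} {P Q : Y ⟶ Z} {P' Q' : Y' ⟶ Z'} (e : P ≅ Q)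
    (e' : P' ≅ Q') {F : Y ⟶ Y'} {K : Z ⟶ Z'} (hP : F ≫ P' = P ≫ K) (hQ : F ≫ Q' = Q ≫ K)
    (h : F ◁ e'.hom = eqToHom hP ≫ e.hom ▷ K ≫ eqToHom hQ.symm) :
    F ≫ powLift e' = powLift e ≫ pow.map K := by
  refine pow_ext_iso (by rw [Category.assoc, powLift_zero, hP, Category.assoc, pow_map_ev]; rfl)
    (by rw [Category.assoc, powLift_one, hQ, Category.assoc, pow_map_ev]; rfl) ?_
  simp only [whiskerLeft_comp_cat, pow_map_evIso, powLift_evIso, Bicategory.whiskerLeft_comp, h,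
    Bicategory.whiskerLeft_eqToHom, Category.assoc, eqToHom_trans_assoc, eqToHom_trans,
    ← whisker_assoc_cat, Bicategory.comp_whiskerRight, Bicategory.eqToHom_whiskerRight]

/-- Changing the target of a functor to the category of isomorphisms along an invertible
2-cell. -/
def pathComp {Y Z : Cat.{u, u}} (p : Y ⟶ pow.obj Z) {G : Y ⟶ Z} (m : p ≫ ev Z .one ≅ G) :
    Y ⟶ pow.obj Z :=
  powLift (Bicategory.whiskerLeftIso p (evIso Z .zero .one) ≪≫ m)

lemma pathComp_nat {Y Y' Z Z' : Cat.{u, u}} {p : Y ⟶ pow.obj Z} {G : Y ⟶ Z}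
    (m : p ≫ ev Z .one ≅ G) {p' : Y' ⟶ pow.obj Z'} {G' : Y' ⟶ Z'} (m' : p' ≫ ev Z' .one ≅ G')
    {F : Y ⟶ Y'} {K : Z ⟶ Z'} (hp : F ≫ p' = p ≫ pow.map K) (hG : F ≫ G' = G ≫ K)
    (h : F ◁ m'.hom = eqToHom (by rw [reassoc_of% hp, pow_map_ev, Category.assoc]) ≫
      m.hom ▷ K ≫ eqToHom hG.symm) :
    F ≫ pathComp p' m' = pathComp p m ≫ pow.map K := by
  refine powLift_nat _ _ (by rw [reassoc_of% hp, pow_map_ev, Category.assoc]) hG ?_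
  have h₂ : F ◁ p' ◁ (evIso Z' .zero .one).hom = _ :=
    whiskerLeft_congr hp (evIso Z' .zero .one).hom
  simp only [Iso.trans_hom, Bicategory.whiskerLeftIso_hom, Bicategory.whiskerLeft_comp, h, h₂,
    whiskerLeft_comp_cat, pow_map_evIso, Bicategory.comp_whiskerRight, Bicategory.whiskerLeft_eqToHom,
    Category.assoc, eqToHom_trans_assoc, whisker_assoc_cat, eqToHom_refl, Category.id_comp]

@[simp]
lemma pathComp_zero {Y Z : Cat.{u, u}} (p : Y ⟶ pow.obj Z) {G : Y ⟶ Z} (m : p ≫ ev Z .one ≅ G) :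
    pathComp p m ≫ ev Z .zero = p ≫ ev Z .zero := rfl

section

variable {T T' : FinitaryMonad.{u}} (f : T ⟶ T')
  [∀ X, (f.toMonadHom.app X).toFunctor.Full] [∀ X, (f.toMonadHom.app X).toFunctor.Faithful]

section

variable {X : Cat.{u, u} ⥤ Cat.{u, u}} {β : X ⟶ T'.toFunctor}
  (a : ∀ A, X.obj A ⟶ cyl (f.toMonadHom.app A))
  (m : ∀ A, a A ≫ cylRight (f.toMonadHom.app A) ≅ β.app A)

lemma cylTransport_right (A : Cat.{u, u}) :
    (a A ≫ cylPath (f.toMonadHom.app A)) ≫ ev (T'.obj A) .one =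
      a A ≫ cylRight (f.toMonadHom.app A) := by
  rw [Category.assoc, cylPath_ev_one]

/-- Changing the target of an object of the mapping cylinder along an isomorphism. -/
noncomputable def cylTransportPath (A : Cat.{u, u}) : X.obj A ⟶ pow.obj (T'.obj A) :=
  pathComp (a A ≫ cylPath (f.toMonadHom.app A)) (eqToIso (cylTransport_right f a A) ≪≫ m A)

lemma cylTransport_w (A : Cat.{u, u}) :
    (a A ≫ cylLeft (f.toMonadHom.app A)) ≫ f.toMonadHom.app A =
      cylTransportPath f a m A ≫ ev (T'.obj A) .zero := by
  rw [cylTransportPath, pathComp_zero, Category.assoc, Category.assoc, cylLeft_comp]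

/-- The hypothesis `h` is the modification axiom for the given 2-cell; it makes the isomorphism
composed with that 2-cell natural in the base category. -/
lemma cylTransportPath_nat {A B : Cat.{u, u}} (F : A ⟶ B)
    (ha : X.map F ≫ a B = a A ≫ cylLift _ _ (cylFunctor_map_w f F))
    (h : X.map F ◁ (m B).hom = eqToHom (by
        rw [reassoc_of% ha, cylLift_right, Category.assoc, Category.assoc, pow_map_ev,
          cylPath_ev_one_assoc]) ≫
      (m A).hom ▷ T'.map F ≫ eqToHom (β.naturality F).symm) :
    X.map F ≫ cylTransportPath f a m B = cylTransportPath f a m A ≫ pow.map (T'.map F) := by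
  have hβ : X.map F ≫ β.app B = β.app A ≫ T'.map F := β.naturality F
  refine pathComp_nat _ _ (by rw [reassoc_of% ha, cylLift_path, Category.assoc]) hβ ?_
  simp only [Iso.trans_hom, eqToIso.hom, Bicategory.whiskerLeft_comp, h,
    Bicategory.comp_whiskerRight, Bicategory.eqToHom_whiskerRight, Bicategory.whiskerLeft_eqToHom,
    Category.assoc, eqToHom_trans_assoc]

lemma cylTransport_nat {A B : Cat.{u, u}} (F : A ⟶ B)
    (ha : X.map F ≫ a B = a A ≫ cylLift _ _ (cylFunctor_map_w f F))
    (h : X.map F ◁ (m B).hom = eqToHom (by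
        rw [reassoc_of% ha, cylLift_right, Category.assoc, Category.assoc, pow_map_ev,
          cylPath_ev_one_assoc]) ≫
      (m A).hom ▷ T'.map F ≫ eqToHom (β.naturality F).symm) :
    X.map F ≫ cylLift _ _ (cylTransport_w f a m B) =
      cylLift _ _ (cylTransport_w f a m A) ≫ cylLift _ _ (cylFunctor_map_w f F) := by
  refine cyl_ext ?_ ?_
  · simp only [Category.assoc, cylLift_left, cylLift_left_assoc, reassoc_of% ha]
  · simp only [Category.assoc, cylLift_path, cylLift_path_assoc]
    exact cylTransportPath_nat f a m F ha h

end

/-- Given an isomorphism from the target of a point of the cylinder to `β`, keep the source and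
compose the stored isomorphism with the given one. The lifted 2-cell is the preimage of `m` under
the fully faithful projection. -/
lemma cylProjection_fibration : Fibration (cylProjection f) := by
  refine ⟨?_⟩
  intro X α β m
  let a (A : Cat.{u, u}) : X.obj A ⟶ cyl (f.toMonadHom.app A) := α.app A
  let n (A : Cat.{u, u}) : a A ≫ cylRight (f.toMonadHom.app A) ≅ β.app A := m.app A
  let α₀ : X.toFunctor ⟶ cylFunctor f :=
    { app A := cylLift _ _ (cylTransport_w f a n A)
      naturality A B F := cylTransport_nat f a n F (α.naturality F) (m.naturality F) }
  let α' : X ⟶ (cylFinitaryMonad f).toFinitaryEndo :=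
    cylEndoLift f α₀ β (NatTrans.ext (funext fun A =>
      (cylLift_right _ _ (cylTransport_w f a n A)).symm))
  exact ⟨α', ModificationIso.lift (α := α) (β := α') (cylTwoRight f)
    (cylFunctorRightFullyFaithful f) m.app m.naturality,
    TwoNatTrans.ext (funext fun A => cylLift_right _ _ (cylTransport_w f a n A)), fun A =>
    (Category.comp_id _).trans (cellLift_whiskerRight _ _)⟩

lemma cylInclusion_w (A : Cat.{u, u}) : 𝟙 _ ≫ f.toMonadHom.app A =
    (f.toMonadHom.app A ≫ cst _) ≫ ev (T'.obj A) .zero := by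
  rw [Category.id_comp, Category.assoc, cst_ev, Category.comp_id]

/-- The inclusion of the source in the mapping cylinder, as a natural transformation. -/
def cylInclusionNat : T.toFunctor ⟶ cylFunctor f where
  app A := cylLift _ _ (cylInclusion_w f A)
  naturality A B F := by
    have h : T.map F ≫ f.toMonadHom.app B = f.toMonadHom.app A ≫ T'.map F :=
      f.toMonadHom.naturality F
    change T.map F ≫ cylLift _ _ (cylInclusion_w f B) =
      cylLift _ _ (cylInclusion_w f A) ≫ cylLift _ _ (cylFunctor_map_w f F)
    refine cyl_ext (by simp) ?_
    simp only [Category.assoc, cylLift_path, cylLift_path_assoc, cst_nat]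
    rw [← pow.map_comp, ← h, pow.map_comp, cst_nat_assoc]

lemma cylInclusionNat_right (A : Cat.{u, u}) :
    (cylInclusionNat f).app A ≫ (cylFunctorRight f).app A = f.toMonadHom.app A :=
  (cylLift_right _ _ (cylInclusion_w f A)).trans (by
    rw [Category.assoc, cst_ev, Category.comp_id])

/-- The inclusion of the source in the mapping cylinder. -/
noncomputable def cylInclusion :
    forgetToEndo.obj T ⟶ forgetToEndo.obj (cylFinitaryMonad f) :=
  cylEndoLift f (X := T.toFinitaryEndo) (cylInclusionNat f) f.toTwoNatTrans
    (NatTrans.ext (funext fun A => (cylInclusionNat_right f A).symm))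

lemma cylInclusion_comp :
    cylInclusion f ≫ forgetToEndo.map (cylProjection f) = forgetToEndo.map f :=
  TwoNatTrans.ext (funext fun A => cylInclusionNat_right f A)

/-- Whiskering an invertible modification on the left. -/
def ModificationIso.whiskerLeft {R S T : FinitaryEndo.{u}} (γ : R ⟶ S) {α β : S ⟶ T}
    (m : ModificationIso α β) : ModificationIso (γ ≫ α) (γ ≫ β) where
  app A := Bicategory.whiskerLeftIso (γ.app A) (m.app A)
  naturality {A B} F := by
    have h := m.naturality F
    have h₁ := whiskerLeft_congr (γ.naturality F) (m.app B).hom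
    change R.map F ◁ γ.app B ◁ (m.app B).hom = eqToHom _ ≫ (γ.app A ◁ (m.app A).hom) ▷ T.map F ≫
      eqToHom _
    refine h₁.trans ?_
    simp only [whiskerLeft_comp_cat, h, Bicategory.whiskerLeft_comp, whisker_assoc_cat,
      Bicategory.whiskerLeft_eqToHom, Category.assoc, eqToHom_trans_assoc, eqToHom_trans]

/-- The homotopy inverse is a homotopy inverse `r` of `f` followed by the inclusion by identities.
An equivalence in `End_f(Cat)` suffices, so no compatibility of these maps with the monad structures
is needed. -/
lemma cylProjection_weakEquivalence (hf : WeakEquivalence f) :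
    WeakEquivalence (cylProjection f) := by
  obtain ⟨r, ⟨e₁⟩, ⟨e₂⟩⟩ := hf.mem
  refine ⟨r ≫ cylInclusion f, ?_, ?_⟩
  -- After projection to `T'` the required modification is `e₂` whiskered with the projection; full
  -- faithfulness lifts it to the cylinder.
  · have h : Nonempty (ModificationIso
        ((forgetToEndo.map (cylProjection f) ≫ r ≫ cylInclusion f) ≫
          forgetToEndo.map (cylProjection f))
        (𝟙 _ ≫ forgetToEndo.map (cylProjection f))) := by
      rw [Category.assoc, Category.assoc, cylInclusion_comp, Category.id_comp]
      nth_rw 2 [← Category.comp_id (forgetToEndo.map (cylProjection f))]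
      exact ⟨ModificationIso.whiskerLeft _ e₂⟩
    obtain ⟨e⟩ := h
    exact ⟨ModificationIso.lift (cylTwoRight f) (cylFunctorRightFullyFaithful f)
      e.app e.naturality⟩
  · rw [Category.assoc, cylInclusion_comp]
    exact ⟨e₂⟩

end

lemma isEquivalence_app {T T' : FinitaryMonad.{u}} (f : T ⟶ T') (hf : WeakEquivalence f)
    (X : Cat.{u, u}) : (f.toMonadHom.app X).toFunctor.IsEquivalence := by
  obtain ⟨r, ⟨e₁⟩, ⟨e₂⟩⟩ := hf.mem
  exact (CategoryTheory.Equivalence.mk (f.toMonadHom.app X).toFunctor (r.app X).toFunctor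
    (Cat.Hom.toNatIso (e₁.app X)).symm (Cat.Hom.toNatIso (e₂.app X))).isEquivalence_functor

/-- A weak equivalence with flexible target has a homotopy section. -/
theorem exists_homotopySection {T T' : FinitaryMonad.{u}} (f : T ⟶ T') (hf : WeakEquivalence f)
    (hT' : T'.IsFlexible) :
    ∃ (g : T'.toMonad ⟶ T.toMonad) (h : T'.toMonad ⟶ T'.powMonad),
      h ≫ T'.evHom .zero = g ≫ f.toMonadHom ∧ h ≫ T'.evHom .one = 𝟙 _ := by
  have hX := isEquivalence_app f hf
  have : Fibration (cylProjection f) := cylProjection_fibration f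
  have : WeakEquivalence (cylProjection f) := cylProjection_weakEquivalence f hf
  have hlift : HasLiftingProperty (initial.to T') (cylProjection f) :=
    hT'.mem _ (mem_trivialFibrations _)
  have sq : CommSq (initial.to (cylFinitaryMonad f)) (initial.to T') (cylProjection f) (𝟙 T') :=
    ⟨Subsingleton.elim _ _⟩
  -- The lift is a section of the projection. Its source component is `g`, and the isomorphism it
  -- stores is the homotopy `h`.
  have hs : sq.lift ≫ cylProjection f = 𝟙 T' := sq.fac_right
  refine ⟨sq.lift.toMonadHom ≫ cylMonadLeft f, sq.lift.toMonadHom ≫ cylMonadPath f, ?_, ?_⟩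
  · exact (Category.assoc sq.lift.toMonadHom (cylMonadPath f) _).trans
      (((congrArg (sq.lift.toMonadHom ≫ ·) (cylMonadLeft_comp f)).symm).trans
        (Category.assoc sq.lift.toMonadHom (cylMonadLeft f) _).symm)
  · refine (Category.assoc sq.lift.toMonadHom (cylMonadPath f) _).trans ?_
    exact (congrArg (sq.lift.toMonadHom ≫ ·) (cylMonadPath_comp f)).trans
      (congrArg FinitaryMonad.Hom.toMonadHom hs)

/-! ## Lifting homotopies along weak equivalences of 2-monads -/

/-- An isomorphism is determined by its end points and its image under a fully faithful functor.
This is the joint monicity that lets lifted homotopies be recognized as monad morphisms. -/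
lemma pow_ext_fullyFaithful {Z A B : Cat.{u, u}} {φ : A ⟶ B} (hφ : φ.toFunctor.FullyFaithful)
    {v w : Z ⟶ pow.obj A} (h₀ : v ≫ ev A .zero = w ≫ ev A .zero)
    (h₁ : v ≫ ev A .one = w ≫ ev A .one) (h : v ≫ pow.map φ = w ≫ pow.map φ) : v = w := by
  refine pow_ext_iso h₀ h₁ (whiskerRight_injective hφ ?_)
  have := whiskerLeft_congr h (evIso B .zero .one).hom
  simp only [whiskerLeft_comp_cat, pow_map_evIso, Bicategory.whiskerLeft_comp,
    Bicategory.whiskerLeft_eqToHom, Category.assoc, eqToHom_trans, eqToHom_trans_assoc,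
    ← whisker_assoc_cat] at this
  have e₀ : v ≫ pow.map φ ≫ ev B .zero = (v ≫ ev A .zero) ≫ φ := by rw [Category.assoc, pow_map_ev]
  have e₁ : (v ≫ ev A .one) ≫ φ = v ≫ pow.map φ ≫ ev B .one := by rw [Category.assoc, pow_map_ev]
  rw [← cancel_epi (eqToHom e₀), ← cancel_mono (eqToHom e₁)]
  simp only [Bicategory.comp_whiskerRight, Bicategory.eqToHom_whiskerRight, Category.assoc,
    eqToHom_trans, eqToHom_trans_assoc]
  exact this

section

variable {Z A B : Cat.{u, u}} {φ : A ⟶ B} (hφ : φ.toFunctor.FullyFaithful) {F G : Z ⟶ A}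
  {p : Z ⟶ pow.obj B} (h₀ : p ≫ ev B .zero = F ≫ φ) (h₁ : p ≫ ev B .one = G ≫ φ)

/-- Lifting isomorphisms along a fully faithful functor. -/
def powLiftAlong : Z ⟶ pow.obj A :=
  powLift (cellIsoLift hφ (eqToIso h₀.symm ≪≫ Bicategory.whiskerLeftIso p (evIso B .zero .one) ≪≫
    eqToIso h₁))

lemma powLiftAlong_zero : powLiftAlong hφ h₀ h₁ ≫ ev A .zero = F := rfl

lemma powLiftAlong_one : powLiftAlong hφ h₀ h₁ ≫ ev A .one = G := rfl

lemma powLiftAlong_map : powLiftAlong hφ h₀ h₁ ≫ pow.map φ = p := by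
  refine pow_ext_iso (by rw [Category.assoc, pow_map_ev, h₀]; rfl)
    (by rw [Category.assoc, pow_map_ev, h₁]; rfl) ?_
  simp only [whiskerLeft_comp_cat, pow_map_evIso, Bicategory.whiskerLeft_comp,
    Bicategory.whiskerLeft_eqToHom, Category.assoc, eqToHom_trans_assoc, ← whisker_assoc_cat,
    eqToHom_trans, powLiftAlong, powLift_evIso, Bicategory.comp_whiskerRight,
    Bicategory.eqToHom_whiskerRight, cellIsoLift_hom, cellLift_whiskerRight, Iso.trans_hom,
    eqToIso.hom, Bicategory.whiskerLeftIso_hom]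

end

/-- A homotopy between endomorphisms of the target of a weak equivalence lifts to its source. -/
theorem exists_homotopyLift {T T' : FinitaryMonad.{u}} (f : T ⟶ T') (hf : WeakEquivalence f)
    (g : T'.toMonad ⟶ T.toMonad) (h : T'.toMonad ⟶ T'.powMonad)
    (h₀ : h ≫ T'.evHom .zero = g ≫ f.toMonadHom) (h₁ : h ≫ T'.evHom .one = 𝟙 _) :
    ∃ k : T.toMonad ⟶ T.powMonad, k ≫ T.evHom .zero = f.toMonadHom ≫ g ∧
      k ≫ T.evHom .one = 𝟙 _ ∧ k ≫ FinitaryMonad.powHom f = f.toMonadHom ≫ h := by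
  have hX := isEquivalence_app f hf
  let φ (X : Cat.{u, u}) : T.obj X ⟶ T'.obj X := f.toMonadHom.app X
  have hφ (X : Cat.{u, u}) : (φ X).toFunctor.FullyFaithful :=
    have := hX X
    Functor.FullyFaithful.ofFullyFaithful _
  -- For `t` in `T X`, the homotopy `h` at `f t` is an isomorphism `f (g (f t)) ≅ f t`; its unique
  -- lift `g (f t) ≅ t` is the component of `k`.
  let p (X : Cat.{u, u}) : T.obj X ⟶ pow.obj (T'.obj X) := φ X ≫ h.app X
  let F (X : Cat.{u, u}) : T.obj X ⟶ T.obj X := φ X ≫ g.app X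
  have e₀ (X : Cat.{u, u}) : p X ≫ ev (T'.obj X) .zero = F X ≫ φ X :=
    congrArg (φ X ≫ ·) (congrArg (fun k : T'.toMonad ⟶ T'.toMonad => k.app X) h₀)
  have e₁ (X : Cat.{u, u}) : p X ≫ ev (T'.obj X) .one = 𝟙 _ ≫ φ X :=
    (congrArg (φ X ≫ ·) (congrArg (fun k : T'.toMonad ⟶ T'.toMonad => k.app X) h₁)).trans (Category.comp_id _)
  -- Three monad morphisms jointly detect equality into `T.powMonad`: the two end points, indexed by
  -- `some`, and the image under `f`, indexed by `none`.
  let M : Option WalkingIso.{0} → CategoryTheory.Monad Cat.{u, u}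
    | none => T'.powMonad
    | some _ => T.toMonad
  let a : ∀ i, T.powMonad ⟶ M i
    | none => FinitaryMonad.powHom f
    | some i => T.evHom i
  let b : ∀ i, T.toMonad ⟶ M i
    | none => f.toMonadHom ≫ h
    | some i => WalkingIso.rec (f.toMonadHom ≫ g) (𝟙 _) i
  have hb : ∀ X i, powLiftAlong (hφ X) (e₀ X) (e₁ X) ≫ (a i).app X = (b i).app X := by
    rintro X (_ | i)
    · exact powLiftAlong_map (hφ X) (e₀ X) (e₁ X)
    · induction i
      · exact powLiftAlong_zero (hφ X) (e₀ X) (e₁ X)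
      · exact powLiftAlong_one (hφ X) (e₀ X) (e₁ X)
  refine ⟨monadHomOfJointlyMono a (fun v w h => pow_ext_fullyFaithful (hφ _)
    (h (some .zero)) (h (some .one)) (h none)) b (fun X => powLiftAlong (hφ X) (e₀ X) (e₁ X)) hb,
    MonadHom.ext (funext fun X => hb X (some .zero)),
    MonadHom.ext (funext fun X => hb X (some .one)),
    MonadHom.ext (funext fun X => hb X none)⟩

/-! ## Colimits of algebras for monads which preserve sequential colimits -/

universe v w

section PreAlgebra

variable {C : Type w} [Category.{v} C] (T : CategoryTheory.Monad C)

variable {T} in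
lemma hasLimits_algebra [HasLimitsOfSize.{v, v} C] : HasLimitsOfSize.{v, v} T.Algebra :=
  ⟨fun _ _ => hasLimitsOfShape_of_hasLimitsOfShape_createsLimitsOfShape T.forget⟩

/-- A sequence of approximations of an algebra. -/
structure AlgebraSeq where
  /-- The approximations. -/
  X : ℕ → C
  /-- The transition maps. -/
  q (n : ℕ) : X n ⟶ X (n + 1)
  /-- The partial actions. -/
  x (n : ℕ) : T.obj (X n) ⟶ X (n + 1)
  unit (n : ℕ) : T.η.app (X n) ≫ x n = q n
  map_q (n : ℕ) : T.map (q n) ≫ x (n + 1) = x n ≫ q (n + 1)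
  map_x (n : ℕ) : T.map (x n) ≫ x (n + 1) = T.μ.app (X n) ≫ x n ≫ q (n + 1)

variable {T}

namespace AlgebraSeq

variable (S : AlgebraSeq T)

/-- The sequence of approximations, as a functor. -/
noncomputable def seq : ℕ ⥤ C :=
  Functor.ofSequence (X := S.X) S.q

lemma seq_map_succ (n : ℕ) : S.seq.map (homOfLE (Nat.le_add_right n 1)) = S.q n :=
  Functor.ofSequence_map_homOfLE_succ _ n

/-- Cocones on the sequence of approximations. -/
noncomputable def seqCocone {S : AlgebraSeq T} (F : C ⥤ C) {Z : C}
    (k : ∀ n, F.obj (S.X n) ⟶ Z) (hk : ∀ n, F.map (S.q n) ≫ k (n + 1) = k n) :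
    Cocone (S.seq ⋙ F) where
  pt := Z
  ι := NatTrans.ofSequence k (fun n => by
    change F.map (S.seq.map (homOfLE (Nat.le_add_right n 1))) ≫ k (n + 1) = k n ≫ 𝟙 Z
    rw [seq_map_succ]
    exact (hk n).trans (Category.comp_id _).symm)

variable [HasColimitsOfSize.{v, v} C]

/-- The underlying object of the generated algebra. -/
noncomputable def gen : C := colimit S.seq

/-- The approximations of the generated algebra. -/
noncomputable def ι (n : ℕ) : S.X n ⟶ S.gen := colimit.ι S.seq n

lemma q_ι (n : ℕ) : S.q n ≫ S.ι (n + 1) = S.ι n := by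
  rw [← seq_map_succ]
  exact colimit.w S.seq _

/-- Used for the identity, for `T` and for `T` composed with itself, each of which preserves the
sequential colimit. -/
lemma map_hom_ext (F : C ⥤ C) [PreservesColimitsOfShape ℕ F] {Z : C} {a b : F.obj S.gen ⟶ Z}
    (h : ∀ n, F.map (S.ι n) ≫ a = F.map (S.ι n) ≫ b) : a = b :=
  (isColimitOfPreserves F (colimit.isColimit S.seq)).hom_ext h

lemma exists_desc (F : C ⥤ C) [PreservesColimitsOfShape ℕ F] {Z : C}
    (k : ∀ n, F.obj (S.X n) ⟶ Z) (hk : ∀ n, F.map (S.q n) ≫ k (n + 1) = k n) :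
    ∃ d : F.obj S.gen ⟶ Z, ∀ n, F.map (S.ι n) ≫ d = k n :=
  ⟨(isColimitOfPreserves F (colimit.isColimit S.seq)).desc (seqCocone F k hk), fun n =>
    (isColimitOfPreserves F (colimit.isColimit S.seq)).fac (seqCocone F k hk) n⟩

variable [PreservesColimitsOfShape ℕ T.toFunctor]

lemma exists_action : ∃ b : T.obj S.gen ⟶ S.gen, ∀ n, T.map (S.ι n) ≫ b = S.x n ≫ S.ι (n + 1) :=
  S.exists_desc T.toFunctor _ fun n => by
    rw [reassoc_of% S.map_q n, q_ι]

/-- Compatible partial actions induce an action on the colimit. Only the existence part of its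
universal property is recorded, which is all that a solution set requires. -/
lemma exists_algebra : ∃ (B : T.Algebra) (k : ∀ n, S.X n ⟶ B.A),
    (∀ n, S.q n ≫ k (n + 1) = k n) ∧ (∀ n, T.map (k n) ≫ B.a = S.x n ≫ k (n + 1)) ∧
    ∀ (A : T.Algebra) (h : ∀ n, S.X n ⟶ A.A), (∀ n, S.q n ≫ h (n + 1) = h n) →
      (∀ n, T.map (h n) ≫ A.a = S.x n ≫ h (n + 1)) → ∃ g : B ⟶ A, ∀ n, k n ≫ g.f = h n := by
  obtain ⟨b, hb⟩ := S.exists_action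
  have hunit : T.η.app S.gen ≫ b = 𝟙 _ := by
    refine S.map_hom_ext (𝟭 C) fun n => ?_
    have := T.η.naturality (S.ι n)
    dsimp at this ⊢
    rw [reassoc_of% this, hb, ← Category.assoc, S.unit, q_ι, Category.comp_id]
  have hassoc : T.μ.app S.gen ≫ b = T.map b ≫ b := by
    refine S.map_hom_ext (T.toFunctor ⋙ T.toFunctor) fun n => ?_
    have h := T.μ.naturality (S.ι n)
    dsimp at h ⊢
    rw [reassoc_of% h, hb, ← T.map_comp_assoc, hb, T.map_comp_assoc, hb, reassoc_of% S.map_x n,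
      q_ι]
  refine ⟨⟨S.gen, b, hunit, hassoc⟩, S.ι, S.q_ι, hb, fun A h hq hx => ?_⟩
  obtain ⟨g, hg⟩ := S.exists_desc (𝟭 C) h hq
  dsimp at g hg
  refine ⟨⟨g, S.map_hom_ext T.toFunctor fun n => ?_⟩, hg⟩
  dsimp
  rw [← T.map_comp_assoc, hg, hx, reassoc_of% hb, hg]

end AlgebraSeq

variable (T)

/-- A stage of the inductive construction of an algebra. -/
structure PreAlgebra where
  /-- The current approximation. -/
  X : C
  /-- The next approximation. -/
  Y : C
  /-- The transition map. -/
  q : X ⟶ Y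
  /-- The partial action. -/
  x : T.obj X ⟶ Y
  unit : T.η.app X ≫ x = q

variable {T}

/-- A morphism from a partial algebra to an algebra. -/
def PreAlgebra.IsHom (S : PreAlgebra T) (A : T.Algebra) (h : S.Y ⟶ A.A) : Prop :=
  T.map (S.q ≫ h) ≫ A.a = S.x ≫ h

variable [HasColimitsOfSize.{v, v} C]

namespace PreAlgebra

variable (S : PreAlgebra T)

/-- The first relation defining the next stage. -/
noncomputable def rel₁ : T.obj S.X ⨿ T.obj (T.obj S.X) ⟶ T.obj S.Y :=
  coprod.desc (T.map S.q) (T.map S.x)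

/-- The second relation defining the next stage. -/
noncomputable def rel₂ : T.obj S.X ⨿ T.obj (T.obj S.X) ⟶ T.obj S.Y :=
  coprod.desc (S.x ≫ T.η.app S.Y) (T.μ.app S.X ≫ S.x ≫ T.η.app S.Y)

/-- The next stage. -/
@[simps X Y]
noncomputable def next : PreAlgebra T where
  X := S.Y
  -- The new action is the quotient map itself. The first relation makes it extend the old partial
  -- action, the second is associativity on what is already defined.
  Y := coequalizer S.rel₁ S.rel₂
  q := T.η.app S.Y ≫ coequalizer.π _ _
  x := coequalizer.π _ _
  unit := rfl

lemma map_q_next : T.map S.q ≫ S.next.x = S.x ≫ S.next.q := by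
  have := congrArg (coprod.inl ≫ ·) (coequalizer.condition S.rel₁ S.rel₂)
  simp only [rel₁, rel₂, coprod.inl_desc_assoc, Category.assoc] at this
  exact this

lemma map_x_next : T.map S.x ≫ S.next.x = T.μ.app S.X ≫ S.x ≫ S.next.q := by
  have := congrArg (coprod.inr ≫ ·) (coequalizer.condition S.rel₁ S.rel₂)
  simp only [rel₁, rel₂, coprod.inr_desc_assoc, Category.assoc] at this
  exact this

/-- The extension is induced by `T.map h ≫ A.a`, which respects the two relations because of the
unit and associativity laws of `A`. -/
lemma exists_next {A : T.Algebra} {h : S.Y ⟶ A.A} (hh : S.IsHom A h) :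
    ∃ h' : S.next.Y ⟶ A.A, S.next.q ≫ h' = h ∧ S.next.IsHom A h' := by
  have hh' : T.map S.q ≫ T.map h ≫ A.a = S.x ≫ h := by
    rw [← T.map_comp_assoc]
    exact hh
  have hη : T.η.app S.Y ≫ T.map h ≫ A.a = h := by
    have := T.η.naturality h
    dsimp at this
    rw [← reassoc_of% this, A.unit, Category.comp_id]
  have key : S.rel₁ ≫ T.map h ≫ A.a = S.rel₂ ≫ T.map h ≫ A.a := by
    apply coprod.hom_ext
    · simp only [rel₁, rel₂, coprod.inl_desc_assoc, Category.assoc, hη, hh']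
    · have hμ := T.μ.naturality (S.q ≫ h)
      dsimp at hμ
      simp only [rel₁, rel₂, coprod.inr_desc_assoc, Category.assoc, hη]
      rw [← hh, ← reassoc_of% hμ, A.assoc, ← T.map_comp_assoc, ← T.map_comp_assoc, ← hh]
  have hq : S.next.q ≫ coequalizer.desc (T.map h ≫ A.a) key = h := by
    simp [next, hη]
  refine ⟨coequalizer.desc _ key, hq, ?_⟩
  change T.map (S.next.q ≫ _) ≫ _ = _
  rw [hq]
  exact (coequalizer.π_desc _ _).symm

/-- The stages of the construction. -/
noncomputable def stage : ℕ → PreAlgebra T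
  | 0 => S
  | n + 1 => (stage n).next

/-- The sequence of approximations generated by a partial algebra. -/
noncomputable def algebraSeq : AlgebraSeq T where
  X n := (S.stage n).X
  q n := (S.stage n).q
  x n := (S.stage n).x
  unit n := (S.stage n).unit
  map_q n := (S.stage n).map_q_next
  map_x n := (S.stage n).map_x_next

variable [PreservesColimitsOfShape ℕ T.toFunctor]

/-- A partial algebra generates a weakly free algebra. -/
lemma exists_weaklyFree : ∃ (B : T.Algebra) (k : S.Y ⟶ B.A), S.IsHom B k ∧
    ∀ (A : T.Algebra) (h : S.Y ⟶ A.A), S.IsHom A h → ∃ g : B ⟶ A, k ≫ g.f = h := by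
  obtain ⟨B, k, hq, hx, hB⟩ := S.algebraSeq.exists_algebra
  -- The index is `1` because the object `Y` of stage `0` is the object `X` of stage `1`.
  refine ⟨B, k 1, ?_, fun A h hh => ?_⟩
  · have : S.q ≫ k 1 = k 0 := hq 0
    exact (congrArg (fun t => T.map t ≫ B.a) this).trans (hx 0)
  · let P (n : ℕ) : Type v := { h : (S.stage n).Y ⟶ A.A // (S.stage n).IsHom A h }
    choose s hs hs' using fun (n : ℕ) (p : P n) => (S.stage n).exists_next p.2
    let p (n : ℕ) : P n := Nat.rec ⟨h, hh⟩ (fun n p => ⟨s n p, hs' n p⟩) n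
    let l : ∀ n, (S.stage n).X ⟶ A.A := fun n => (S.stage n).q ≫ (p n).1
    have hl (n : ℕ) : l (n + 1) = (p n).1 := hs n (p n)
    obtain ⟨g, hg⟩ := hB A l (fun n => congrArg ((S.stage n).q ≫ ·) (hl n))
      (fun n => (p n).2.trans (congrArg ((S.stage n).x ≫ ·) (hl n).symm))
    exact ⟨g, (hg 1).trans (hl 0)⟩

end PreAlgebra

section

variable {J : Type v} (A : J → T.Algebra) {X : C} (i : ∀ j, (A j).A ⟶ X)

/-- The first relation which makes a family of morphisms compatible with the actions. -/
noncomputable def familyRel₁ : (∐ fun j => T.obj (A j).A) ⟶ T.obj X :=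
  Sigma.desc fun j => T.map (i j)

/-- The second relation which makes a family of morphisms compatible with the actions. -/
noncomputable def familyRel₂ : (∐ fun j => T.obj (A j).A) ⟶ T.obj X :=
  Sigma.desc fun j => (A j).a ≫ i j ≫ T.η.app X

/-- The first approximation of the algebra generated by a family of algebras. -/
noncomputable def familyPreAlgebra : PreAlgebra T where
  X := X
  Y := coequalizer (familyRel₁ A i) (familyRel₂ A i)
  q := T.η.app _ ≫ coequalizer.π _ _
  x := coequalizer.π _ _
  unit := rfl

/-- The morphism to the first approximation of the algebra generated by a family of algebras. -/
noncomputable def familyQ : X ⟶ (familyPreAlgebra A i).Y := (familyPreAlgebra A i).q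

lemma familyPreAlgebra_w (j : J) : T.map (i j) ≫ (familyPreAlgebra A i).x =
    (A j).a ≫ i j ≫ familyQ A i := by
  have := congrArg (Sigma.ι (fun j => T.obj (A j).A) j ≫ ·)
    (coequalizer.condition (familyRel₁ A i) (familyRel₂ A i))
  simp only [familyRel₁, familyRel₂, Sigma.ι_desc_assoc, Category.assoc] at this
  exact this

variable {A i}

lemma familyPreAlgebra_isHom_comp {B : T.Algebra} {k : (familyPreAlgebra A i).Y ⟶ B.A}
    (hk : (familyPreAlgebra A i).IsHom B k) (j : J) :
    T.map (i j ≫ familyQ A i ≫ k) ≫ B.a = (A j).a ≫ i j ≫ familyQ A i ≫ k := by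
  have hk' : T.map (familyQ A i ≫ k) ≫ B.a = (familyPreAlgebra A i).x ≫ k := hk
  have h := familyPreAlgebra_w A i j
  rw [T.map_comp, Category.assoc, hk', ← reassoc_of% h]
  exact (Category.assoc _ _ _).symm

lemma exists_familyPreAlgebra_desc {B : T.Algebra} {d : X ⟶ B.A}
    (hd : ∀ j, T.map (i j ≫ d) ≫ B.a = (A j).a ≫ i j ≫ d) :
    ∃ h : (familyPreAlgebra A i).Y ⟶ B.A, (familyPreAlgebra A i).IsHom B h ∧
      familyQ A i ≫ h = d := by
  have hη : T.η.app _ ≫ T.map d ≫ B.a = d := by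
    have := T.η.naturality d
    dsimp at this
    rw [← reassoc_of% this, B.unit, Category.comp_id]
  have key : familyRel₁ A i ≫ T.map d ≫ B.a = familyRel₂ A i ≫ T.map d ≫ B.a := by
    apply Sigma.hom_ext
    intro j
    simp only [familyRel₁, familyRel₂, Sigma.ι_desc_assoc, Category.assoc, hη, ← hd,
      T.map_comp]
  have hq : familyQ A i ≫ coequalizer.desc (T.map d ≫ B.a) key = d :=
    (Category.assoc _ _ _).trans ((congrArg (_ ≫ ·) (coequalizer.π_desc _ _)).trans hη)
  refine ⟨coequalizer.desc _ key, ?_, hq⟩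
  exact (congrArg (fun t => T.map t ≫ B.a) hq).trans (coequalizer.π_desc _ _).symm

end

section

variable {J : Type v} [SmallCategory J] (D : J ⥤ T.Algebra)

/-- The coprojections of the colimit of the underlying objects. -/
noncomputable def forgetι (j : J) : (D.obj j).A ⟶ colimit (D ⋙ T.forget) :=
  colimit.ι (D ⋙ T.forget) j

lemma forgetι_w {i j : J} (f : i ⟶ j) : (D.map f).f ≫ forgetι D j = forgetι D i :=
  colimit.w (D ⋙ T.forget) f

lemma forgetι_w_assoc {i j : J} (f : i ⟶ j) {Z : C} (h : colimit (D ⋙ T.forget) ⟶ Z) :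
    (D.map f).f ≫ forgetι D j ≫ h = forgetι D i ≫ h := by
  rw [← Category.assoc, forgetι_w]

/-- The cocone of algebras given by a morphism from the colimit of the underlying objects. -/
noncomputable def algebraCocone {B : T.Algebra} {d : colimit (D ⋙ T.forget) ⟶ B.A}
    (hd : ∀ j, T.map (forgetι D j ≫ d) ≫ B.a = (D.obj j).a ≫ forgetι D j ≫ d) :
    D ⟶ (Functor.const J).obj B where
  app j := { f := forgetι D j ≫ d, h := hd j }
  naturality i j f := by
    ext
    exact (forgetι_w_assoc D f d).trans (Category.comp_id _).symm

lemma exists_forget_desc {B : T.Algebra} (s : D ⟶ (Functor.const J).obj B) :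
    ∃ d : colimit (D ⋙ T.forget) ⟶ B.A, ∀ j, forgetι D j ≫ d = (s.app j).f :=
  ⟨colimit.desc _ (T.forget.mapCocone ⟨B, s⟩), fun _ => colimit.ι_desc _ _⟩

end

/-- Categories of algebras of monads which preserve sequential colimits are cocomplete. -/
theorem hasColimits_algebra [HasLimitsOfSize.{v, v} C] [PreservesColimitsOfShape ℕ T.toFunctor] :
    HasColimitsOfSize.{v, v} T.Algebra where
  has_colimits_of_shape J _ := by
    have : HasLimitsOfSize.{v, v} T.Algebra := hasLimits_algebra
    -- A colimit functor is a left adjoint of the diagonal. Algebras are complete and the diagonal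
    -- preserves limits, so a weakly universal cocone, here a one-element solution set, suffices.
    rw [hasColimitsOfShape_iff_isRightAdjoint_const]
    refine isRightAdjoint_of_preservesLimits_of_solutionSetCondition _ fun D => ?_
    obtain ⟨B, k, hk, hB⟩ := (familyPreAlgebra D.obj (forgetι D)).exists_weaklyFree
    refine ⟨PUnit, fun _ => B, fun _ => algebraCocone D (familyPreAlgebra_isHom_comp hk),
      fun A s => ?_⟩
    obtain ⟨d, hd⟩ := exists_forget_desc D s
    obtain ⟨h, hh, hs⟩ := exists_familyPreAlgebra_desc (A := D.obj) (i := forgetι D) (B := A)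
      (d := d) (fun j => by rw [hd]; exact (s.app j).h)
    obtain ⟨g, hg⟩ := hB A h hh
    refine ⟨⟨⟩, g, ?_⟩
    ext j
    refine Eq.trans ?_ (hd j)
    refine (Category.assoc _ _ _).trans (congrArg (_ ≫ ·) ?_)
    exact (Category.assoc _ _ _).trans ((congrArg (_ ≫ ·) hg).trans hs)

end PreAlgebra

/-! ### Limits, colimits and change of 2-monad for algebras. -/

section Cat

instance (T : FinitaryMonad.{u}) : PreservesFilteredColimits T.toMonad.toFunctor := T.finitary

instance (T : FinitaryMonad.{u}) : PreservesColimitsOfShape ℕ T.toMonad.toFunctor :=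
  preservesColimitsOfShape_of_equiv (ULiftHomULiftCategory.equiv.{u, u} ℕ).symm _

instance (T : FinitaryMonad.{u}) : HasLimits T.Alg := hasLimits_algebra

instance (T : FinitaryMonad.{u}) : HasColimits T.Alg := hasColimits_algebra

/-- By the adjoint triangle theorem: `restrict f` followed by the monadic forgetful functor of `T`
is the forgetful functor of `T'`, a right adjoint, and `T'.Alg` has coequalizers. -/
instance {T T' : FinitaryMonad.{u}} (f : T ⟶ T') : (restrict f).IsRightAdjoint :=
  have : (restrict f ⋙ T.toMonad.forget).IsRightAdjoint :=
    T'.toMonad.adj.isRightAdjoint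
  isRightAdjoint_triangle_lift_monadic T.toMonad.forget

end Cat

/-! ## Generating cofibrations and generating trivial cofibrations of `Cat` -/

/-- The category with one object. -/
abbrev point : Cat.{u, u} := Cat.of (Discrete PUnit.{u + 1})

/-- The category with one non-identity arrow. -/
abbrev interval : Cat.{u, u} := Cat.of (AsSmall.{u} (Fin 2))

/-- The functor from the empty category. -/
def emptyFunctor (X : Cat.{u, u}) : Cat.of (Discrete PEmpty.{u + 1}) ⟶ X :=
  (Discrete.functor PEmpty.elim).toCatHom

/-- The functor which classifies an object. -/
def pointFunctor {X : Cat.{u, u}} (x : X) : point.{u} ⟶ X :=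
  (Discrete.functor fun _ => x).toCatHom

/-- The functor which classifies a morphism. -/
def arrowFunctor {X : Cat.{u, u}} {x y : X} (f : x ⟶ y) : interval.{u} ⟶ X :=
  (AsSmall.down ⋙ ComposableArrows.mk₁ f).toCatHom

/-- The functor which classifies a pair of objects. -/
def pairFunctor {X : Cat.{u, u}} (x y : X) : Cat.of (Discrete (ULift.{u} Bool)) ⟶ X :=
  (Discrete.functor fun b => bif b.down then y else x).toCatHom

/-- The functor which classifies a pair of parallel morphisms. -/
def parallelFunctor {X : Cat.{u, u}} {x y : X} (f g : x ⟶ y) :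
    Cat.of (AsSmall.{u} WalkingParallelPair) ⟶ X :=
  (AsSmall.down ⋙ parallelPair f g).toCatHom

/-- The source of the non-identity arrow. -/
def intervalZero : interval.{u} := AsSmall.up.obj (0 : Fin 2)

/-- The target of the non-identity arrow. -/
def intervalOne : interval.{u} := AsSmall.up.obj (1 : Fin 2)

/-- The non-identity arrow. -/
def intervalHom : intervalZero.{u} ⟶ intervalOne :=
  AsSmall.up.map (homOfLE (by decide))

/-- The inclusion of the end points of the interval. -/
def boundary : Cat.of (Discrete (ULift.{u} Bool)) ⟶ interval.{u} :=
  pairFunctor intervalZero intervalOne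

/-- The functor which identifies two parallel arrows. -/
def collapse : Cat.of (AsSmall.{u} WalkingParallelPair) ⟶ interval.{u} :=
  parallelFunctor intervalHom intervalHom

/-- The free isomorphism. -/
abbrev freeIso : Cat.{u, u} := Cat.of (AsSmall.{u} WalkingIso.{0})

/-- The inclusion of the empty category in the category with one object. -/
def emptyToPoint : Cat.of (Discrete PEmpty.{u + 1}) ⟶ point.{u} :=
  emptyFunctor point

/-- The functor which classifies an isomorphism. -/
def isoFunctor {X : Cat.{u, u}} {x y : X} (e : x ≅ y) : freeIso.{u} ⟶ X :=
  (AsSmall.down ⋙ WalkingIso.fromIso e).toCatHom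

/-- The inclusion of the source of the free isomorphism. -/
def pointToIso : point.{u} ⟶ freeIso :=
  pointFunctor (X := freeIso) (AsSmall.up.obj WalkingIso.zero)

/-- The generating cofibrations of `Cat`. -/
def generatingCofibration : Fin 3 → Arrow Cat.{u, u} :=
  ![Arrow.mk emptyToPoint, Arrow.mk boundary, Arrow.mk collapse]

instance : Finite (Arrow (Discrete PEmpty.{u + 1})) :=
  have : Finite (Discrete PEmpty.{u + 1}) := Finite.of_equiv _ discreteEquiv.symm
  finite_arrow _

instance : Finite (Arrow (Discrete PUnit.{u + 1})) :=
  have : Finite (Discrete PUnit.{u + 1}) := Finite.of_equiv _ discreteEquiv.symm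
  finite_arrow _

instance : Finite (Arrow (Discrete (ULift.{u} Bool))) :=
  have : Finite (Discrete (ULift.{u} Bool)) := Finite.of_equiv _ discreteEquiv.symm
  finite_arrow _

instance : Finite (Arrow (AsSmall.{u} WalkingParallelPair)) :=
  have : Finite (AsSmall.{u} WalkingParallelPair) :=
    inferInstanceAs (Finite (ULift WalkingParallelPair))
  have (x y : AsSmall.{u} WalkingParallelPair) : Finite (x ⟶ y) :=
    inferInstanceAs (Finite (ULift (AsSmall.down.obj x ⟶ AsSmall.down.obj y)))
  finite_arrow _

instance (k : Fin 3) : Finite (Arrow (generatingCofibration.{u} k).left) := by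
  fin_cases k
  · exact inferInstanceAs (Finite (Arrow (Discrete PEmpty)))
  · exact inferInstanceAs (Finite (Arrow (Discrete (ULift Bool))))
  · exact inferInstanceAs (Finite (Arrow (AsSmall WalkingParallelPair)))

lemma emptyToPoint_injective : Function.Injective emptyToPoint.{u}.toFunctor.obj :=
  fun x => x.as.elim

lemma boundary_injective : Function.Injective boundary.{u}.toFunctor.obj := by
  rintro ⟨⟨_ | _⟩⟩ ⟨⟨_ | _⟩⟩ h
  · rfl
  · exact absurd (congrArg (fun x : AsSmall.{u} (Fin 2) => AsSmall.down.{0, 0, u}.obj x) h) zero_ne_one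
  · exact absurd (congrArg (fun x : AsSmall.{u} (Fin 2) => AsSmall.down.{0, 0, u}.obj x) h) one_ne_zero
  · rfl

lemma collapse_injective : Function.Injective collapse.{u}.toFunctor.obj := by
  rintro ⟨_ | _⟩ ⟨_ | _⟩ h
  · rfl
  · exact absurd (congrArg (fun x : AsSmall.{u} (Fin 2) => AsSmall.down.{0, 0, u}.obj x) h) zero_ne_one
  · exact absurd (congrArg (fun x : AsSmall.{u} (Fin 2) => AsSmall.down.{0, 0, u}.obj x) h) one_ne_zero
  · rfl

section

variable {X Y : Cat.{u, u}} (p : X ⟶ Y)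

/-- A functor which is fully faithful and surjective on objects has the right lifting property
with respect to the functors which are injective on objects. -/
lemma hasLiftingProperty_of_injective [p.toFunctor.Full] [p.toFunctor.Faithful]
    (hp : Function.Surjective p.toFunctor.obj) {A B : Cat.{u, u}} (i : A ⟶ B)
    (hi : Function.Injective i.toFunctor.obj) : HasLiftingProperty i p where
  sq_hasLift {a b} sq := by
    classical
    have w (x : A) : p.toFunctor.obj (a.toFunctor.obj x) = b.toFunctor.obj (i.toFunctor.obj x) :=
      congrArg (fun F : A ⟶ Y => F.toFunctor.obj x) sq.w
    -- On the image of `i` the value is prescribed, consistently since `i` is injective on objects;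
    -- elsewhere any preimage under `p` will do.
    have hl (y : B) : ∃ x : X, p.toFunctor.obj x = b.toFunctor.obj y ∧
        ∀ z : A, i.toFunctor.obj z = y → a.toFunctor.obj z = x := by
      by_cases h : ∃ z : A, i.toFunctor.obj z = y
      · obtain ⟨z, rfl⟩ := h
        exact ⟨a.toFunctor.obj z, w z, fun z' hz' => congrArg _ (hi hz')⟩
      · obtain ⟨x, hx⟩ := hp (b.toFunctor.obj y)
        exact ⟨x, hx, fun z hz => (h ⟨z, hz⟩).elim⟩
    choose l hpl hal using hl
    let L : B ⥤ X :=
      { obj := l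
        map {y y'} f := p.toFunctor.preimage
          (eqToHom (hpl y) ≫ b.toFunctor.map f ≫ eqToHom (hpl y').symm)
        map_id y := p.toFunctor.map_injective (by simp)
        map_comp f g := p.toFunctor.map_injective (by simp) }
    refine ⟨⟨⟨L.toCatHom, ?_, ?_⟩⟩⟩
    · refine Cat.ext (CategoryTheory.Functor.ext (fun z => (hal _ z rfl).symm) fun z z' f => ?_)
      apply p.toFunctor.map_injective
      have := CategoryTheory.Functor.congr_hom (congrArg Cat.Hom.toFunctor sq.w) f
      simp only [Cat.Hom.comp_toFunctor, Functor.comp_map] at this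
      have hL (y y' : B) (f : y ⟶ y') : p.toFunctor.map (L.map f) =
          eqToHom (hpl y) ≫ b.toFunctor.map f ≫ eqToHom (hpl y').symm :=
        p.toFunctor.map_preimage _
      simp only [Functor.map_comp, eqToHom_map, this]
      change p.toFunctor.map (L.map (i.toFunctor.map f)) = _
      simp [hL]
    · refine Cat.ext (CategoryTheory.Functor.ext hpl fun y y' f => ?_)
      exact p.toFunctor.map_preimage _

variable {p}

lemma surjective_of_hasLiftingProperty [HasLiftingProperty emptyToPoint p] :
    Function.Surjective p.toFunctor.obj := by
  intro y
  have sq : CommSq (emptyFunctor X) emptyToPoint p (pointFunctor y) :=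
    ⟨Cat.ext (CategoryTheory.Functor.ext (fun x => x.as.elim) (fun x => x.as.elim))⟩
  exact ⟨sq.lift.toFunctor.obj ⟨⟨⟩⟩,
    congrArg (fun F : point ⟶ Y => F.toFunctor.obj ⟨⟨⟩⟩) sq.fac_right⟩

lemma arrow_eq_of_eq {A : Cat.{u, u}} {F G : A ⟶ X} (h : F = G) {x y : A} (f : x ⟶ y) :
    Arrow.mk (F.toFunctor.map f) = Arrow.mk (G.toFunctor.map f) := by rw [h]

lemma full_of_hasLiftingProperty [HasLiftingProperty boundary p] :
    p.toFunctor.Full where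
  map_surjective {x y} g := by
    have sq : CommSq (pairFunctor x y) boundary p (arrowFunctor g) :=
      ⟨Cat.ext (Discrete.functor_ext (by rintro (_ | _) <;> rfl))⟩
    have h₀ : sq.lift.toFunctor.obj intervalZero = x :=
      congrArg (fun F : Cat.of (Discrete (ULift.{u} Bool)) ⟶ X => F.toFunctor.obj ⟨⟨false⟩⟩) sq.fac_left
    have h₁ : sq.lift.toFunctor.obj intervalOne = y :=
      congrArg (fun F : Cat.of (Discrete (ULift.{u} Bool)) ⟶ X => F.toFunctor.obj ⟨⟨true⟩⟩) sq.fac_left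
    have h₂ : Arrow.mk (p.toFunctor.map (sq.lift.toFunctor.map intervalHom)) = Arrow.mk g :=
      arrow_eq_of_eq sq.fac_right intervalHom
    generalize sq.lift.toFunctor.map intervalHom = t at h₂
    generalize sq.lift.toFunctor.obj intervalZero = x' at *
    generalize sq.lift.toFunctor.obj intervalOne = y' at *
    subst h₀ h₁
    exact ⟨t, (Arrow.mk_inj _ _).1 h₂⟩

/-- Parallel arrows with the same image form a square over `collapse`. A lift sends the single arrow
of the interval to both of them. -/
lemma faithful_of_hasLiftingProperty [HasLiftingProperty collapse p] :
    p.toFunctor.Faithful where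
  map_injective {x y f g} hfg := by
    have sq : CommSq (parallelFunctor f g) collapse p
        (arrowFunctor (p.toFunctor.map f)) := by
      refine ⟨Cat.ext (Arrow.functor_ext ?_)⟩
      rintro ⟨a⟩ ⟨_⟩ ⟨_ | _ | _⟩
      · rfl
      · exact congrArg Arrow.mk hfg.symm
      · cases a
        · exact congrArg Arrow.mk (p.toFunctor.map_id _)
        · exact congrArg Arrow.mk (p.toFunctor.map_id _)
    have h₁ : Arrow.mk (sq.lift.toFunctor.map intervalHom) = Arrow.mk f :=
      arrow_eq_of_eq sq.fac_left (AsSmall.up.map WalkingParallelPairHom.left)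
    have h₂ : Arrow.mk (sq.lift.toFunctor.map intervalHom) = Arrow.mk g :=
      arrow_eq_of_eq sq.fac_left (AsSmall.up.map WalkingParallelPairHom.right)
    exact (Arrow.mk_inj _ _).1 (h₁.symm.trans h₂)

end

/-- The trivial fibrations of `Cat`: the fully faithful functors which are surjective on
objects. -/
lemma rlp_generatingCofibration_iff {X Y : Cat.{u, u}} (p : X ⟶ Y) :
    (MorphismProperty.ofHoms fun k => (generatingCofibration.{u} k).hom).rlp p ↔
      (catFibrations ⊓ catWeakEquivalences) p := by
  constructor
  · intro h
    have hk (k : Fin 3) : HasLiftingProperty (generatingCofibration k).hom p := h _ ⟨k⟩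
    have : HasLiftingProperty emptyToPoint p := hk 0
    have : HasLiftingProperty boundary p := hk 1
    have : HasLiftingProperty collapse p := hk 2
    have h₀ := surjective_of_hasLiftingProperty (p := p)
    have h₁ := full_of_hasLiftingProperty (p := p)
    have h₂ := faithful_of_hasLiftingProperty (p := p)
    have h₃ : p.toFunctor.EssSurj := ⟨fun y => ⟨_, ⟨eqToIso (h₀ y).choose_spec⟩⟩⟩
    refine ⟨fun x y e => ?_, { }⟩
    obtain ⟨x', rfl⟩ := h₀ y
    exact ⟨x', p.toFunctor.preimageIso e, rfl, by ext; simp⟩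
  · rintro ⟨hf, hw⟩ _ _ _ ⟨k⟩
    have : p.toFunctor.IsEquivalence := hw
    -- Essential surjectivity gives a preimage up to isomorphism, and the isofibration property
    -- makes it strict.
    have hs : Function.Surjective p.toFunctor.obj := fun y => by
      obtain ⟨x', _, h, _⟩ := hf _ _ (p.toFunctor.objObjPreimageIso y)
      exact ⟨x', h⟩
    refine hasLiftingProperty_of_injective p hs _ ?_
    fin_cases k
    · exact emptyToPoint_injective
    · exact boundary_injective
    · exact collapse_injective

lemma walkingIso_functor_ext {Y : Type u} [Category.{u} Y] {x y : Y} (e : x ≅ y) (F : WalkingIso.{0} ⥤ Y)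
    (h₀ : F.obj .zero = x) (h₁ : F.obj .one = y)
    (h : F.mapIso WalkingIso.iso = eqToIso h₀ ≪≫ e ≪≫ eqToIso h₁.symm) :
    WalkingIso.fromIso e = F := by
  subst h₀ h₁
  obtain rfl : F.mapIso WalkingIso.iso = e := by simpa using h
  exact WalkingIso.equiv.symm_apply_apply F

/-- The isofibrations are the functors which have the right lifting property with respect to the
generating trivial cofibration. -/
lemma hasLiftingProperty_pointToIso_iff {X Y : Cat.{u, u}} (p : X ⟶ Y) :
    HasLiftingProperty pointToIso p ↔ catFibrations p := by
  constructor
  · intro _ x y e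
    have sq : CommSq (pointFunctor x) pointToIso p (isoFunctor e) :=
      ⟨Cat.ext (Discrete.functor_ext fun _ => rfl)⟩
    let l := AsSmall.up ⋙ sq.lift.toFunctor
    have hl : l ⋙ p.toFunctor = WalkingIso.fromIso e :=
      congrArg (fun F : freeIso ⟶ Y => AsSmall.up ⋙ F.toFunctor) sq.fac_right
    have h₀ : l.obj .zero = x := congrArg (fun F : point ⟶ X => F.toFunctor.obj ⟨⟨⟩⟩) sq.fac_left
    clear_value l
    subst h₀
    refine ⟨l.obj .one, l.mapIso WalkingIso.iso, congrArg (fun F => F.obj WalkingIso.one) hl, ?_⟩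
    ext
    have := CategoryTheory.Functor.congr_hom hl WalkingIso.iso.hom
    refine (congrArg (· ≫ _) this).trans ?_
    have hy : y = p.toFunctor.obj (l.obj .one) :=
      (congrArg (fun F => F.obj WalkingIso.one) hl).symm
    change (eqToHom rfl ≫ e.hom ≫ eqToHom hy) ≫ eqToHom hy.symm = e.hom
    simp
  · intro h
    refine ⟨fun {a b} sq => ?_⟩
    let B : WalkingIso.{0} ⥤ Y := AsSmall.up ⋙ b.toFunctor
    let x := a.toFunctor.obj ⟨⟨⟩⟩
    have hx : p.toFunctor.obj x = B.obj .zero :=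
      congrArg (fun F : point ⟶ Y => F.toFunctor.obj ⟨⟨⟩⟩) sq.w
    obtain ⟨x', e', h', he⟩ := h x (B.obj .one) (eqToIso hx ≪≫ B.mapIso WalkingIso.iso)
    have key : WalkingIso.fromIso (p.toFunctor.mapIso e') = B :=
      walkingIso_functor_ext _ _ hx.symm h'.symm (by
        rw [he, ← Iso.trans_assoc]
        ext
        simp)
    refine ⟨⟨⟨isoFunctor e',
      Cat.ext (Discrete.functor_ext fun _ => rfl), ?_⟩⟩⟩
    refine Cat.ext ?_
    have h₂ : AsSmall.down.{0, 0, u} ⋙ WalkingIso.fromIso e' ⋙ p.toFunctor = AsSmall.down ⋙ B := by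
      rw [← key]
      exact congrArg (AsSmall.down.{0, 0, u} ⋙ ·) (walkingIso_functor_ext
        (p.toFunctor.mapIso e') (WalkingIso.fromIso e' ⋙ p.toFunctor) rfl rfl
        (Iso.ext ((Category.id_comp _).trans (Category.comp_id _)).symm)).symm
    exact h₂

/-! ## The Lack model structure on algebras -/

namespace FinitaryMonad

variable {T : FinitaryMonad.{u}}

lemma powStr_ev {Y : Cat.{u, u}} (h : T.obj Y ⟶ Y) (i : WalkingIso.{0}) :
    T.powStr h ≫ ev Y i = ev (T.obj (pow.obj Y)) i ≫ T.map (ev Y i) ≫ h := by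
  simp only [powStr, Category.assoc, pow_map_ev, diag_ev_assoc, pow_map_ev_assoc, lam_ev_assoc]

lemma powAlg_ev {S : CategoryTheory.Monad Cat.{u, u}} (k : S ⟶ T.powMonad) (i : WalkingIso.{0})
    (A : T.Alg) : S.map (ev A.A i) ≫ (k ≫ T.evHom i).app A.A ≫ A.a =
      (k.app (pow.obj A.A) ≫ T.powStr A.a) ≫ ev A.A i := by
  have h : S.map (ev A.A i) ≫ k.app A.A = k.app (pow.obj A.A) ≫ pow.map (T.map (ev A.A i)) :=
    k.naturality (ev A.A i)
  -- Abstracting the components of `k` leaves an identity between plain functors, to which the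
  -- composites of monad morphisms reduce by definition.
  have key (a : S.obj A.A ⟶ pow.obj (T.obj A.A))
      (b : S.obj (pow.obj A.A) ⟶ pow.obj (T.obj (pow.obj A.A)))
      (h : S.map (ev A.A i) ≫ a = b ≫ pow.map (T.map (ev A.A i))) :
      S.map (ev A.A i) ≫ (a ≫ ev (T.obj A.A) i) ≫ A.a = (b ≫ T.powStr A.a) ≫ ev A.A i := by
    rw [Category.assoc, reassoc_of% h, Category.assoc, powStr_ev, pow_map_ev_assoc]
  exact key _ _ h

/-- The source and the target of an isomorphism in an algebra, as morphisms of algebras. -/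
def algEvId {k : T.toMonad ⟶ T.powMonad} {i : WalkingIso.{0}}
    (hk : k ≫ T.evHom i = 𝟙 _) (A : T.Alg) :
    (CategoryTheory.Monad.algebraFunctorOfMonadHom k).obj (T.powAlg A) ⟶ A where
  f := ev A.A i
  h := by
    refine Eq.trans ?_ (powAlg_ev k i A)
    rw [hk]
    exact congrArg (_ ≫ ·) (Category.id_comp _).symm

lemma cstHom_evHom (i : WalkingIso.{0}) : T.cstHom ≫ T.evHom i = 𝟙 _ :=
  MonadHom.ext (funext fun X => cst_ev (T.obj X) i)

/-- The algebra of isomorphisms in an algebra. -/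
def pathAlg (A : T.Alg) : T.Alg :=
  (CategoryTheory.Monad.algebraFunctorOfMonadHom T.cstHom).obj (T.powAlg A)

/-- The inclusion of the identities in the algebra of isomorphisms. -/
def algCst (A : T.Alg) : A ⟶ pathAlg A where
  f := cst A.A
  h := by
    change T.map (cst A.A) ≫ cst _ ≫ T.powStr A.a = A.a ≫ cst A.A
    rw [powStr, ← cst_nat_assoc, cst_diag_assoc, lam_cst_assoc, ← cst_nat]

end FinitaryMonad

/-! ### Products of categories and the path fibration. -/

section Prod

/-- The product of two categories. -/
def prodCat (X Y : Cat.{u, u}) : Cat.{u, u} := Cat.of (X × Y)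

/-- The first projection. -/
def prodFst (X Y : Cat.{u, u}) : prodCat X Y ⟶ X := (CategoryTheory.Prod.fst X Y).toCatHom

/-- The second projection. -/
def prodSnd (X Y : Cat.{u, u}) : prodCat X Y ⟶ Y := (CategoryTheory.Prod.snd X Y).toCatHom

/-- The functor to a product with given components. -/
def prodLift {X Y Z : Cat.{u, u}} (F : Z ⟶ X) (G : Z ⟶ Y) : Z ⟶ prodCat X Y :=
  (F.toFunctor.prod' G.toFunctor).toCatHom

@[simp]
lemma prodLift_fst {X Y Z : Cat.{u, u}} (F : Z ⟶ X) (G : Z ⟶ Y) :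
    prodLift F G ≫ prodFst X Y = F := rfl

@[simp]
lemma prodLift_snd {X Y Z : Cat.{u, u}} (F : Z ⟶ X) (G : Z ⟶ Y) :
    prodLift F G ≫ prodSnd X Y = G := rfl

lemma prodCat_hom_ext {X Y Z : Cat.{u, u}} {F G : Z ⟶ prodCat X Y}
    (h₁ : F ≫ prodFst X Y = G ≫ prodFst X Y) (h₂ : F ≫ prodSnd X Y = G ≫ prodSnd X Y) :
    F = G := by
  refine Cat.ext (Arrow.functor_ext fun x y f => ?_)
  change Arrow.mk (F.toFunctor.map f) = Arrow.mk (G.toFunctor.map f)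
  have h₁ : Arrow.mk (F.toFunctor.map f).1 = Arrow.mk (G.toFunctor.map f).1 :=
    arrow_eq_of_eq h₁ f
  have h₂ : Arrow.mk (F.toFunctor.map f).2 = Arrow.mk (G.toFunctor.map f).2 :=
    arrow_eq_of_eq h₂ f
  generalize F.toFunctor.map f = s at *
  generalize G.toFunctor.map f = t at *
  generalize F.toFunctor.obj x = a at *
  generalize F.toFunctor.obj y = b at *
  generalize G.toFunctor.obj x = c at *
  generalize G.toFunctor.obj y = d at *
  obtain ⟨a₁, a₂⟩ := a
  obtain ⟨b₁, b₂⟩ := b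
  obtain ⟨c₁, c₂⟩ := c
  obtain ⟨d₁, d₂⟩ := d
  obtain ⟨s₁, s₂⟩ := s
  obtain ⟨t₁, t₂⟩ := t
  cases h₁
  cases h₂
  rfl

/-- The functor which sends an isomorphism to its end points is an isofibration. -/
lemma catFibrations_prodLift_ev (X : Cat.{u, u}) :
    catFibrations (prodLift (ev X .zero) (ev X .one)) := by
  intro x y e
  let x₁ : WalkingIso.{0} ⥤ X := x
  let e₀ : x₁.obj .zero ≅ y.1 := (prodFst X X).toFunctor.mapIso e
  let e₁ : x₁.obj .one ≅ y.2 := (prodSnd X X).toFunctor.mapIso e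
  -- The lift ends at the isomorphism `x₁` conjugated by the given isomorphisms of its end points.
  let e' : x₁ ≅ WalkingIso.fromIso (e₀.symm ≪≫ WalkingIso.toIso x₁ ≪≫ e₁) :=
    NatIso.ofComponents (fun i => WalkingIso.rec (motive := fun i => x₁.obj i ≅
        (WalkingIso.fromIso (e₀.symm ≪≫ WalkingIso.toIso x₁ ≪≫ e₁)).obj i) e₀ e₁ i)
      (fun {i j} m => by
        induction i <;> induction j
        · obtain rfl : m = 𝟙 _ := Subsingleton.elim _ _
          simp
        · obtain rfl : m = WalkingIso.iso.hom := WalkingIso.eq_iso_hom m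
          change x₁.map WalkingIso.iso.hom ≫ e₁.hom = e₀.hom ≫ e₀.inv ≫ x₁.map _ ≫ e₁.hom
          rw [e₀.hom_inv_id_assoc]
        · obtain rfl : m = WalkingIso.iso.inv := WalkingIso.eq_iso_inv m
          change x₁.map WalkingIso.iso.inv ≫ e₀.hom =
            e₁.hom ≫ (e₁.inv ≫ x₁.map WalkingIso.iso.inv) ≫ e₀.hom
          rw [Category.assoc, e₁.hom_inv_id_assoc]
        · obtain rfl : m = 𝟙 _ := Subsingleton.elim _ _
          simp)
  refine ⟨WalkingIso.fromIso (e₀.symm ≪≫ WalkingIso.toIso x₁ ≪≫ e₁), e', rfl, ?_⟩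
  exact Iso.ext (Category.comp_id _)

/-- The functor to the category with one object. -/
def toPoint (X : Cat.{u, u}) : X ⟶ point := ((Functor.const X).obj ⟨⟨⟩⟩).toCatHom

lemma point_hom_ext {X : Cat.{u, u}} (F G : X ⟶ point) : F = G :=
  Cat.ext (Functor.punit_ext' _ _)

lemma catFibrations_toPoint (X : Cat.{u, u}) : catFibrations (toPoint X) :=
  fun x _ _ => ⟨x, Iso.refl x, Subsingleton.elim (α := Discrete PUnit) _ _, by
    ext
    exact Subsingleton.elim (α := (_ : Discrete PUnit) ⟶ _) _ _⟩

lemma isEquivalence_of_iso {X Y : Cat.{u, u}} {F : X ⟶ Y} {G : Y ⟶ X} (e : F ≫ G ≅ 𝟙 X)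
    (e' : G ≫ F ≅ 𝟙 Y) : F.toFunctor.IsEquivalence :=
  (CategoryTheory.Equivalence.mk F.toFunctor G.toFunctor
    (Cat.Hom.toNatIso e).symm (Cat.Hom.toNatIso e')).isEquivalence_functor

end Prod

/-! ### Products of algebras, the terminal algebra and the three classes of morphisms. -/

namespace FinitaryMonad

variable {T : FinitaryMonad.{u}}

/-- The product of two algebras. -/
def prodAlg (A B : T.Alg) : T.Alg where
  A := prodCat A.A B.A
  a := prodLift (T.map (prodFst _ _) ≫ A.a) (T.map (prodSnd _ _) ≫ B.a)
  unit := by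
    have h₁ := T.η.naturality (prodFst A.A B.A)
    have h₂ := T.η.naturality (prodSnd A.A B.A)
    dsimp at h₁ h₂
    refine prodCat_hom_ext ?_ ?_
    · rw [Category.assoc, prodLift_fst, ← reassoc_of% h₁, A.unit]
      exact (Category.comp_id _).trans (Category.id_comp _).symm
    · rw [Category.assoc, prodLift_snd, ← reassoc_of% h₂, B.unit]
      exact (Category.comp_id _).trans (Category.id_comp _).symm
  assoc := by
    have h₁ := T.μ.naturality (prodFst A.A B.A)
    have h₂ := T.μ.naturality (prodSnd A.A B.A)
    dsimp at h₁ h₂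
    refine prodCat_hom_ext ?_ ?_
    · rw [Category.assoc, prodLift_fst, ← reassoc_of% h₁, A.assoc, Category.assoc, prodLift_fst,
        ← T.map_comp_assoc, ← T.map_comp_assoc, prodLift_fst]
    · rw [Category.assoc, prodLift_snd, ← reassoc_of% h₂, B.assoc, Category.assoc, prodLift_snd,
        ← T.map_comp_assoc, ← T.map_comp_assoc, prodLift_snd]

lemma map_prodLift (A B : T.Alg) {Y : Cat.{u, u}} {y : T.obj Y ⟶ Y} {p : Y ⟶ A.A} {q : Y ⟶ B.A}
    (hp : T.map p ≫ A.a = y ≫ p) (hq : T.map q ≫ B.a = y ≫ q) :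
    T.map (prodLift p q) ≫ prodLift (T.map (prodFst A.A B.A) ≫ A.a)
      (T.map (prodSnd A.A B.A) ≫ B.a) = y ≫ prodLift p q := by
  refine prodCat_hom_ext ?_ ?_
  · rw [Category.assoc, prodLift_fst, ← T.map_comp_assoc, prodLift_fst, Category.assoc,
      prodLift_fst, hp]
  · rw [Category.assoc, prodLift_snd, ← T.map_comp_assoc, prodLift_snd, Category.assoc,
      prodLift_snd, hq]

/-- The morphism to a product of algebras with given components. -/
def prodAlgLift {A B Z : T.Alg} (p : Z ⟶ A) (q : Z ⟶ B) : Z ⟶ prodAlg A B where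
  f := prodLift p.f q.f
  h := map_prodLift A B p.h q.h

/-- The terminal algebra. -/
def pointAlg (T : FinitaryMonad.{u}) : T.Alg where
  A := point
  a := toPoint _
  unit := point_hom_ext _ _
  assoc := point_hom_ext _ _

/-- The morphism to the terminal algebra. -/
def toPointAlg (A : T.Alg) : A ⟶ pointAlg T where
  f := toPoint A.A
  h := point_hom_ext _ _

instance : CategoryWithWeakEquivalences T.Alg where
  weakEquivalences := catWeakEquivalences.inverseImage T.toMonad.forget

instance : CategoryWithFibrations T.Alg where
  fibrations := catFibrations.inverseImage T.toMonad.forget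

instance : CategoryWithCofibrations T.Alg where
  cofibrations := (trivialFibrations T.Alg).llp

end FinitaryMonad

instance : catWeakEquivalences.{u}.HasTwoOutOfThreeProperty where
  comp_mem F G hF hG :=
    have : F.toFunctor.IsEquivalence := hF
    have : G.toFunctor.IsEquivalence := hG
    inferInstanceAs (F.toFunctor ⋙ G.toFunctor).IsEquivalence
  of_postcomp F G hG hFG :=
    have : G.toFunctor.IsEquivalence := hG
    have : (F.toFunctor ⋙ G.toFunctor).IsEquivalence := hFG
    Functor.isEquivalence_of_comp_right F.toFunctor G.toFunctor
  of_precomp F G hF hFG :=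
    have : F.toFunctor.IsEquivalence := hF
    have : (F.toFunctor ⋙ G.toFunctor).IsEquivalence := hFG
    Functor.isEquivalence_of_comp_left F.toFunctor G.toFunctor

/-! ### Smallness of free algebras on finite categories. -/

section SmallObject

variable {T : FinitaryMonad.{u}}

/-- Morphisms out of a free algebra are functors from `X` to the underlying category, and the
forgetful functor preserves filtered colimits because `T` does. -/
instance (X : Cat.{u, u}) [Finite (Arrow X)] :
    PreservesFilteredColimits (coyoneda.obj (Opposite.op (T.toMonad.free.obj X))) where
  preserves_filtered_colimits J _ _ :=
    have : PreservesColimitsOfShape J (T.toMonad.forget ⋙ coyoneda.obj (Opposite.op X)) :=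
      inferInstance
    let e : T.toMonad.forget ⋙ coyoneda.obj (Opposite.op X) ≅
        coyoneda.obj (Opposite.op (T.toMonad.free.obj X)) :=
      (T.toMonad.adj.compCoyonedaIso.app (Opposite.op X)).symm
    preservesColimitsOfShape_of_natIso e

/-- The cardinal is `ℵ₀`, as free algebras on finite categories are finitely presentable. -/
lemma hasSmallObjectArgument {ι : Type} [Finite ι] (i : ι → Arrow Cat.{u, u})
    [∀ k, Finite (Arrow (i k).left)] :
    MorphismProperty.HasSmallObjectArgument.{u}
      (MorphismProperty.ofHoms fun k => T.toMonad.free.map (i k).hom) := by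
  refine ⟨Cardinal.aleph0.{u}, Cardinal.fact_isRegular_aleph0, Cardinal.orderBotAleph0OrdToType, ?_⟩
  let _ := Cardinal.orderBotAleph0OrdToType.{u}
  have := Cardinal.fact_isRegular_aleph0.{u}
  refine { isSmall := MorphismProperty.isSmall_ofHoms _, preservesColimit := ?_ }
  rintro _ _ _ _ _ ⟨k⟩ f hf
  infer_instance

lemma rlp_ofHoms_free_iff {ι : Type} (i : ι → Arrow Cat.{u, u}) {A B : T.Alg} (p : A ⟶ B) :
    (MorphismProperty.ofHoms fun k => T.toMonad.free.map (i k).hom).rlp p ↔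
      (MorphismProperty.ofHoms fun k => (i k).hom).rlp p.f := by
  constructor
  · rintro h _ _ _ ⟨k⟩
    exact (T.toMonad.adj.hasLiftingProperty_iff _ _).1 (h _ ⟨k⟩)
  · rintro h _ _ _ ⟨k⟩
    exact (T.toMonad.adj.hasLiftingProperty_iff _ _).2 (h _ ⟨k⟩)

end SmallObject

/-! ### Transfer of the model structure from `Cat` to algebras. -/

section ModelCategory

variable {T : FinitaryMonad.{u}}

/-- The generating trivial cofibration of `Cat`, as a family. -/
def generatingTrivialCofibration : Unit → Arrow Cat.{u, u} := fun _ => Arrow.mk pointToIso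

instance (k : Unit) : Finite (Arrow (generatingTrivialCofibration.{u} k).left) :=
  inferInstanceAs (Finite (Arrow (Discrete PUnit)))

/-- The generating cofibrations of the category of algebras. -/
def algGeneratingCofibrations (T : FinitaryMonad.{u}) : MorphismProperty T.Alg :=
  MorphismProperty.ofHoms fun k => T.toMonad.free.map (generatingCofibration k).hom

/-- The generating trivial cofibrations of the category of algebras. -/
def algGeneratingTrivialCofibrations (T : FinitaryMonad.{u}) : MorphismProperty T.Alg :=
  MorphismProperty.ofHoms fun k => T.toMonad.free.map (generatingTrivialCofibration k).hom

instance : MorphismProperty.HasSmallObjectArgument.{u} (algGeneratingCofibrations T) :=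
  hasSmallObjectArgument generatingCofibration

instance : MorphismProperty.HasSmallObjectArgument.{u} (algGeneratingTrivialCofibrations T) :=
  hasSmallObjectArgument generatingTrivialCofibration

instance : MorphismProperty.HasFactorization (algGeneratingCofibrations T).rlp.llp
    (algGeneratingCofibrations T).rlp :=
  have := MorphismProperty.instHasFunctorialFactorizationLlpRlp.{u} (algGeneratingCofibrations T)
  inferInstance

instance : MorphismProperty.HasFactorization (algGeneratingTrivialCofibrations T).rlp.llp
    (algGeneratingTrivialCofibrations T).rlp :=
  have := MorphismProperty.instHasFunctorialFactorizationLlpRlp.{u}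
    (algGeneratingTrivialCofibrations T)
  inferInstance

lemma rlp_algGeneratingCofibrations :
    (algGeneratingCofibrations T).rlp = trivialFibrations T.Alg := by
  ext A B p
  exact (rlp_ofHoms_free_iff _ p).trans (rlp_generatingCofibration_iff p.f)

lemma rlp_algGeneratingTrivialCofibrations :
    (algGeneratingTrivialCofibrations T).rlp = fibrations T.Alg := by
  ext A B p
  refine (rlp_ofHoms_free_iff generatingTrivialCofibration p).trans ?_
  refine Iff.trans ⟨fun h => ?_, ?_⟩ (hasLiftingProperty_pointToIso_iff p.f)
  · exact h _ (MorphismProperty.ofHoms.mk (f := fun k => (generatingTrivialCofibration k).hom) ())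
  · rintro h _ _ _ ⟨_⟩
    exact h

instance : (weakEquivalences T.Alg).HasTwoOutOfThreeProperty :=
  inferInstanceAs (catWeakEquivalences.inverseImage T.toMonad.forget).HasTwoOutOfThreeProperty

/-- The morphisms with the left lifting property with respect to fibrations are weak
equivalences. -/
lemma weakEquivalences_of_llp_fibrations {A B : T.Alg} (j : A ⟶ B)
    (hj : (fibrations T.Alg).llp j) : weakEquivalences T.Alg j := by
  -- Every algebra is fibrant, so lifting the identity of `A` gives a retraction of `j`.
  have : HasLiftingProperty j (FinitaryMonad.toPointAlg A) :=
    hj _ (catFibrations_toPoint A.A)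
  have sq : CommSq (𝟙 A) j (FinitaryMonad.toPointAlg A) (FinitaryMonad.toPointAlg B) :=
    ⟨CategoryTheory.Monad.Algebra.Hom.ext (point_hom_ext _ _)⟩
  let r : B ⟶ A := sq.lift
  have hr : j ≫ r = 𝟙 A := sq.fac_left
  let P := FinitaryMonad.pathAlg B
  let p₀ : P ⟶ B := FinitaryMonad.algEvId (FinitaryMonad.cstHom_evHom .zero) B
  let p₁ : P ⟶ B := FinitaryMonad.algEvId (FinitaryMonad.cstHom_evHom .one) B
  let p : P ⟶ FinitaryMonad.prodAlg B B := FinitaryMonad.prodAlgLift p₀ p₁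
  have : HasLiftingProperty j p := hj _ (catFibrations_prodLift_ev B.A)
  -- A lift against the end-point fibration of the path algebra is an isomorphism from `r ≫ j` to
  -- the identity, constant along `j`.
  have sq' : CommSq (j ≫ FinitaryMonad.algCst B) j p (FinitaryMonad.prodAlgLift (r ≫ j) (𝟙 B)) := by
    refine ⟨CategoryTheory.Monad.Algebra.Hom.ext (prodCat_hom_ext ?_ ?_)⟩
    · change j.f = (j ≫ r ≫ j).f
      rw [reassoc_of% hr]
    · rfl
  have h := congrArg CategoryTheory.Monad.Algebra.Hom.f sq'.fac_right
  let H : B.A ⟶ pow.obj B.A := sq'.lift.f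
  have h₀ : H ≫ ev B.A .zero = r.f ≫ j.f := congrArg (· ≫ prodFst _ _) h
  have h₁ : H ≫ ev B.A .one = 𝟙 B.A := congrArg (· ≫ prodSnd _ _) h
  exact isEquivalence_of_iso
    (eqToIso (congrArg CategoryTheory.Monad.Algebra.Hom.f hr))
    (eqToIso h₀.symm ≪≫ Bicategory.whiskerLeftIso H (evIso B.A .zero .one) ≪≫ eqToIso h₁)

/-- The nontrivial inclusion is the retract argument: factor `j` through `h.i` followed by a
fibration. The fibration is trivial by two-out-of-three, so `j` lifts against it and is a retract of
`h.i`. -/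
lemma llp_fibrations : (fibrations T.Alg).llp = trivialCofibrations T.Alg := by
  refine le_antisymm (fun A B j hj => ⟨fun X Y p hp => hj p hp.1,
    weakEquivalences_of_llp_fibrations j hj⟩) (fun A B j hj => ?_)
  have h := MorphismProperty.factorizationData (algGeneratingTrivialCofibrations T).rlp.llp
    (algGeneratingTrivialCofibrations T).rlp j
  have hi : (fibrations T.Alg).llp h.i := by
    rw [← rlp_algGeneratingTrivialCofibrations]
    exact h.hi
  have hp : fibrations T.Alg h.p := by
    rw [← rlp_algGeneratingTrivialCofibrations]
    exact h.hp
  have hp' : weakEquivalences T.Alg h.p := by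
    refine (weakEquivalences T.Alg).of_precomp h.i h.p (weakEquivalences_of_llp_fibrations _ hi) ?_
    rw [h.fac]
    exact hj.2
  have : HasLiftingProperty j h.p := hj.1 h.p ⟨hp, hp'⟩
  exact MorphismProperty.of_retract (RetractArrow.ofLeftLiftingProperty h.fac) hi

instance : MorphismProperty.IsWeakFactorizationSystem (cofibrations T.Alg)
    (trivialFibrations T.Alg) where
  rlp := by
    change (trivialFibrations T.Alg).llp.rlp = _
    rw [← rlp_algGeneratingCofibrations, MorphismProperty.rlp_llp_rlp]
  llp := rfl
  hasFactorization := by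
    change MorphismProperty.HasFactorization (trivialFibrations T.Alg).llp _
    rw [← rlp_algGeneratingCofibrations]
    infer_instance

instance : MorphismProperty.IsWeakFactorizationSystem (trivialCofibrations T.Alg)
    (fibrations T.Alg) where
  rlp := by
    rw [← llp_fibrations, ← rlp_algGeneratingTrivialCofibrations, MorphismProperty.rlp_llp_rlp]
  llp := llp_fibrations
  hasFactorization := by
    rw [← llp_fibrations, ← rlp_algGeneratingTrivialCofibrations]
    infer_instance

/-- The Lack model structure on the category of algebras of a finitary 2-monad. -/
noncomputable abbrev lackModelCategory (T : FinitaryMonad.{u}) : ModelCategory T.Alg :=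
  ModelCategory.mk' _

lemma isLackModelStructure_lackModelCategory (T : FinitaryMonad.{u}) :
    IsLackModelStructure T (lackModelCategory T) where
  weakEquivalences_eq := rfl
  fibrations_eq := rfl

end ModelCategory

/-! ## The Quillen equivalence -/

namespace FinitaryMonad

variable {T T' : FinitaryMonad.{u}}

/-- The source and the target of an isomorphism in an algebra, as morphisms of algebras. -/
def algEvComp {S R : CategoryTheory.Monad Cat.{u, u}} {k : S ⟶ T.powMonad} {i : WalkingIso.{0}}
    {φ : S ⟶ R} {g : R ⟶ T.toMonad} (hk : k ≫ T.evHom i = φ ≫ g) (A : T.Alg) :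
    (CategoryTheory.Monad.algebraFunctorOfMonadHom k).obj (T.powAlg A) ⟶
      (CategoryTheory.Monad.algebraFunctorOfMonadHom φ).obj
        ((CategoryTheory.Monad.algebraFunctorOfMonadHom g).obj A) where
  f := ev A.A i
  h := by
    refine Eq.trans ?_ (powAlg_ev k i A)
    rw [hk]
    exact congrArg (_ ≫ ·) (Category.assoc (φ.app A.A) (g.app A.A) A.a).symm

/-- If `e` is a morphism of algebras along `f`, then `pow.map e` is one along `powHom f`. -/
lemma powStr_nat (f : T ⟶ T') {Y Z : Cat.{u, u}} {y : T.obj Y ⟶ Y} {z : T'.obj Z ⟶ Z}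
    {e : Y ⟶ Z} (he : T.map e ≫ f.toMonadHom.app Z ≫ z = y ≫ e) :
    pow.map (T.map (pow.map e)) ≫ pow.map (f.toMonadHom.app (pow.obj Z)) ≫ T'.powStr z =
      T.powStr y ≫ pow.map e := by
  have h₁ : pow.map (f.toMonadHom.app (pow.obj Z)) ≫ pow.map (T'.lam Z) =
      pow.map (T.lam Z) ≫ pow.map (pow.map (f.toMonadHom.app Z)) := by
    rw [← pow.map_comp, lam_hom, pow.map_comp]
  have h₂ : pow.map (T.map (pow.map e)) ≫ pow.map (T.lam Z) =
      pow.map (T.lam Y) ≫ pow.map (pow.map (T.map e)) := by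
    rw [← pow.map_comp, lam_nat, pow.map_comp]
  rw [powStr, reassoc_of% h₁, reassoc_of% h₂, diag_nat_assoc, diag_nat_assoc, ← pow.map_comp,
    ← pow.map_comp, he, powStr, Category.assoc, Category.assoc, pow.map_comp]

/-- The functoriality of the algebras of isomorphisms. -/
def powAlgMap {f : T ⟶ T'} {k : T.toMonad ⟶ T.powMonad} {h : T'.toMonad ⟶ T'.powMonad}
    (hk : k ≫ powHom f = f.toMonadHom ≫ h) {A : T.Alg} {B : T'.Alg} (e : A ⟶ (restrict f).obj B) :
    (CategoryTheory.Monad.algebraFunctorOfMonadHom k).obj (T.powAlg A) ⟶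
      (restrict f).obj ((CategoryTheory.Monad.algebraFunctorOfMonadHom h).obj (T'.powAlg B)) where
  f := pow.map e.f
  h := by
    have hk' : k.app (pow.obj B.A) ≫ pow.map (f.toMonadHom.app (pow.obj B.A)) =
        f.toMonadHom.app (pow.obj B.A) ≫ h.app (pow.obj B.A) :=
      congrArg (fun m : T.toMonad ⟶ T'.powMonad => m.app (pow.obj B.A)) hk
    have hn : T.map (pow.map e.f) ≫ k.app (pow.obj B.A) =
        k.app (pow.obj A.A) ≫ pow.map (T.map (pow.map e.f)) := k.naturality (pow.map e.f)
    have key {P Q R V W : Cat.{u, u}} (a : P ⟶ Q) (b : Q ⟶ R) (b' : Q ⟶ pow.obj V)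
        (c' : pow.obj V ⟶ pow.obj W) (c : R ⟶ pow.obj W) (d : pow.obj W ⟶ pow.obj B.A)
        (hb : b' ≫ c' = b ≫ c) : a ≫ b ≫ c ≫ d = (a ≫ b') ≫ c' ≫ d := by
      rw [Category.assoc, reassoc_of% hb]
    refine (key _ _ _ _ _ _ hk').trans ((congrArg (· ≫ _) hn).trans ?_)
    exact (Category.assoc _ _ _).trans ((congrArg (_ ≫ ·) (powStr_nat f e.h)).trans
      (Category.assoc _ _ _).symm)

end FinitaryMonad

/-- Apply the lifting property of the end-point functor to the given isomorphism of targets, paired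
with the identity of the source. -/
lemma catFibrations_ev_one (X : Cat.{u, u}) : catFibrations (ev X .one) := by
  intro x y e
  obtain ⟨x', e', h, he⟩ := catFibrations_prodLift_ev X x ((ev X .zero).toFunctor.obj x, y)
    (Iso.prod (Iso.refl _) e)
  refine ⟨x', e', congrArg Prod.snd h, ?_⟩
  refine Iso.ext (Eq.trans ?_ (congrArg (fun m => (prodSnd X X).toFunctor.map m)
    (congrArg Iso.hom he)))
  exact (congrArg (_ ≫ ·) (eqToHom_map (prodSnd X X).toFunctor h).symm).trans
    ((prodSnd X X).toFunctor.map_comp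
      ((prodLift (ev X .zero) (ev X .one)).toFunctor.map e'.hom) (eqToHom h)).symm

lemma catWeakEquivalences_ev (X : Cat.{u, u}) (i : WalkingIso.{0}) :
    catWeakEquivalences (ev X i) :=
  have : (ev X i).toFunctor.Full := (evFullyFaithful X i).full
  have : (ev X i).toFunctor.Faithful := (evFullyFaithful X i).faithful
  have : (ev X i).toFunctor.EssSurj := ⟨fun x => ⟨(cst X).toFunctor.obj x, ⟨Iso.refl _⟩⟩⟩
  { }

/-! ### The Quillen adjunction and its unit at cofibrant algebras. -/

section

variable {T T' : FinitaryMonad.{u}} {f : T ⟶ T'} {F : T.Alg ⥤ T'.Alg} (adj : F ⊣ restrict f)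

include adj

/-- Restriction preserves trivial fibrations, as these are detected on underlying functors; lifting
problems then transpose along the adjunction. -/
lemma cofibrations_map {A B : T.Alg} {i : A ⟶ B} (hi : cofibrations T.Alg i) :
    cofibrations T'.Alg (F.map i) := by
  intro X Y p hp
  exact (adj.hasLiftingProperty_iff i p).2 (hi _ hp)

lemma trivialCofibrations_map {A B : T.Alg} {i : A ⟶ B} (hi : trivialCofibrations T.Alg i) :
    trivialCofibrations T'.Alg (F.map i) := by
  rw [← llp_fibrations] at hi ⊢
  intro X Y p hp
  exact (adj.hasLiftingProperty_iff i p).2 (hi _ hp)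

lemma hom_ext_of_unit {A : T.Alg} {Z : T'.Alg} {x y : F.obj A ⟶ Z}
    (h : (adj.unit.app A).f ≫ x.f = (adj.unit.app A).f ≫ y.f) : x = y :=
  (adj.homEquiv A Z).injective (by
    rw [adj.homEquiv_unit, adj.homEquiv_unit]
    exact CategoryTheory.Monad.Algebra.Hom.ext h)

lemma exists_unit_comp {A : T.Alg} {Z : T'.Alg} (v : A ⟶ (restrict f).obj Z) :
    ∃ w : F.obj A ⟶ Z, (adj.unit.app A).f ≫ w.f = v.f :=
  ⟨(adj.homEquiv A Z).symm v, congrArg CategoryTheory.Monad.Algebra.Hom.f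
    ((adj.homEquiv_unit A Z _).symm.trans ((adj.homEquiv A Z).apply_symm_apply v))⟩

/-- The unit of the adjunction is a weak equivalence at the cofibrant algebras. -/
theorem isEquivalence_unit (hf : WeakEquivalence f) (hT' : T'.IsFlexible) (A : T.Alg)
    (hA : cofibrations T.Alg (initial.to A)) : catWeakEquivalences (adj.unit.app A).f := by
  obtain ⟨g, h, h₀, h₁⟩ := exists_homotopySection f hf hT'
  obtain ⟨k, k₀, k₁, hk⟩ := exists_homotopyLift f hf g h h₀ h₁
  let W := (CategoryTheory.Monad.algebraFunctorOfMonadHom k).obj (T.powAlg A)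
  let p₁ : W ⟶ A := FinitaryMonad.algEvId k₁ A
  -- The target projection is a trivial fibration and `A` is cofibrant, so the projection has a
  -- section `s` by morphisms of `T`-algebras.
  have : HasLiftingProperty (initial.to A) p₁ :=
    hA _ ⟨catFibrations_ev_one A.A, catWeakEquivalences_ev A.A .one⟩
  have sq : CommSq (initial.to W) (initial.to A) p₁ (𝟙 A) := ⟨initial.hom_ext _ _⟩
  let s : A ⟶ W := sq.lift
  let H : A.A ⟶ pow.obj A.A := s.f
  have hs : H ≫ ev A.A .one = 𝟙 A.A :=
    congrArg CategoryTheory.Monad.Algebra.Hom.f sq.fac_right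
  -- The source of `s` is a morphism to the restriction of `A` along `f ≫ g`; its transpose `v` is
  -- the candidate inverse of the unit.
  obtain ⟨v, hv⟩ := exists_unit_comp adj (s ≫ FinitaryMonad.algEvComp k₀ A)
  -- The relation `hk` between `k` and `h` makes `pow.map` of the unit a morphism of `T`-algebras.
  -- The transpose `t` carries the homotopy on `A` over to `F.obj A`.
  obtain ⟨t, ht⟩ := exists_unit_comp adj (s ≫ FinitaryMonad.powAlgMap hk (adj.unit.app A))
  let η : A.A ⟶ (F.obj A).A := (adj.unit.app A).f
  let v' : (F.obj A).A ⟶ A.A := v.f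
  let K : (F.obj A).A ⟶ pow.obj (F.obj A).A := t.f
  have hv' : η ≫ v' = H ≫ ev A.A .zero := hv
  have hK : η ≫ K = H ≫ pow.map η := ht
  -- The end points of `K` are identified as algebra morphisms out of `F.obj A`, where it is enough
  -- to compare after the unit.
  have hK₁ : K ≫ ev _ .one = 𝟙 _ := by
    have : t ≫ FinitaryMonad.algEvId h₁ (F.obj A) = 𝟙 _ := hom_ext_of_unit adj (by
      change η ≫ K ≫ ev _ .one = η ≫ 𝟙 _
      rw [reassoc_of% hK, pow_map_ev, reassoc_of% hs, Category.comp_id])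
    exact congrArg CategoryTheory.Monad.Algebra.Hom.f this
  have hK₀ : K ≫ ev _ .zero = v' ≫ η := by
    have : t ≫ FinitaryMonad.algEvComp h₀ (F.obj A) =
        v ≫ (CategoryTheory.Monad.algebraFunctorOfMonadHom g).map (adj.unit.app A) :=
      hom_ext_of_unit adj (by
        change η ≫ K ≫ ev _ .zero = η ≫ v' ≫ η
        rw [reassoc_of% hK, pow_map_ev, reassoc_of% hv'])
    exact congrArg CategoryTheory.Monad.Algebra.Hom.f this
  exact isEquivalence_of_iso
    (eqToIso hv' ≪≫ Bicategory.whiskerLeftIso H (evIso A.A .zero .one) ≪≫ eqToIso hs)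
    (eqToIso hK₀.symm ≪≫ Bicategory.whiskerLeftIso K (evIso _ .zero .one) ≪≫ eqToIso hK₁)

/-- On underlying functors the adjunct of `φ` is the unit followed by `φ`. Since the unit is an
equivalence at cofibrant algebras, two-out-of-three concludes. -/
theorem isQuillenEquivalence_restrict (hf : WeakEquivalence f) (hT' : T'.IsFlexible) :
    @IsQuillenEquivalence _ _ _ _ (lackModelCategory T) (lackModelCategory T') _ _ adj := by
  let _ := lackModelCategory T
  let _ := lackModelCategory T'
  refine ⟨fun i hi => ⟨cofibrations_map adj hi.mem⟩,
    fun i hi hi' => ⟨(trivialCofibrations_map adj ⟨hi.mem, hi'.mem⟩).2⟩, fun {A Y} φ hA _ => ?_⟩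
  have h := isEquivalence_unit adj hf hT' A hA.mem
  rw [weakEquivalence_iff, weakEquivalence_iff, adj.homEquiv_unit]
  exact (catWeakEquivalences.precomp_iff (adj.unit.app A).f φ.f h).symm

end

end CatTwoMonad

theorem mainTheorem9 {T T' : CatTwoMonad.FinitaryMonad.{u}} (f : T ⟶ T')
    (hf : WeakEquivalence f) (hT : T.IsFlexible) (hT' : T'.IsFlexible) :
    ∃ (M : ModelCategory T.Alg) (M' : ModelCategory T'.Alg),
      CatTwoMonad.IsLackModelStructure T M ∧ CatTwoMonad.IsLackModelStructure T' M' ∧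
      ∃ (F : T.Alg ⥤ T'.Alg) (adj : F ⊣ CatTwoMonad.restrict f),
        CatTwoMonad.IsQuillenEquivalence adj := by
  exact ⟨CatTwoMonad.lackModelCategory T, CatTwoMonad.lackModelCategory T',
    CatTwoMonad.isLackModelStructure_lackModelCategory T,
    CatTwoMonad.isLackModelStructure_lackModelCategory T', _,
    Adjunction.ofIsRightAdjoint (CatTwoMonad.restrict f),
    CatTwoMonad.isQuillenEquivalence_restrict _ hf hT'⟩
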